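/- **Setting.** For $0<\varepsilon<\tfrac12$ consider the periodic Lorentz gas in $\mathbb R^2$ whose scatterers are the disks of radius $\varepsilon$ centred at the points of $\mathbb Z^2$. The billiard map $T_\varepsilon$ acts on $\mathcal M=\mathbb S^1\times[-\frac\pi2,\frac\pi2]$, $\mathbb S^1=\mathbb R/2\pi\mathbb Z$: a collision $(\theta,\phi)$ takes place at the point $(\varepsilon\sin\theta,\varepsilon\cos\theta)$ of the scatterer (translated to the origin) and $\phi$ is the outgoing angle with the outward normal, positive in the direction of increasing $\theta$; grazing contacts count as collisions. The displacement $\kappa_\varepsilon:\mathcal M\to\mathbb Z^2$ is the difference of lattice points between a collision and the next one, $\tau_{\min}$ is the shortest free flight time, $\mathcal S_0=\{\phi=\pm\frac\pi2\}$ and $\mathcal S_1=\mathcal S_0\cup T_\varepsilon^{-1}\mathcal S_0$. For $r_0>1$ and a fixed integer $k_0\ge1$ the homogeneity strips are $\mathbb H_{\pm k}=\{\,|\pm\frac\pi2-\phi|\in[(k+1)^{-r_0},k^{-r_0})\}$, $k\ge k_0$, together with the remaining central region. Lengths $|\cdot|$ of curves in $\mathcal M$ are with respect to $d\theta^2+d\phi^2$,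 and $|\kappa_\varepsilon|$ is the Euclidean norm. Fix $B$. For $c>0$ and $\nu\ge0$ put $\delta_0=c\,\varepsilon^{\nu}$. An *admissible stable leaf* is a $C^2$ curve $W\subset\mathcal M$, a graph $\phi=w(\theta)$ over a nondegenerate interval, with tangent lines in the stable cone $-1-\varepsilon/\tau_{\min}\le d\phi/d\theta\le-1$, with $|w''|\le B$, contained in a single homogeneity strip, on which $\kappa_\varepsilon$ is constant, and with $|W|\le\delta_0$. The pieces $V_i$ are the connected components of $T_\varepsilon^{-1}W$ after removal of $\mathcal S_1$ and of the boundaries of the homogeneity strips; $\kappa_\varepsilon$ is constant on each $V_i$, and $\kappa_\varepsilon(V_i)$ denotes its value. (A piece consisting of a single point contributes $0$ to the sum below.) **Proposition.** Let $k_0\ge 1$, $B$ and $\eta>0$ be fixed. Consider the estimate $$\sum_i|\kappa_\varepsilon(V_i)|^{\nu}\,\frac{|T_\varepsilon V_i|}{|V_i|}\;\le\;C\left(\varepsilon+\varepsilon^{-\nu}\delta_0\right).\qquad(*)$$ 1. For every $c>0$ and every $\varepsilon_{\max}<\frac12$ there is a constant $C>0$ such that $(*)$ holds for all $r_0>1$,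 all $0\le\nu\le\frac12-\frac1{2r_0}-\eta$, all $0<\varepsilon\le\varepsilon_{\max}$ and every admissible stable leaf $W$. 2. For small $\varepsilon$ the constant does not depend on $c$: there is a constant $C>0$ such that for every $c>0$ there is $\varepsilon_0\in(0,\frac12)$ such that $(*)$ holds for all $r_0>1$, all $0\le\nu\le\frac12-\frac1{2r_0}-\eta$, all $0<\varepsilon\le\varepsilon_0$ and every admissible stable leaf $W$. In particular, for each fixed $r_0$ and each $0\le\nu<\frac12-\frac1{2r_0}$ the constant $C$ is uniform in $\varepsilon$ as $\varepsilon\to0$, although the number of open corridors is unbounded in this limit. -/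

import Mathlib

open Set MeasureTheory
open scoped ENNReal Real

noncomputable section

namespace LorentzGas

/-- The Borel `σ`-algebra on the circle `ℝ / 2πℤ`. -/
instance instMeasurableSpaceAngle : MeasurableSpace Real.Angle := borel Real.Angle

instance instBorelSpaceAngle : BorelSpace Real.Angle := ⟨rfl⟩

/-- The cylinder `𝕊¹ × ℝ` with the Euclidean product metric `dθ² + dφ²`, where `𝕊¹ = ℝ / 2πℤ`.
A collision is a pair `(θ, φ)`: `θ` is the (clockwise) position on the scatterer and `φ` the
outgoing angle with the outward normal, positive in the direction of increasing `θ`. -/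
abbrev Cylinder : Type := WithLp 2 (Real.Angle × ℝ)

/-- The point of the cylinder with coordinates `(θ, φ)`. -/
def point (θ φ : ℝ) : Cylinder := WithLp.toLp 2 ((θ : Real.Angle), φ)

/-- The phase space `𝕊¹ × [-π/2, π/2]` of the billiard map. -/
def phaseSpace : Set Cylinder := {x | x.snd ∈ Icc (-(π / 2)) (π / 2)}

/-- The collision point `(ε sin θ, ε cos θ)` on the scatterer of radius `ε` at the origin.
The plane `ℝ²` is identified with `ℂ`. -/
def position (ε : ℝ) (x : Cylinder) : ℂ := ⟨ε * x.fst.sin, ε * x.fst.cos⟩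

/-- The unit outgoing velocity `cos φ • n + sin φ • t`, for the outward normal
`n = (sin θ, cos θ)` and the tangent vector `t = (cos θ, - sin θ)`. -/
def velocity (x : Cylinder) : ℂ :=
  ⟨Real.cos x.snd * x.fst.sin + Real.sin x.snd * x.fst.cos,
    Real.cos x.snd * x.fst.cos - Real.sin x.snd * x.fst.sin⟩

/-- The lattice point `ℓ ∈ ℤ²` as a point of the plane. -/
def latticePoint (ℓ : ℤ × ℤ) : ℂ := ⟨(ℓ.1 : ℝ), (ℓ.2 : ℝ)⟩

/-- The free flight time `τ(x)`: the first positive time at which the particle is on (or in) one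
of the closed disks of radius `ε` around the lattice points. Grazing contacts are collisions. -/
def flightTime (ε : ℝ) (x : Cylinder) : ℝ :=
  sInf {t : ℝ | 0 < t ∧ ∃ ℓ : ℤ × ℤ, ‖position ε x + (t : ℂ) * velocity x - latticePoint ℓ‖ ≤ ε}

/-- The shortest free flight time. -/
def minFlightTime (ε : ℝ) : ℝ := sInf (flightTime ε '' phaseSpace)

/-- The point of the plane where the next collision takes place. -/
def nextPoint (ε : ℝ) (x : Cylinder) : ℂ := position ε x + (flightTime ε x : ℂ) * velocity x

/-- The displacement function `κ_ε(x) ∈ ℤ²`: the centre of the scatterer of the next collision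
(it is unique, the closed disks being pairwise disjoint for `ε < 1/2`). -/
def displacement (ε : ℝ) (x : Cylinder) : ℤ × ℤ :=
  Classical.epsilon fun ℓ : ℤ × ℤ => ‖nextPoint ε x - latticePoint ℓ‖ ≤ ε

/-- The coordinate `θ` of the next collision, for which
`nextPoint - latticePoint κ = (ε sin θ, ε cos θ)`. -/
def nextAngle (ε : ℝ) (x : Cylinder) : ℝ :=
  Complex.arg ⟨(nextPoint ε x - latticePoint (displacement ε x)).im,
    (nextPoint ε x - latticePoint (displacement ε x)).re⟩

/-- The billiard map `T_ε`. Elastic reflection preserves the component of the velocity along the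
tangent vector `t = (cos θ₁, - sin θ₁)`, and this component is the sine of the new angle `φ₁`. -/
def billiardMap (ε : ℝ) (x : Cylinder) : Cylinder :=
  point (nextAngle ε x)
    (Real.arcsin ((velocity x).re * Real.cos (nextAngle ε x)
      - (velocity x).im * Real.sin (nextAngle ε x)))

/-- The set `S₀` of grazing collisions. -/
def singularSetZero : Set Cylinder := {x | x.snd = π / 2 ∨ x.snd = -(π / 2)}

/-- The discontinuity set `S₁ = S₀ ∪ T_ε⁻¹ S₀`. -/
def singularSetOne (ε : ℝ) : Set Cylinder :=
  singularSetZero ∪ {x ∈ phaseSpace | billiardMap ε x ∈ singularSetZero}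

/-- The homogeneity strip `ℍ_k`, close to `φ = π/2`. -/
def upperStrip (r₀ : ℝ) (k : ℕ) : Set Cylinder :=
  {x | |π / 2 - x.snd| ∈ Ico (((k : ℝ) + 1) ^ (-r₀)) ((k : ℝ) ^ (-r₀))} ∩ phaseSpace

/-- The homogeneity strip `ℍ_{-k}`, close to `φ = -π/2`. -/
def lowerStrip (r₀ : ℝ) (k : ℕ) : Set Cylinder :=
  {x | |-(π / 2) - x.snd| ∈ Ico (((k : ℝ) + 1) ^ (-r₀)) ((k : ℝ) ^ (-r₀))} ∩ phaseSpace

/-- The remaining, central part of the phase space, outside all strips `ℍ_{±k}`, `k ≥ k₀`. -/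
def centralStrip (r₀ : ℝ) (k₀ : ℕ) : Set Cylinder :=
  {x | (k₀ : ℝ) ^ (-r₀) ≤ |π / 2 - x.snd| ∧ (k₀ : ℝ) ^ (-r₀) ≤ |-(π / 2) - x.snd|} ∩ phaseSpace

/-- The union of the boundary curves of the homogeneity strips. -/
def stripBoundaries (r₀ : ℝ) (k₀ : ℕ) : Set Cylinder :=
  {x | ∃ k : ℕ, k₀ ≤ k ∧
    (|π / 2 - x.snd| = (k : ℝ) ^ (-r₀) ∨ |-(π / 2) - x.snd| = (k : ℝ) ^ (-r₀))}

/-- `W` lies in a single homogeneity strip. -/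
def IsHomogeneous (r₀ : ℝ) (k₀ : ℕ) (W : Set Cylinder) : Prop :=
  W ⊆ centralStrip r₀ k₀ ∨ ∃ k : ℕ, k₀ ≤ k ∧ (W ⊆ upperStrip r₀ k ∨ W ⊆ lowerStrip r₀ k)

/-- The length of a curve in the phase space. -/
def length (V : Set Cylinder) : ℝ≥0∞ := μH[1] V

/-- The class of admissible stable leaves of length at most `δ₀`: `C²` curves, given as graphs
`φ = w(θ)` over intervals, with all tangent lines in the stable cone
`-1 - ε/τ_min ≤ dφ/dθ ≤ -1`, with second derivative bounded by `B`, contained in a single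
homogeneity strip, and on which `κ_ε` is constant. -/
def IsAdmissibleStableLeaf (ε r₀ : ℝ) (k₀ : ℕ) (B δ₀ : ℝ) (W : Set Cylinder) : Prop :=
  (∃ (I : Set ℝ) (w : ℝ → ℝ), I.OrdConnected ∧ I.Nontrivial ∧
    W = (fun θ => point θ (w θ)) '' I ∧
    ContDiffOn ℝ 2 w I ∧
    (∀ θ ∈ I, derivWithin w I θ ∈ Icc (-1 - ε / minFlightTime ε) (-1)) ∧
    (∀ θ ∈ I, |iteratedDerivWithin 2 w I θ| ≤ B)) ∧
  IsHomogeneous r₀ k₀ W ∧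
  (∃ ℓ : ℤ × ℤ, ∀ x ∈ W, displacement ε x = ℓ) ∧
  length W ≤ ENNReal.ofReal δ₀

/-- The maximal length `δ₀ = c ε^ν` of admissible stable leaves. -/
def leafSize (c ε ν : ℝ) : ℝ := c * ε ^ ν

/-- The preimage `T_ε⁻¹ W`, cut at the discontinuity set and at the boundaries of the
homogeneity strips. -/
def cutPreimage (ε r₀ : ℝ) (k₀ : ℕ) (W : Set Cylinder) : Set Cylinder :=
  {x ∈ phaseSpace | billiardMap ε x ∈ W} \ (singularSetOne ε ∪ stripBoundaries r₀ k₀)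

/-- The pieces `V_i` of the preimage of `W`: the connected components of the cut preimage. -/
def preimagePieces (ε r₀ : ℝ) (k₀ : ℕ) (W : Set Cylinder) : Set (Set Cylinder) :=
  {V | ∃ x ∈ cutPreimage ε r₀ k₀ W, V = connectedComponentIn (cutPreimage ε r₀ k₀ W) x}

/-- The value of the displacement function on a piece on which it is constant. -/
def pieceDisplacement (ε : ℝ) (V : Set Cylinder) : ℤ × ℤ :=
  Classical.epsilon fun ℓ : ℤ × ℤ => ∀ x ∈ V, displacement ε x = ℓ

/-- The one-step growth sum `∑ |κ_ε(V)|^ν |T_ε V| / |V|` over the pieces `V` of `T_ε⁻¹ W`,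
with values in `[0, ∞]`; `|κ_ε|` is the Euclidean norm. -/
def growthSum (ε r₀ ν : ℝ) (k₀ : ℕ) (W : Set Cylinder) : ℝ≥0∞ :=
  ∑' V : preimagePieces ε r₀ k₀ W,
    ENNReal.ofReal (‖latticePoint (pieceDisplacement ε V)‖ ^ ν) *
      (length (billiardMap ε '' (V : Set Cylinder)) / length (V : Set Cylinder))

end LorentzGas

end

/-!
By time reversal the preimages of a point `(θ, φ)` of the leaf are indexed by the scatterers `m`
that are visible from it in the direction `θ - φ`. Along the leaf this direction turns
monotonically and the rays form a divergent front, so the offset of the ray from a given `m` is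
monotone, and over a short part of the leaf the preimage on a given scatterer and homogeneity strip
is connected. A piece is therefore labelled by `m`, its strip and one of boundedly many parts of the
leaf.

On such a piece the billiard map contracts by at most a multiple of `ε cos φ / |m|`. A far scatterer
is reached only by crossing a corridor, hence it lies on a row next to that of the scatterer of
departure and is hit almost tangentially, which gives `cos φ ≲ (ε |m|) ^ (-1/2)`; on the strip
`ℍ_k` one has `cos φ ≤ k ^ (-r₀)`. Interpolating between the two bounds leaves a summable power of
`k` and a power of `|m|` that is summable over the visible scatterers: the near ones are counted in
the sector of directions of the leaf, whose width is at most `2 c ε ^ ν`, and the far ones in the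
rows next to the vectors spanning the corridors. The result is a multiple of `c + ε ^ (η / 2)`.
-/

noncomputable section

namespace LorentzGas

/-! ### Lattice vectors along a direction and free flight -/

/-- The component of a lattice vector along the direction `(sin α, cos α)`. -/
def along (α : ℝ) : ℤ × ℤ →+ ℝ where
  toFun m := m.1 * Real.sin α + m.2 * Real.cos α
  map_zero' := by simp
  map_add' m n := by
    simp only [Prod.fst_add, Prod.snd_add, Int.cast_add]
    ring

/-- The component of a lattice vector orthogonal to the direction `(sin α, cos α)`. -/
def across (α : ℝ) : ℤ × ℤ →+ ℝ where
  toFun m := m.1 * Real.cos α - m.2 * Real.sin α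
  map_zero' := by simp
  map_add' m n := by
    simp only [Prod.fst_add, Prod.snd_add, Int.cast_add]
    ring

lemma along_apply (α : ℝ) (m : ℤ × ℤ) : along α m = m.1 * Real.sin α + m.2 * Real.cos α := rfl

lemma across_apply (α : ℝ) (m : ℤ × ℤ) : across α m = m.1 * Real.cos α - m.2 * Real.sin α := rfl

lemma along_add_pi (α : ℝ) (m : ℤ × ℤ) : along (α + π) m = -along α m := by
  simp only [along_apply, Real.sin_add_pi, Real.cos_add_pi]
  ring

lemma across_add_pi (α : ℝ) (m : ℤ × ℤ) : across (α + π) m = -across α m := by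
  simp only [across_apply, Real.sin_add_pi, Real.cos_add_pi]
  ring

lemma latticePoint_add (m n : ℤ × ℤ) :
    latticePoint (m + n) = latticePoint m + latticePoint n := by
  apply Complex.ext <;> simp [latticePoint]

lemma latticePoint_neg (m : ℤ × ℤ) : latticePoint (-m) = -latticePoint m := by
  apply Complex.ext <;> simp [latticePoint]

lemma latticePoint_zero : latticePoint 0 = 0 := by
  apply Complex.ext <;> simp [latticePoint]

lemma norm_latticePoint_neg (m : ℤ × ℤ) : ‖latticePoint (-m)‖ = ‖latticePoint m‖ := by
  rw [latticePoint_neg, norm_neg]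

lemma norm_latticePoint_sq (m : ℤ × ℤ) :
    ‖latticePoint m‖ ^ 2 = (m.1 : ℝ) ^ 2 + (m.2 : ℝ) ^ 2 := by
  rw [← Complex.normSq_eq_norm_sq, Complex.normSq_apply, latticePoint]
  ring

lemma along_sq_add_across_sq (α : ℝ) (m : ℤ × ℤ) :
    along α m ^ 2 + across α m ^ 2 = ‖latticePoint m‖ ^ 2 := by
  rw [norm_latticePoint_sq, along_apply, across_apply]
  linear_combination ((m.1 : ℝ) ^ 2 + (m.2 : ℝ) ^ 2) * Real.sin_sq_add_cos_sq α

lemma one_le_norm_latticePoint {m : ℤ × ℤ} (hm : m ≠ 0) : 1 ≤ ‖latticePoint m‖ := by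
  rw [← one_le_sq_iff₀ (norm_nonneg _), norm_latticePoint_sq]
  have h : (1 : ℤ) ≤ m.1 ^ 2 + m.2 ^ 2 := by
    by_contra! hc
    have h1 : m.1 = 0 := by nlinarith [sq_nonneg m.1, sq_nonneg m.2]
    have h2 : m.2 = 0 := by nlinarith [sq_nonneg m.1, sq_nonneg m.2]
    exact hm (Prod.ext h1 h2)
  exact_mod_cast h

lemma abs_along_le (α : ℝ) (m : ℤ × ℤ) : |along α m| ≤ ‖latticePoint m‖ := by
  apply abs_le_of_sq_le_sq _ (norm_nonneg _)
  linarith [along_sq_add_across_sq α m, sq_nonneg (across α m)]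

lemma abs_across_le (α : ℝ) (m : ℤ × ℤ) : |across α m| ≤ ‖latticePoint m‖ := by
  apply abs_le_of_sq_le_sq _ (norm_nonneg _)
  linarith [along_sq_add_across_sq α m, sq_nonneg (along α m)]

lemma finite_norm_latticePoint_le (R : ℝ) : {ℓ : ℤ × ℤ | ‖latticePoint ℓ‖ ≤ R}.Finite := by
  apply ((Set.finite_Icc (-⌈R⌉) ⌈R⌉).prod (Set.finite_Icc (-⌈R⌉) ⌈R⌉)).subset
  intro ℓ hℓ
  have hre := (Complex.abs_re_le_norm (latticePoint ℓ)).trans hℓ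
  have him := (Complex.abs_im_le_norm (latticePoint ℓ)).trans hℓ
  simp only [latticePoint, abs_le] at hre him
  have hceil := Int.le_ceil R
  simp only [mem_prod, mem_Icc]
  refine ⟨⟨?_, ?_⟩, ?_, ?_⟩ <;> (rify; linarith)

lemma eq_of_norm_sub_latticePoint_le {ε : ℝ} (hε : ε < 1 / 2) {z : ℂ} {ℓ ℓ' : ℤ × ℤ}
    (h : ‖z - latticePoint ℓ‖ ≤ ε) (h' : ‖z - latticePoint ℓ'‖ ≤ ε) : ℓ = ℓ' := by
  by_contra hne
  have hsep := one_le_norm_latticePoint (sub_ne_zero.mpr hne)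
  have hsub : latticePoint (ℓ - ℓ') = (z - latticePoint ℓ') - (z - latticePoint ℓ) := by
    rw [sub_eq_add_neg, latticePoint_add, latticePoint_neg]
    ring
  rw [hsub] at hsep
  linarith [norm_sub_le (z - latticePoint ℓ') (z - latticePoint ℓ)]

/-- In the coordinates `(along α, across α)`, the hypotheses say that the segments
`[along α m - h, along α m + h]` and `[along α m' - h', along α m' + h']` of the line
`across = B` lie in the disks of radius `ε` around `m` and `m'`, which are disjoint. -/
lemma chord_lt_chord {ε B h h' α : ℝ} {m m' : ℤ × ℤ} (hε0 : 0 < ε) (hε : ε < 1 / 2)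
    (hh : 0 ≤ h) (hh' : 0 ≤ h') (hm : h ^ 2 + (B - across α m) ^ 2 ≤ ε ^ 2)
    (hm' : h' ^ 2 + (B - across α m') ^ 2 ≤ ε ^ 2) (hne : m ≠ m')
    (hle : along α m ≤ along α m') : along α m + h < along α m' - h' := by
  by_contra! hmeet
  obtain ⟨A, hA⟩ : ∃ A, A = max (along α m) (along α m' - h') := ⟨_, rfl⟩
  have hAm : (A - along α m) ^ 2 ≤ h ^ 2 :=
    sq_le_sq' (by linarith [le_max_left (along α m) (along α m' - h')])
      (by linarith [max_le (by linarith : along α m ≤ along α m + h) hmeet])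
  have hAm' : (A - along α m') ^ 2 ≤ h' ^ 2 :=
    sq_le_sq' (by linarith [le_max_right (along α m) (along α m' - h')])
      (by linarith [max_le hle (by linarith : along α m' - h' ≤ along α m')])
  have hsep : 1 ≤ ‖latticePoint (m - m')‖ ^ 2 :=
    one_le_pow₀ (one_le_norm_latticePoint (sub_ne_zero.mpr hne))
  rw [← along_sq_add_across_sq α, map_sub, map_sub] at hsep
  nlinarith [sq_nonneg ((A - along α m) + (A - along α m')),
    sq_nonneg ((B - across α m) + (B - across α m'))]

lemma exists_eq_point (x : Cylinder) : ∃ a f : ℝ, x = point a f := by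
  obtain ⟨a, ha⟩ := QuotientAddGroup.mk_surjective x.fst
  exact ⟨a, x.snd, WithLp.ofLp_injective 2 (Prod.ext ha.symm rfl)⟩

lemma point_eq_point_iff {a f b g : ℝ} :
    point a f = point b g ↔ (a : Real.Angle) = (b : Real.Angle) ∧ f = g := by
  rw [point, point, (WithLp.toLp_injective 2).eq_iff, Prod.mk.injEq]

lemma velocity_point (a f : ℝ) : velocity (point a f) = ⟨Real.sin (a + f), Real.cos (a + f)⟩ := by
  apply Complex.ext <;> simp [velocity, point, Real.sin_add, Real.cos_add] <;> ring

lemma position_point (ε a f : ℝ) :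
    position ε (point a f) = ⟨ε * Real.sin a, ε * Real.cos a⟩ := by
  simp [position, point]

lemma norm_position {ε : ℝ} (hε0 : 0 ≤ ε) (x : Cylinder) : ‖position ε x‖ = ε := by
  rw [← sq_eq_sq₀ (norm_nonneg _) hε0, ← Complex.normSq_eq_norm_sq, Complex.normSq_apply, position]
  linear_combination ε ^ 2 * x.fst.cos_sq_add_sin_sq

lemma norm_velocity (x : Cylinder) : ‖velocity x‖ = 1 := by
  rw [← sq_eq_sq₀ (norm_nonneg _) zero_le_one, ← Complex.normSq_eq_norm_sq, Complex.normSq_apply,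
    velocity]
  linear_combination x.fst.cos_sq_add_sin_sq +
    (x.fst.cos ^ 2 + x.fst.sin ^ 2) * Real.sin_sq_add_cos_sq x.snd

/-- The position at time `t` of the particle that leaves the collision `x` and ignores all further
scatterers. -/
def ray (ε : ℝ) (x : Cylinder) (t : ℝ) : ℂ := position ε x + (t : ℂ) * velocity x

/-- The times at which the ray of `x` is on or in one of the scatterers; the flight time is by
definition their infimum. -/
def hitTimes (ε : ℝ) (x : Cylinder) : Set ℝ :=
  {t : ℝ | 0 < t ∧ ∃ ℓ : ℤ × ℤ, ‖ray ε x t - latticePoint ℓ‖ ≤ ε}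

lemma continuous_ray (ε : ℝ) (x : Cylinder) : Continuous (ray ε x) := by
  unfold ray
  fun_prop

lemma norm_ray_sub_sq (ε a f t : ℝ) (ℓ : ℤ × ℤ) :
    ‖ray ε (point a f) t - latticePoint ℓ‖ ^ 2 =
      (t + ε * Real.cos f - along (a + f) ℓ) ^ 2 +
        (ε * Real.sin f + across (a + f) ℓ) ^ 2 := by
  obtain ⟨α, rfl⟩ : ∃ α, a = α - f := ⟨a + f, by ring⟩
  rw [ray, velocity_point, position_point, sub_add_cancel, ← Complex.normSq_eq_norm_sq,
    Complex.normSq_apply]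
  simp only [Complex.add_re, Complex.sub_re, Complex.add_im, Complex.sub_im,
    Complex.re_ofReal_mul, Complex.im_ofReal_mul, latticePoint, along_apply, across_apply,
    Real.sin_sub, Real.cos_sub]
  have hα := Real.cos_sq' α
  have hf := Real.cos_sq' f
  ring_nf
  simp only [hα, hf]
  ring

lemma norm_ray_sub_le_iff {ε : ℝ} (hε0 : 0 ≤ ε) (a f t : ℝ) (ℓ : ℤ × ℤ) :
    ‖ray ε (point a f) t - latticePoint ℓ‖ ≤ ε ↔
      (t + ε * Real.cos f - along (a + f) ℓ) ^ 2 +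
        (ε * Real.sin f + across (a + f) ℓ) ^ 2 ≤ ε ^ 2 := by
  rw [← norm_ray_sub_sq, sq_le_sq₀ (norm_nonneg _) hε0]

lemma lt_norm_ray_sub_zero {ε : ℝ} (hε0 : 0 ≤ ε) {x : Cylinder} (hx : 0 ≤ Real.cos x.snd) {t : ℝ}
    (ht : 0 < t) : ε < ‖ray ε x t - latticePoint 0‖ := by
  obtain ⟨a, f, rfl⟩ := exists_eq_point x
  replace hx : 0 ≤ Real.cos f := hx
  have hcross : 0 ≤ t * (ε * Real.cos f) := by positivity
  rw [← sq_lt_sq₀ hε0 (norm_nonneg _), norm_ray_sub_sq, map_zero, map_zero]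
  have hsq : 0 < t ^ 2 := by positivity
  linear_combination 2 * hcross + hsq - ε ^ 2 * Real.sin_sq_add_cos_sq f

lemma norm_latticePoint_le_of_hit {ε : ℝ} (hε0 : 0 ≤ ε) {x : Cylinder} {t : ℝ} (ht : 0 ≤ t)
    {ℓ : ℤ × ℤ} (h : ‖ray ε x t - latticePoint ℓ‖ ≤ ε) : ‖latticePoint ℓ‖ ≤ t + 2 * ε :=
  calc ‖latticePoint ℓ‖ = ‖position ε x + t * velocity x - (ray ε x t - latticePoint ℓ)‖ := by
        rw [ray, sub_sub_cancel]
    _ ≤ ‖position ε x‖ + ‖(t : ℂ) * velocity x‖ + ‖ray ε x t - latticePoint ℓ‖ :=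
        (norm_sub_le _ _).trans (by gcongr; exact norm_add_le _ _)
    _ ≤ t + 2 * ε := by
        rw [norm_position hε0, norm_mul, norm_velocity, Complex.norm_real, Real.norm_of_nonneg ht]
        linarith

lemma isCompact_hitTimes_inter_Iic {ε : ℝ} (hε0 : 0 < ε) (hε : ε < 1 / 2) {x : Cylinder}
    (hx : 0 ≤ Real.cos x.snd) (T : ℝ) : IsCompact (hitTimes ε x ∩ Iic T) := by
  have hfin : ({ℓ : ℤ × ℤ | ‖latticePoint ℓ‖ ≤ T + 2 * ε} \ {0}).Finite :=
    (finite_norm_latticePoint_le _).subset sdiff_subset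
  have hcompact : IsCompact (Icc 0 T ∩ ⋃ ℓ ∈ {ℓ : ℤ × ℤ | ‖latticePoint ℓ‖ ≤ T + 2 * ε} \ {0},
      {t : ℝ | ‖ray ε x t - latticePoint ℓ‖ ≤ ε}) :=
    isCompact_Icc.inter_right (hfin.isClosed_biUnion fun ℓ _ =>
      isClosed_le ((continuous_ray ε x).sub continuous_const).norm continuous_const)
  convert hcompact using 1
  ext t
  simp only [mem_inter_iff, mem_Iic, mem_Icc, mem_iUnion, exists_prop, mem_sdiff, mem_ofPred_eq,
    mem_singleton_iff]
  constructor
  · rintro ⟨⟨ht, ℓ, hℓ⟩, htT⟩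
    refine ⟨⟨ht.le, htT⟩, ℓ, ⟨(norm_latticePoint_le_of_hit hε0.le ht.le hℓ).trans (by linarith),
      ?_⟩, hℓ⟩
    rintro rfl
    exact hℓ.not_gt (lt_norm_ray_sub_zero hε0.le hx ht)
  · rintro ⟨⟨ht, htT⟩, ℓ, ⟨-, hℓ0⟩, hℓ⟩
    refine ⟨⟨ht.lt_of_ne ?_, ℓ, hℓ⟩, htT⟩
    rintro rfl
    refine hℓ0 (eq_of_norm_sub_latticePoint_le hε hℓ ?_)
    simp [ray, latticePoint_zero, norm_position hε0.le]

lemma isLeast_flightTime {ε : ℝ} (hε0 : 0 < ε) (hε : ε < 1 / 2) {x : Cylinder}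
    (hx : 0 ≤ Real.cos x.snd) (hne : (hitTimes ε x).Nonempty) :
    IsLeast (hitTimes ε x) (flightTime ε x) := by
  obtain ⟨T, hT⟩ := hne
  obtain ⟨τ, ⟨hτ, hτT⟩, hleast⟩ :=
    (isCompact_hitTimes_inter_Iic hε0 hε hx T).exists_isLeast ⟨T, hT, mem_Iic.mpr le_rfl⟩
  have h : IsLeast (hitTimes ε x) τ :=
    ⟨hτ, fun t ht => (le_total t T).elim (fun htT => hleast ⟨ht, htT⟩) hτT.trans⟩
  rwa [show flightTime ε x = τ from h.csInf_eq]

lemma displacement_spec {ε : ℝ} {x : Cylinder} {ℓ : ℤ × ℤ}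
    (h : ‖nextPoint ε x - latticePoint ℓ‖ ≤ ε) :
    ‖nextPoint ε x - latticePoint (displacement ε x)‖ ≤ ε :=
  Classical.epsilon_spec (p := fun ℓ : ℤ × ℤ => ‖nextPoint ε x - latticePoint ℓ‖ ≤ ε) ⟨ℓ, h⟩

lemma displacement_eq {ε : ℝ} (hε : ε < 1 / 2) {x : Cylinder} {ℓ : ℤ × ℤ}
    (h : ‖nextPoint ε x - latticePoint ℓ‖ ≤ ε) : displacement ε x = ℓ :=
  eq_of_norm_sub_latticePoint_le hε (displacement_spec h) h

lemma along_swap (α : ℝ) (m : ℤ × ℤ) : along (π / 2 - α) m.swap = along α m := by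
  simp only [along_apply, Prod.fst_swap, Prod.snd_swap, Real.sin_pi_div_two_sub,
    Real.cos_pi_div_two_sub]
  ring

lemma across_swap (α : ℝ) (m : ℤ × ℤ) : across (π / 2 - α) m.swap = -across α m := by
  simp only [across_apply, Prod.fst_swap, Prod.snd_swap, Real.sin_pi_div_two_sub,
    Real.cos_pi_div_two_sub]
  ring

/-- The approximation is by a fraction close to `cot α`. -/
lemma exists_coprime_abs_across_le_abs_sin_div {α : ℝ} (hα : Real.sin α ≠ 0) {n : ℕ} (hn : 0 < n) :
    ∃ e : ℤ × ℤ, IsCoprime e.1 e.2 ∧ |(e.1 : ℝ)| ≤ n ∧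
      |across α e| ≤ |Real.sin α| / (n + 1) := by
  obtain ⟨q, hq, hqn⟩ := Real.exists_rat_abs_sub_le_and_den_le (Real.cos α / Real.sin α) hn
  have hden : (0 : ℝ) < q.den := by exact_mod_cast q.den_pos
  have hnum : (q.num : ℝ) = q.den * q := by exact_mod_cast (Rat.den_mul_eq_num q).symm
  refine ⟨(q.den, q.num), ?_, ?_, ?_⟩
  · rw [Int.isCoprime_iff_gcd_eq_one, Int.gcd_comm]
    exact q.reduced
  · rw [Int.cast_natCast, abs_of_pos hden]
    exact_mod_cast hqn
  · calc |across α (q.den, q.num)|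
        = |Real.sin α * (q.den * (Real.cos α / Real.sin α - q))| := by
          rw [across_apply, hnum]
          congr 1
          push_cast
          field_simp
      _ = |Real.sin α| * (q.den * |Real.cos α / Real.sin α - q|) := by
          rw [abs_mul, abs_mul, abs_of_pos hden]
      _ ≤ |Real.sin α| * (q.den * (1 / ((n + 1) * q.den))) := by gcongr
      _ = |Real.sin α| / (n + 1) := by field_simp

lemma exists_coprime_abs_across_le_of_le_sin_sq {α : ℝ} (hα : 1 / 2 ≤ Real.sin α ^ 2) {n : ℕ}
    (hn : 0 < n) : ∃ e : ℤ × ℤ, IsCoprime e.1 e.2 ∧ |across α e| ≤ 1 / (n + 1) ∧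
      |along α e| * |across α e| ≤ 1 ∧ |along α e| ≤ 2 * (n + 1) := by
  have hsin0 : Real.sin α ≠ 0 := fun h => by norm_num [h] at hα
  have hsin : 1 / 2 ≤ |Real.sin α| := by
    nlinarith [abs_nonneg (Real.sin α), sq_abs (Real.sin α), Real.abs_sin_le_one α]
  obtain ⟨e, hcop, hfst, hacross⟩ := exists_coprime_abs_across_le_abs_sin_div hsin0 hn
  have hn1 : (0 : ℝ) < n + 1 := by positivity
  have hacross' : |across α e| ≤ 1 / (n + 1) :=
    hacross.trans (by gcongr; exact Real.abs_sin_le_one α)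
  have halong : |along α e| * |Real.sin α| ≤ n + 1 :=
    calc |along α e| * |Real.sin α| = |e.1 - across α e * Real.cos α| := by
          rw [← abs_mul, along_apply, across_apply]
          congr 1
          linear_combination (e.1 : ℝ) * Real.sin_sq_add_cos_sq α
      _ ≤ |(e.1 : ℝ)| + |across α e| * |Real.cos α| := (abs_sub _ _).trans_eq (by rw [abs_mul])
      _ ≤ n + 1 * 1 := by
          gcongr
          · exact hacross'.trans (by rw [div_le_one hn1]; linarith)
          · exact Real.abs_cos_le_one α
      _ = n + 1 := by ring
  refine ⟨e, hcop, hacross', ?_, by nlinarith [abs_nonneg (along α e)]⟩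
  calc |along α e| * |across α e| ≤ |along α e| * (|Real.sin α| / (n + 1)) := by gcongr
    _ = (|along α e| * |Real.sin α|) / (n + 1) := by ring
    _ ≤ 1 := by rwa [div_le_one hn1]

lemma exists_coprime_abs_across_le (α : ℝ) {n : ℕ} (hn : 0 < n) :
    ∃ e : ℤ × ℤ, IsCoprime e.1 e.2 ∧ |across α e| ≤ 1 / (n + 1) ∧
      |along α e| * |across α e| ≤ 1 ∧ |along α e| ≤ 2 * (n + 1) := by
  rcases le_total (1 / 2) (Real.sin α ^ 2) with hα | hα
  · exact exists_coprime_abs_across_le_of_le_sin_sq hα hn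
  · have hα' : 1 / 2 ≤ Real.sin (π / 2 - α) ^ 2 := by
      rw [Real.sin_pi_div_two_sub]
      linarith [Real.sin_sq_add_cos_sq α]
    obtain ⟨e, hcop, he⟩ := exists_coprime_abs_across_le_of_le_sin_sq hα' hn
    refine ⟨e.swap, hcop.symm, ?_⟩
    rwa [← e.swap_swap, along_swap, across_swap, abs_neg] at he

lemma ne_zero_of_isCoprime {e : ℤ × ℤ} (he : IsCoprime e.1 e.2) : e ≠ 0 := by
  rintro rfl
  exact not_isCoprime_zero_zero he

lemma exists_coprime_along_pos (α : ℝ) {n : ℕ} (hn : 0 < n) : ∃ e : ℤ × ℤ, IsCoprime e.1 e.2 ∧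
    0 < along α e ∧ |across α e| ≤ 1 / (n + 1) ∧ along α e * |across α e| ≤ 1 ∧
      along α e ≤ 2 * (n + 1) := by
  obtain ⟨e, hcop, hacross, hmul, halong⟩ := exists_coprime_abs_across_le α hn
  have hne : along α e ≠ 0 := by
    intro h0
    have hnorm := one_le_norm_latticePoint (ne_zero_of_isCoprime hcop)
    have hsq := along_sq_add_across_sq α e
    have hhalf : (1 : ℝ) / (n + 1) ≤ 1 / 2 := by
      have : (1 : ℝ) ≤ n := by exact_mod_cast hn
      gcongr
      linarith
    rw [h0, ← sq_abs (across α e)] at hsq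
    nlinarith [abs_nonneg (across α e)]
  rcases lt_or_gt_of_ne hne with hneg | hpos
  · rw [abs_of_neg hneg] at hmul halong
    refine ⟨-e, hcop.neg_neg, ?_⟩
    rw [map_neg, map_neg, abs_neg]
    exact ⟨neg_pos.mpr hneg, hacross, hmul, halong⟩
  · rw [abs_of_pos hpos] at hmul halong
    exact ⟨e, hcop, hpos, hacross, hmul, halong⟩

lemma hitTimes_nonempty {ε : ℝ} (hε0 : 0 < ε) (hε : ε < 1 / 2) {x : Cylinder}
    (hx : 0 < Real.cos x.snd) : (hitTimes ε x).Nonempty := by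
  obtain ⟨a, f, rfl⟩ := exists_eq_point x
  replace hx : 0 < Real.cos f := hx
  have hsin : |Real.sin f| < 1 := by
    apply abs_lt_of_sq_lt_sq _ zero_le_one
    nlinarith [Real.sin_sq_add_cos_sq f]
  obtain ⟨n, hn⟩ := exists_nat_one_div_lt (by nlinarith : 0 < ε - ε * |Real.sin f|)
  obtain ⟨e, hcop, hpos, hacross, -, -⟩ := exists_coprime_along_pos (a + f) n.succ_pos
  have hacross' : |across (a + f) e| ≤ ε - ε * |Real.sin f| := by
    refine hacross.trans (le_trans ?_ hn.le)
    push_cast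
    gcongr
    linarith
  have halong : ε < along (a + f) e := by
    have hsq := along_sq_add_across_sq (a + f) e
    have hnorm := one_le_norm_latticePoint (ne_zero_of_isCoprime hcop)
    have hle : |across (a + f) e| ≤ ε := by nlinarith [abs_nonneg (Real.sin f)]
    rw [← sq_abs (across _ e)] at hsq
    nlinarith [abs_nonneg (across (a + f) e)]
  refine ⟨along (a + f) e - ε * Real.cos f, by nlinarith [Real.cos_le_one f], e, ?_⟩
  rw [norm_ray_sub_le_iff hε0.le, sub_add_cancel, sub_self, zero_pow two_ne_zero, zero_add]
  refine sq_le_sq.mpr ((abs_add_le _ _).trans ?_)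
  rw [abs_mul, abs_of_pos hε0]
  linarith

/-- The point of a ray at time `t` has the coordinates `t + A` and `B`, along and across the ray,
with respect to the centre of the disk that the ray enters at time `τ`. -/
lemma sq_add_sq_eq_and_nonpos_of_first_hit {ε τ A B : ℝ} (hτ : 0 < τ)
    (hhit : (τ + A) ^ 2 + B ^ 2 ≤ ε ^ 2)
    (hfirst : ∀ t, 0 < t → t < τ → ¬ (t + A) ^ 2 + B ^ 2 ≤ ε ^ 2) :
    (τ + A) ^ 2 + B ^ 2 = ε ^ 2 ∧ τ + A ≤ 0 := by
  have hrange : ∀ r, (τ + A) ^ 2 ≤ r ^ 2 → r ^ 2 ≤ ε ^ 2 - B ^ 2 → 0 ≤ r → τ + A ≤ -r := by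
    intro r hr hr' hr0
    by_contra! hlt
    have habs := abs_le_of_sq_le_sq hr hr0
    refine hfirst (max (τ / 2) (-A - r)) (by positivity) (max_lt (by linarith) (by linarith)) ?_
    have hlow : -r ≤ max (τ / 2) (-A - r) + A := by linarith [le_max_right (τ / 2) (-A - r)]
    have hupp : max (τ / 2) (-A - r) + A ≤ τ + A := by
      linarith [max_le (by linarith : τ / 2 ≤ τ) (by linarith : -A - r ≤ τ)]
    nlinarith [sq_le_sq' hlow (hupp.trans (le_of_abs_le habs))]
  have hsqrt := Real.sq_sqrt (by nlinarith [sq_nonneg (τ + A)] : 0 ≤ ε ^ 2 - B ^ 2)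
  have hle := hrange √(ε ^ 2 - B ^ 2) (by linarith) hsqrt.le (Real.sqrt_nonneg _)
  have hnonneg := Real.sqrt_nonneg (ε ^ 2 - B ^ 2)
  exact ⟨le_antisymm hhit (by nlinarith), by linarith⟩

/-! ### Visible scatterers and time reversal -/

/-- The signed distance from the lattice point `m` to the line of direction `(sin α, cos α)` that
leaves the scatterer at the origin at the angle `φ`. -/
def offset (ε φ α : ℝ) (m : ℤ × ℤ) : ℝ := ε * Real.sin φ - across α m

/-- The scatterer `m` is the first one hit, and not tangentially, by the ray of direction
`(sin α, cos α)` that leaves the scatterer at the origin at the angle `φ`. -/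
def Visible (ε φ α : ℝ) (m : ℤ × ℤ) : Prop :=
  |offset ε φ α m| < ε ∧ 0 < along α m ∧
    ∀ m', 0 < along α m' → along α m' < along α m → ε < |offset ε φ α m'|

lemma offset_zero (ε φ α : ℝ) : offset ε φ α 0 = ε * Real.sin φ := by
  rw [offset, map_zero, sub_zero]

lemma sq_mul_cos_add_sq_mul_sin_le (ε φ : ℝ) :
    (ε * Real.cos φ) ^ 2 + (ε * Real.sin φ) ^ 2 ≤ ε ^ 2 := by
  linear_combination ε ^ 2 * Real.sin_sq_add_cos_sq φ

lemma chord_zero (ε φ α : ℝ) : (ε * Real.cos φ) ^ 2 + offset ε φ α 0 ^ 2 ≤ ε ^ 2 := by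
  rw [offset_zero]
  exact sq_mul_cos_add_sq_mul_sin_le ε φ

lemma norm_ray_neg_sub_le_iff {ε : ℝ} (hε0 : 0 ≤ ε) (θ φ s : ℝ) (m : ℤ × ℤ) :
    ‖ray ε (point θ (-φ)) s - latticePoint m‖ ≤ ε ↔
      (s + ε * Real.cos φ - along (θ - φ) m) ^ 2 + offset ε φ (θ - φ) m ^ 2 ≤ ε ^ 2 := by
  rw [norm_ray_sub_le_iff hε0, Real.cos_neg, Real.sin_neg, ← sub_eq_add_neg, offset, ← neg_sq
    (ε * Real.sin φ - across _ m)]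
  ring_nf

/-- Time reversal: seen from the scatterer `m`, the ray that arrives at `(θ, φ)` is the ray of
`(θ, -φ)` run backwards. -/
lemma ray_eq_ray_neg_sub {ε θ φ f : ℝ} {m : ℤ × ℤ}
    (hf : ε * Real.sin f = offset ε φ (θ - φ) m) (t : ℝ) :
    ray ε (point (θ - φ + π - f) f) t =
      ray ε (point θ (-φ)) (along (θ - φ) m - ε * Real.cos f - ε * Real.cos φ - t) -
        latticePoint m := by
  obtain ⟨α, rfl⟩ : ∃ α, θ = α + φ := ⟨θ - φ, by ring⟩
  rw [add_sub_cancel_right, offset, across_apply] at hf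
  have hα := Real.sin_sq_add_cos_sq α
  rw [ray, ray, position_point, position_point, velocity_point, velocity_point,
    show α + φ - φ + π - f + f = α + π by ring, show α + φ - φ + π - f = α - f + π by ring,
    add_neg_cancel_right, add_sub_cancel_right, along_apply, Real.sin_add_pi, Real.cos_add_pi,
    Real.sin_add_pi, Real.cos_add_pi]
  apply Complex.ext <;> simp only [Complex.add_re, Complex.sub_re, Complex.add_im, Complex.sub_im,
    Complex.re_ofReal_mul, Complex.im_ofReal_mul, latticePoint, Real.sin_sub, Real.cos_sub,
    Real.sin_add, Real.cos_add]
  · linear_combination Real.cos α * hf - m.1 * hα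
  · linear_combination -Real.sin α * hf - m.2 * hα

/-- The outgoing angle at the scatterer `m` of the ray that arrives from `m` at the scatterer at the
origin and leaves it, with time reversed, in the direction `(sin α, cos α)`. -/
def backAngle (ε φ α : ℝ) (m : ℤ × ℤ) : ℝ := Real.arcsin (offset ε φ α m / ε)

/-- The preimage of `(θ, φ)` under the billiard map on the scatterer `m`. -/
def backPoint (ε θ φ : ℝ) (m : ℤ × ℤ) : Cylinder :=
  point (θ - φ + π - backAngle ε φ (θ - φ) m) (backAngle ε φ (θ - φ) m)

lemma sin_backAngle {ε φ α : ℝ} {m : ℤ × ℤ} (hε0 : 0 < ε) (h : |offset ε φ α m| ≤ ε) :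
    ε * Real.sin (backAngle ε φ α m) = offset ε φ α m := by
  obtain ⟨hlow, hupp⟩ := abs_le.mp h
  rw [backAngle, Real.sin_arcsin, mul_div_cancel₀ _ hε0.ne']
  · rw [le_div_iff₀ hε0]
    linarith
  · rwa [div_le_one hε0]

lemma backAngle_mem_Ioo {ε φ α : ℝ} {m : ℤ × ℤ} (hε0 : 0 < ε) (h : |offset ε φ α m| < ε) :
    backAngle ε φ α m ∈ Ioo (-(π / 2)) (π / 2) := by
  obtain ⟨hlow, hupp⟩ := abs_lt.mp h
  constructor
  · apply Real.neg_pi_div_two_lt_arcsin.mpr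
    rw [lt_div_iff₀ hε0]
    linarith
  · apply Real.arcsin_lt_pi_div_two.mpr
    rwa [div_lt_one hε0]

lemma cos_backAngle_pos {ε φ α : ℝ} {m : ℤ × ℤ} (hε0 : 0 < ε) (h : |offset ε φ α m| < ε) :
    0 < Real.cos (backAngle ε φ α m) :=
  Real.cos_pos_of_mem_Ioo (backAngle_mem_Ioo hε0 h)

lemma sin_snd_of_billiardMap_eq {ε a f θ φ : ℝ} (hT : billiardMap ε (point a f) = point θ φ) :
    Real.sin φ = Real.sin (a + f - θ) ∧ φ ∈ Icc (-(π / 2)) (π / 2) := by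
  rw [billiardMap, point_eq_point_iff] at hT
  obtain ⟨hN, rfl⟩ := hT
  refine ⟨?_, Real.neg_pi_div_two_le_arcsin _, Real.arcsin_le_pi_div_two _⟩
  have hsin : Real.sin (nextAngle ε (point a f)) = Real.sin θ := by
    rw [← Real.Angle.sin_coe, hN, Real.Angle.sin_coe]
  have hcos : Real.cos (nextAngle ε (point a f)) = Real.cos θ := by
    rw [← Real.Angle.cos_coe, hN, Real.Angle.cos_coe]
  simp only [hsin, hcos, velocity_point]
  rw [← Real.sin_sub, Real.sin_arcsin (Real.neg_one_le_sin _) (Real.sin_le_one _)]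

lemma nextPoint_sub_eq_position {ε : ℝ} (hε0 : 0 < ε) {x : Cylinder}
    (hx : ‖nextPoint ε x - latticePoint (displacement ε x)‖ = ε) :
    nextPoint ε x - latticePoint (displacement ε x) = position ε (billiardMap ε x) := by
  obtain ⟨z, hz⟩ : ∃ z, z = nextPoint ε x - latticePoint (displacement ε x) := ⟨_, rfl⟩
  have hswap : ‖(⟨z.im, z.re⟩ : ℂ)‖ = ε := by
    rw [← hx, ← hz, ← sq_eq_sq₀ (norm_nonneg _) (norm_nonneg _), ← Complex.normSq_eq_norm_sq,
      ← Complex.normSq_eq_norm_sq, Complex.normSq_apply, Complex.normSq_apply, add_comm]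
  have hswap0 : (⟨z.im, z.re⟩ : ℂ) ≠ 0 := norm_ne_zero_iff.mp (hswap ▸ hε0.ne')
  rw [billiardMap, position_point, nextAngle, ← hz, Complex.sin_arg, Complex.cos_arg hswap0, hswap,
    mul_div_cancel₀ _ hε0.ne', mul_div_cancel₀ _ hε0.ne']

lemma coe_nextAngle {ε θ : ℝ} (hε0 : 0 < ε) {x : Cylinder}
    (hx : nextPoint ε x - latticePoint (displacement ε x) =
      ⟨ε * Real.sin θ, ε * Real.cos θ⟩) : (nextAngle ε x : Real.Angle) = θ := by
  have hpolar : (⟨ε * Real.cos θ, ε * Real.sin θ⟩ : ℂ) =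
      (ε : ℂ) * (Real.Angle.cos θ + Real.Angle.sin θ * Complex.I) := by
    apply Complex.ext
    · simp [-Complex.ofReal_cos]
    · simp [-Complex.ofReal_sin]
  rw [nextAngle, hx, hpolar, Complex.arg_mul_cos_add_sin_mul_I_coe_angle hε0]

lemma along_across_of_ray_sub_eq_position {ε a f t θ φ : ℝ} {ℓ : ℤ × ℤ}
    (h : ray ε (point a f) t - latticePoint ℓ = position ε (point θ φ)) :
    t + ε * Real.cos f - along (a + f) ℓ = ε * Real.cos (a + f - θ) ∧
      ε * Real.sin f + across (a + f) ℓ = ε * Real.sin (a + f - θ) := by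
  obtain ⟨α, rfl⟩ : ∃ α, a = α - f := ⟨a + f, by ring⟩
  rw [ray, position_point, position_point, velocity_point, sub_add_cancel, Complex.ext_iff] at h
  simp only [Complex.add_re, Complex.sub_re, Complex.add_im, Complex.sub_im,
    Complex.re_ofReal_mul, Complex.im_ofReal_mul, latticePoint, Real.sin_sub, Real.cos_sub] at h
  obtain ⟨hre, him⟩ := h
  have hα := Real.sin_sq_add_cos_sq α
  rw [sub_add_cancel, along_apply, across_apply, Real.cos_sub, Real.sin_sub]
  constructor
  · linear_combination Real.sin α * hre + Real.cos α * him - (ε * Real.cos f + t) * hα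
  · linear_combination -Real.cos α * hre + Real.sin α * him - ε * Real.sin f * hα

lemma collision_of_hitTimes_nonempty {ε : ℝ} (hε0 : 0 < ε) (hε : ε < 1 / 2) {a f : ℝ}
    (hf : 0 ≤ Real.cos f) (hne : (hitTimes ε (point a f)).Nonempty) :
    ‖nextPoint ε (point a f) - latticePoint (displacement ε (point a f))‖ = ε ∧
      flightTime ε (point a f) + ε * Real.cos f -
        along (a + f) (displacement ε (point a f)) ≤ 0 := by
  obtain ⟨⟨hτ, ℓ₀, hℓ₀⟩, hleast⟩ := isLeast_flightTime (x := point a f) hε0 hε hf hne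
  have hhit := (norm_ray_sub_le_iff hε0.le _ _ _ _).mp (displacement_spec hℓ₀)
  rw [add_sub_assoc] at hhit
  obtain ⟨heq, hin⟩ := sq_add_sq_eq_and_nonpos_of_first_hit hτ hhit fun t ht htτ h => by
    rw [← add_sub_assoc, ← norm_ray_sub_le_iff hε0.le] at h
    exact htτ.not_ge (hleast ⟨ht, _, h⟩)
  rw [← add_sub_assoc] at heq hin
  refine ⟨?_, hin⟩
  rw [← sq_eq_sq₀ (norm_nonneg _) hε0.le, ← heq]
  exact norm_ray_sub_sq ε a f _ _

lemma point_eq_of_billiardMap_eq {ε : ℝ} (hε0 : 0 < ε) (hε : ε < 1 / 2) {a f θ φ : ℝ}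
    (hf : 0 ≤ Real.cos f) (hne : (hitTimes ε (point a f)).Nonempty)
    (hT : billiardMap ε (point a f) = point θ φ) :
    point a f = point (θ - φ + π - f) f := by
  obtain ⟨hnorm, hin⟩ := collision_of_hitTimes_nonempty hε0 hε hf hne
  have hpos := nextPoint_sub_eq_position hε0 hnorm
  rw [hT] at hpos
  rw [(along_across_of_ray_sub_eq_position hpos).1] at hin
  obtain ⟨hsin, hφ⟩ := sin_snd_of_billiardMap_eq hT
  have hcos : Real.cos φ = -Real.cos (a + f - θ) := by
    rw [← sq_eq_sq₀ (Real.cos_nonneg_of_mem_Icc hφ) (by nlinarith), Real.cos_sq', hsin, neg_sq,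
      Real.cos_sq']
  have hangle : ((a + f - θ : ℝ) : Real.Angle) = ((π - φ : ℝ) : Real.Angle) := by
    apply Real.Angle.cos_sin_inj
    · rw [Real.cos_pi_sub, hcos, neg_neg]
    · rw [Real.sin_pi_sub, hsin]
  rw [point_eq_point_iff, show a = (a + f - θ) + (θ - f) by ring, Real.Angle.coe_add, hangle,
    ← Real.Angle.coe_add]
  exact ⟨congrArg _ (by ring), rfl⟩

lemma offset_neg_displacement {ε : ℝ} (hε0 : 0 < ε) (hε : ε < 1 / 2) {f θ φ : ℝ}
    (hf : 0 ≤ Real.cos f) (hne : (hitTimes ε (point (θ - φ + π - f) f)).Nonempty)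
    (hT : billiardMap ε (point (θ - φ + π - f) f) = point θ φ) :
    ε * Real.sin f = offset ε φ (θ - φ) (-displacement ε (point (θ - φ + π - f) f)) ∧
      flightTime ε (point (θ - φ + π - f) f) =
        along (θ - φ) (-displacement ε (point (θ - φ + π - f) f)) - ε * Real.cos f -
          ε * Real.cos φ := by
  have hpos := nextPoint_sub_eq_position hε0 (collision_of_hitTimes_nonempty hε0 hε hf hne).1
  rw [hT] at hpos
  obtain ⟨halong, hacross⟩ := along_across_of_ray_sub_eq_position hpos
  rw [sub_add_cancel, along_add_pi, show θ - φ + π - θ = π - φ by ring, Real.cos_pi_sub] at halong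
  rw [sub_add_cancel, across_add_pi, show θ - φ + π - θ = π - φ by ring, Real.sin_pi_sub]
    at hacross
  rw [offset, map_neg, map_neg]
  exact ⟨by linarith, by linarith⟩

section TimeReversal

variable {ε θ φ f : ℝ} {m : ℤ × ℤ}

lemma lt_abs_offset_of_isLeast (hε0 : 0 < ε) (hε : ε < 1 / 2) (hf : 0 ≤ Real.cos f)
    (hφ : 0 ≤ Real.cos φ) (hsin : ε * Real.sin f = offset ε φ (θ - φ) m)
    (hleast : IsLeast (hitTimes ε (point (θ - φ + π - f) f))
      (along (θ - φ) m - ε * Real.cos f - ε * Real.cos φ)) {m' : ℤ × ℤ}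
    (hm'0 : 0 < along (θ - φ) m') (hm' : along (θ - φ) m' < along (θ - φ) m) :
    ε < |offset ε φ (θ - φ) m'| := by
  by_contra! hle
  have hchord' : (0 : ℝ) ^ 2 + offset ε φ (θ - φ) m' ^ 2 ≤ ε ^ 2 := by
    rw [zero_pow two_ne_zero, zero_add]
    exact sq_le_sq.mpr (hle.trans (le_abs_self ε))
  have hchord : (ε * Real.cos f) ^ 2 + offset ε φ (θ - φ) m ^ 2 ≤ ε ^ 2 := by
    rw [← hsin]
    exact sq_mul_cos_add_sq_mul_sin_le ε f
  have hstart : along (θ - φ) 0 + ε * Real.cos φ < along (θ - φ) m' - 0 :=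
    chord_lt_chord hε0 hε (by positivity) le_rfl (chord_zero ε φ _) hchord'
      (fun h => by simp [← h] at hm'0) (by rw [map_zero]; exact hm'0.le)
  have hend : along (θ - φ) m' + 0 < along (θ - φ) m - ε * Real.cos f :=
    chord_lt_chord hε0 hε le_rfl (by positivity) hchord' hchord (fun h => hm'.ne (h ▸ rfl)) hm'.le
  rw [map_zero] at hstart
  have hhit : along (θ - φ) m - ε * Real.cos f - along (θ - φ) m' ∈
      hitTimes ε (point (θ - φ + π - f) f) := by
    refine ⟨by linarith, m' - m, ?_⟩
    rw [ray_eq_ray_neg_sub hsin, sub_sub, ← latticePoint_add, add_sub_cancel,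
      norm_ray_neg_sub_le_iff hε0.le]
    exact le_trans (by ring_nf; rfl) hchord'
  linarith [hleast.2 hhit]

lemma Visible.not_hit_of_lt (hε0 : 0 < ε) (hε : ε < 1 / 2) (hf : 0 ≤ Real.cos f)
    (hφ : 0 ≤ Real.cos φ) (hsin : ε * Real.sin f = offset ε φ (θ - φ) m)
    (hm : Visible ε φ (θ - φ) m) {t : ℝ} (ht : 0 < t)
    (htτ : t < along (θ - φ) m - ε * Real.cos f - ε * Real.cos φ) (ℓ : ℤ × ℤ) :
    ¬ ‖ray ε (point (θ - φ + π - f) f) t - latticePoint ℓ‖ ≤ ε := by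
  intro hhit
  have hℓ0 : ℓ ≠ 0 := by
    rintro rfl
    exact hhit.not_gt (lt_norm_ray_sub_zero (x := point _ f) hε0.le hf ht)
  rw [ray_eq_ray_neg_sub hsin, sub_sub, ← latticePoint_add] at hhit
  obtain ⟨s, hs⟩ : ∃ s, s = along (θ - φ) m - ε * Real.cos f - ε * Real.cos φ - t := ⟨_, rfl⟩
  rw [← hs] at hhit
  have hm0 : m + ℓ ≠ 0 := by
    intro h
    rw [h] at hhit
    refine hhit.not_gt (lt_norm_ray_sub_zero hε0.le ?_ (by linarith))
    exact hφ.trans_eq (Real.cos_neg φ).symm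
  rw [norm_ray_neg_sub_le_iff hε0.le, ← sq_abs (s + _ - _)] at hhit
  have habs := le_abs_self (s + ε * Real.cos φ - along (θ - φ) (m + ℓ))
  have habs' := neg_abs_le (s + ε * Real.cos φ - along (θ - φ) (m + ℓ))
  rcases le_or_gt (along (θ - φ) (m + ℓ)) 0 with hbehind | hpos
  · have := chord_lt_chord hε0 hε (abs_nonneg _) (by positivity) hhit (chord_zero ε φ (θ - φ)) hm0
      (hbehind.trans_eq (map_zero _).symm)
    rw [map_zero] at this
    have : 0 ≤ ε * Real.cos φ := by positivity
    linarith
  rcases lt_or_ge (along (θ - φ) (m + ℓ)) (along (θ - φ) m) with hbetween | hbeyond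
  · have hle : |offset ε φ (θ - φ) (m + ℓ)| ≤ ε := by
      apply abs_le_of_sq_le_sq _ hε0.le
      linarith [sq_nonneg |s + ε * Real.cos φ - along (θ - φ) (m + ℓ)|]
    exact hle.not_gt (hm.2.2 _ hpos hbetween)
  · have hchord : (ε * Real.cos f) ^ 2 + offset ε φ (θ - φ) m ^ 2 ≤ ε ^ 2 := by
      rw [← hsin]
      exact sq_mul_cos_add_sq_mul_sin_le ε f
    have := chord_lt_chord hε0 hε (by positivity) (abs_nonneg _) hchord hhit
      (fun h => hℓ0 (left_eq_add.mp h)) hbeyond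
    have : 0 ≤ ε * Real.cos f := by positivity
    linarith

lemma Visible.lt_along (hε0 : 0 < ε) (hε : ε < 1 / 2) (hf : 0 ≤ Real.cos f)
    (hφ : 0 ≤ Real.cos φ) (hsin : ε * Real.sin f = offset ε φ (θ - φ) m)
    (hm : Visible ε φ (θ - φ) m) : ε * Real.cos f + ε * Real.cos φ < along (θ - φ) m := by
  have hchord : (ε * Real.cos f) ^ 2 + offset ε φ (θ - φ) m ^ 2 ≤ ε ^ 2 := by
    rw [← hsin]
    exact sq_mul_cos_add_sq_mul_sin_le ε f
  have := chord_lt_chord hε0 hε (by positivity) (by positivity) (chord_zero ε φ _) hchord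
    (fun h => by simpa [← h] using hm.2.1) (by rw [map_zero]; exact hm.2.1.le)
  rw [map_zero] at this
  linarith

end TimeReversal

lemma cos_pos_of_notMem_singularSetZero {x : Cylinder} (hx : x ∈ phaseSpace)
    (hx0 : x ∉ singularSetZero) : 0 < Real.cos x.snd := by
  simp only [singularSetZero, mem_ofPred_eq, not_or] at hx0
  exact Real.cos_pos_of_mem_Ioo ⟨lt_of_le_of_ne hx.1 (Ne.symm hx0.2), lt_of_le_of_ne hx.2 hx0.1⟩

section BackPoint

variable {ε θ φ : ℝ} {m : ℤ × ℤ}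

lemma ray_backPoint (hε0 : 0 < ε) (hm : |offset ε φ (θ - φ) m| ≤ ε) :
    ray ε (backPoint ε θ φ m)
        (along (θ - φ) m - ε * Real.cos (backAngle ε φ (θ - φ) m) - ε * Real.cos φ) -
      latticePoint (-m) = position ε (point θ φ) := by
  rw [backPoint, ray_eq_ray_neg_sub (sin_backAngle hε0 hm), sub_self, latticePoint_neg,
    sub_neg_eq_add, sub_add_cancel, ray, Complex.ofReal_zero, zero_mul, add_zero, position_point,
    position_point]

lemma flightTime_backPoint (hε0 : 0 < ε) (hε : ε < 1 / 2) (hφ : 0 ≤ Real.cos φ)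
    (hm : Visible ε φ (θ - φ) m) : flightTime ε (backPoint ε θ φ m) =
      along (θ - φ) m - ε * Real.cos (backAngle ε φ (θ - φ) m) - ε * Real.cos φ := by
  have hcos := (cos_backAngle_pos hε0 hm.1).le
  have hsin := sin_backAngle hε0 hm.1.le
  refine IsLeast.csInf_eq (s := hitTimes ε (backPoint ε θ φ m)) ⟨⟨?_, -m, ?_⟩, ?_⟩
  · linarith [hm.lt_along hε0 hε hcos hφ hsin]
  · rw [ray_backPoint hε0 hm.1.le, norm_position hε0.le]
  · rintro t ⟨ht, ℓ, hℓ⟩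
    by_contra! hlt
    exact hm.not_hit_of_lt hε0 hε hcos hφ hsin ht hlt ℓ hℓ

lemma nextPoint_backPoint (hε0 : 0 < ε) (hε : ε < 1 / 2) (hφ : 0 ≤ Real.cos φ)
    (hm : Visible ε φ (θ - φ) m) :
    nextPoint ε (backPoint ε θ φ m) - latticePoint (-m) = position ε (point θ φ) := by
  rw [nextPoint, flightTime_backPoint hε0 hε hφ hm, ← ray_backPoint hε0 hm.1.le, ray]

lemma displacement_backPoint (hε0 : 0 < ε) (hε : ε < 1 / 2) (hφ : 0 ≤ Real.cos φ)
    (hm : Visible ε φ (θ - φ) m) : displacement ε (backPoint ε θ φ m) = -m := by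
  apply displacement_eq hε
  rw [nextPoint_backPoint hε0 hε hφ hm, norm_position hε0.le]

lemma billiardMap_backPoint (hε0 : 0 < ε) (hε : ε < 1 / 2) (hφ : φ ∈ Icc (-(π / 2)) (π / 2))
    (hm : Visible ε φ (θ - φ) m) : billiardMap ε (backPoint ε θ φ m) = point θ φ := by
  have hcos := Real.cos_nonneg_of_mem_Icc hφ
  have hN : (nextAngle ε (backPoint ε θ φ m) : Real.Angle) = θ := by
    apply coe_nextAngle hε0
    rw [displacement_backPoint hε0 hε hcos hm, nextPoint_backPoint hε0 hε hcos hm, position_point]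
  have hsinN : Real.sin (nextAngle ε (backPoint ε θ φ m)) = Real.sin θ := by
    rw [← Real.Angle.sin_coe, hN, Real.Angle.sin_coe]
  have hcosN : Real.cos (nextAngle ε (backPoint ε θ φ m)) = Real.cos θ := by
    rw [← Real.Angle.cos_coe, hN, Real.Angle.cos_coe]
  have hvel : velocity (backPoint ε θ φ m) = ⟨Real.sin (θ - φ + π), Real.cos (θ - φ + π)⟩ := by
    rw [backPoint, velocity_point, sub_add_cancel]
  rw [billiardMap, point_eq_point_iff, hsinN, hcosN, hvel]
  refine ⟨hN, ?_⟩
  rw [← Real.sin_sub, show θ - φ + π - θ = π - φ by ring, Real.sin_pi_sub,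
    Real.arcsin_sin hφ.1 hφ.2]

lemma visible_and_eq_backPoint (hε0 : 0 < ε) (hε : ε < 1 / 2) {x : Cylinder}
    (hx : x ∈ phaseSpace) (hx0 : x ∉ singularSetZero) (hT : billiardMap ε x = point θ φ) :
    Visible ε φ (θ - φ) (-displacement ε x) ∧ x = backPoint ε θ φ (-displacement ε x) := by
  obtain ⟨a, f, rfl⟩ := exists_eq_point x
  have hcosf : 0 < Real.cos f := cos_pos_of_notMem_singularSetZero hx hx0
  have hφ := Real.cos_nonneg_of_mem_Icc (sin_snd_of_billiardMap_eq hT).2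
  have hne := hitTimes_nonempty (x := point a f) hε0 hε hcosf
  have hpoint := point_eq_of_billiardMap_eq hε0 hε hcosf.le hne hT
  rw [hpoint] at hT hne ⊢
  obtain ⟨hsin, hτ⟩ := offset_neg_displacement hε0 hε hcosf.le hne hT
  have hleast := isLeast_flightTime (x := point _ f) hε0 hε hcosf.le hne
  obtain ⟨m, hm⟩ : ∃ m, m = -displacement ε (point (θ - φ + π - f) f) := ⟨_, rfl⟩
  rw [← hm] at hsin hτ ⊢
  have hf : f = backAngle ε φ (θ - φ) m := by
    rw [backAngle, ← hsin, mul_div_cancel_left₀ _ hε0.ne', Real.arcsin_sin (x := f) hx.1 hx.2]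
  have hoffset : |offset ε φ (θ - φ) m| < ε := by
    apply abs_lt_of_sq_lt_sq _ hε0.le
    have : 0 < (ε * Real.cos f) ^ 2 := by positivity
    rw [← hsin]
    linarith [sq_mul_cos_add_sq_mul_sin_le ε f]
  have halong : 0 < along (θ - φ) m := by
    have := hleast.1.1
    rw [hτ] at this
    have : 0 < ε * Real.cos f := by positivity
    have : 0 ≤ ε * Real.cos φ := by positivity
    linarith
  rw [hτ] at hleast
  refine ⟨⟨hoffset, halong, fun m' => lt_abs_offset_of_isLeast hε0 hε hcosf.le hφ hsin hleast⟩, ?_⟩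
  rw [backPoint, ← hf]

end BackPoint

lemma continuous_position (ε : ℝ) : Continuous (position ε) := by
  unfold position
  simp only [Complex.mk_eq_add_mul_I]
  have hsin : Continuous fun x : Cylinder => x.fst.sin :=
    Real.Angle.continuous_sin.comp (by fun_prop)
  have hcos : Continuous fun x : Cylinder => x.fst.cos :=
    Real.Angle.continuous_cos.comp (by fun_prop)
  fun_prop

lemma continuous_velocity : Continuous velocity := by
  unfold velocity
  simp only [Complex.mk_eq_add_mul_I]
  have hsin : Continuous fun x : Cylinder => x.fst.sin :=
    Real.Angle.continuous_sin.comp (by fun_prop)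
  have hcos : Continuous fun x : Cylinder => x.fst.cos :=
    Real.Angle.continuous_cos.comp (by fun_prop)
  fun_prop

lemma continuous_uncurry_ray (ε : ℝ) : Continuous fun z : Cylinder × ℝ => ray ε z.1 z.2 := by
  have hP := continuous_position ε
  have hV := continuous_velocity
  unfold ray
  fun_prop

lemma exists_norm_ray_sub_displacement_lt {ε : ℝ} (hε0 : 0 < ε) (hε : ε < 1 / 2) {x : Cylinder}
    (hx : x ∈ phaseSpace) (hx1 : x ∉ singularSetOne ε) :
    ∃ T, 0 < T ∧ ‖ray ε x T - latticePoint (displacement ε x)‖ < ε ∧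
      ∀ ℓ, ℓ ≠ 0 → ℓ ≠ displacement ε x → ∀ t ∈ Icc 0 T, ε < ‖ray ε x t - latticePoint ℓ‖ := by
  have hx0 : x ∉ singularSetZero := fun h => hx1 (Or.inl h)
  obtain ⟨θ, φ, hT⟩ := exists_eq_point (billiardMap ε x)
  obtain ⟨hvis, hback⟩ := visible_and_eq_backPoint hε0 hε hx hx0 hT
  have hφ : 0 < Real.cos φ := by
    apply cos_pos_of_notMem_singularSetZero (x := point θ φ)
    · obtain ⟨a, f, rfl⟩ := exists_eq_point x
      exact (sin_snd_of_billiardMap_eq hT).2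
    · exact fun h => hx1 (Or.inr ⟨hx, hT ▸ h⟩)
  obtain ⟨m, hm⟩ : ∃ m, displacement ε x = -m := ⟨-displacement ε x, (neg_neg _).symm⟩
  rw [hm, neg_neg] at hvis hback
  rw [hm]
  have hleast := isLeast_flightTime hε0 hε (cos_pos_of_notMem_singularSetZero hx hx0).le
    (hitTimes_nonempty hε0 hε (cos_pos_of_notMem_singularSetZero hx hx0))
  have hdist : ∀ t, ‖ray ε x t - latticePoint (-m)‖ ^ 2 =
      (t - flightTime ε x - ε * Real.cos φ) ^ 2 + (ε * Real.sin φ) ^ 2 := by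
    intro t
    rw [hback, flightTime_backPoint hε0 hε hφ.le hvis, backPoint, norm_ray_sub_sq, sub_add_cancel,
      along_add_pi, across_add_pi, map_neg, map_neg, sin_backAngle hε0 hvis.1.le, offset]
    ring
  have hcosφ : 0 < ε * Real.cos φ := by positivity
  have hdisk := sq_mul_cos_add_sq_mul_sin_le ε φ
  refine ⟨flightTime ε x + ε * Real.cos φ, add_pos hleast.1.1 hcosφ, ?_, ?_⟩
  · rw [← sq_lt_sq₀ (norm_nonneg _) hε0.le, hdist]
    nlinarith
  · intro ℓ hℓ0 hℓ t ht
    by_contra! hhit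
    rcases ht.1.eq_or_lt with rfl | htpos
    · exact hℓ0 (eq_of_norm_sub_latticePoint_le hε hhit
        (by simp [ray, latticePoint_zero, norm_position hε0.le]))
    · have hτt : flightTime ε x ≤ t := hleast.2 ⟨htpos, ℓ, hhit⟩
      refine hℓ (eq_of_norm_sub_latticePoint_le hε hhit ?_)
      rw [← sq_le_sq₀ (norm_nonneg _) hε0.le, hdist]
      nlinarith [ht.2]

lemma displacement_eq_of_forall_lt {ε T : ℝ} (hε0 : 0 < ε) (hε : ε < 1 / 2) {y : Cylinder}
    {ℓ : ℤ × ℤ} (hy : y ∈ phaseSpace) (hT : 0 < T) (hhit : ‖ray ε y T - latticePoint ℓ‖ ≤ ε)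
    (hmiss : ∀ ℓ', ‖latticePoint ℓ'‖ ≤ T + 2 * ε → ℓ' ≠ 0 → ℓ' ≠ ℓ →
      ∀ t ∈ Icc 0 T, ε < ‖ray ε y t - latticePoint ℓ'‖) : displacement ε y = ℓ := by
  have hcos : 0 ≤ Real.cos y.snd := Real.cos_nonneg_of_mem_Icc hy
  have hleast := isLeast_flightTime hε0 hε hcos ⟨T, hT, ℓ, hhit⟩
  obtain ⟨hτ, ℓ', hℓ'⟩ := hleast.1
  have hτT := hleast.2 ⟨hT, ℓ, hhit⟩
  have hℓ'0 : ℓ' ≠ 0 := by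
    rintro rfl
    exact hℓ'.not_gt (lt_norm_ray_sub_zero hε0.le hcos hτ)
  have hℓ'ℓ : ℓ' = ℓ := by
    by_contra hne
    refine hℓ'.not_gt (hmiss ℓ' ?_ hℓ'0 hne _ ⟨hτ.le, hτT⟩)
    exact (norm_latticePoint_le_of_hit hε0.le hτ.le hℓ').trans (by linarith)
  exact displacement_eq hε (hℓ'ℓ ▸ hℓ')

lemma eventually_displacement_eq {ε : ℝ} (hε0 : 0 < ε) (hε : ε < 1 / 2) {x : Cylinder}
    (hx : x ∈ phaseSpace) (hx1 : x ∉ singularSetOne ε) :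
    ∀ᶠ y in nhdsWithin x phaseSpace, displacement ε y = displacement ε x := by
  obtain ⟨T, hT, hhit, hmiss⟩ := exists_norm_ray_sub_displacement_lt hε0 hε hx hx1
  have hdist : ∀ ℓ : ℤ × ℤ, Continuous fun z : Cylinder × ℝ => ‖ray ε z.1 z.2 - latticePoint ℓ‖ :=
    fun ℓ => ((continuous_uncurry_ray ε).sub continuous_const).norm
  have hhit_near : ∀ᶠ y in nhds x, ‖ray ε y T - latticePoint (displacement ε x)‖ < ε :=
    ((hdist _).comp (Continuous.prodMk_left T)).continuousAt.eventually_lt continuousAt_const hhit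
  have hmiss_near : ∀ᶠ y in nhds x, ∀ ℓ ∈ {ℓ : ℤ × ℤ | ‖latticePoint ℓ‖ ≤ T + 2 * ε}, ℓ ≠ 0 →
      ℓ ≠ displacement ε x → ∀ t ∈ Icc 0 T, ε < ‖ray ε y t - latticePoint ℓ‖ := by
    rw [Filter.eventually_all_finite (finite_norm_latticePoint_le _)]
    intro ℓ _
    by_cases hℓ : ℓ ≠ 0 ∧ ℓ ≠ displacement ε x
    · have : ∀ᶠ y in nhds x, ∀ t ∈ Icc 0 T, ε < ‖ray ε y t - latticePoint ℓ‖ :=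
        isCompact_Icc.eventually_forall_of_forall_eventually fun t ht =>
          continuousAt_const.eventually_lt (hdist ℓ).continuousAt (hmiss ℓ hℓ.1 hℓ.2 t ht)
      exact this.mono fun y hy _ _ => hy
    · exact Filter.Eventually.of_forall fun y h h' => absurd ⟨h, h'⟩ hℓ
  filter_upwards [nhdsWithin_le_nhds hhit_near, nhdsWithin_le_nhds hmiss_near, self_mem_nhdsWithin]
    with y hyhit hymiss hy
  exact displacement_eq_of_forall_lt hε0 hε hy hT hyhit.le hymiss

/-! ### The offset and the preimage of a divergent front -/

lemma abs_mul_one_sub_cos_add_mul_sub_sin_le {a b N h : ℝ} (ha : |a| ≤ N) (hb : |b| ≤ N)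
    (hh : |h| ≤ 1) : |a * (1 - Real.cos h) + b * (h - Real.sin h)| ≤ N * h ^ 2 := by
  have hN : 0 ≤ N := (abs_nonneg a).trans ha
  have hcos : |1 - Real.cos h| ≤ h ^ 2 / 2 := by
    rw [abs_of_nonneg (by linarith [Real.cos_le_one h])]
    linarith [Real.one_sub_sq_div_two_le_cos (x := h)]
  have hsin : |h - Real.sin h| ≤ h ^ 2 / 2 := by
    have hcube : |h| ^ 3 ≤ |h| ^ 2 := pow_le_pow_of_le_one (abs_nonneg h) hh (by norm_num)
    rw [sq_abs] at hcube
    linarith [Real.abs_sub_sin_le h, sq_nonneg h]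
  calc |a * (1 - Real.cos h) + b * (h - Real.sin h)|
      ≤ |a| * |1 - Real.cos h| + |b| * |h - Real.sin h| :=
        (abs_add_le _ _).trans_eq (by rw [abs_mul, abs_mul])
    _ ≤ N * (h ^ 2 / 2) + N * (h ^ 2 / 2) := by gcongr
    _ = N * h ^ 2 := by ring

lemma abs_sin_sub_sub_le {φ ψ : ℝ} (h : |ψ - φ| ≤ 1) :
    |Real.sin ψ - Real.sin φ - (ψ - φ) * Real.cos φ| ≤ (ψ - φ) ^ 2 := by
  obtain ⟨k, rfl⟩ : ∃ k, ψ = φ + k := ⟨ψ - φ, by ring⟩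
  rw [add_sub_cancel_left] at *
  calc |Real.sin (φ + k) - Real.sin φ - k * Real.cos φ|
      = |Real.sin φ * (1 - Real.cos k) + Real.cos φ * (k - Real.sin k)| := by
        rw [← abs_neg, Real.sin_add]
        ring_nf
    _ ≤ 1 * k ^ 2 := abs_mul_one_sub_cos_add_mul_sub_sin_le (Real.abs_sin_le_one φ)
        (Real.abs_cos_le_one φ) h
    _ = k ^ 2 := one_mul _

lemma across_add (α h : ℝ) (m : ℤ × ℤ) :
    across (α + h) m = across α m * Real.cos h - along α m * Real.sin h := by
  rw [across_apply, across_apply, along_apply, Real.sin_add, Real.cos_add]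
  ring

lemma along_add (α h : ℝ) (m : ℤ × ℤ) :
    along (α + h) m = along α m * Real.cos h + across α m * Real.sin h := by
  rw [across_apply, along_apply, along_apply, Real.sin_add, Real.cos_add]
  ring

lemma abs_across_sub_sub_le (m : ℤ × ℤ) {α β : ℝ} (h : |β - α| ≤ 1) :
    |across α m - across β m - (β - α) * along α m| ≤ ‖latticePoint m‖ * (β - α) ^ 2 := by
  obtain ⟨k, rfl⟩ : ∃ k, β = α + k := ⟨β - α, by ring⟩
  rw [add_sub_cancel_left] at *
  have halong : |-along α m| ≤ ‖latticePoint m‖ := (abs_neg _).trans_le (abs_along_le α m)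
  refine Eq.trans_le ?_ (abs_mul_one_sub_cos_add_mul_sub_sin_le (abs_across_le α m) halong h)
  rw [across_add]
  ring_nf

lemma along_sub_sq_add_across_sub_sq_le (α β : ℝ) (m : ℤ × ℤ) :
    (along β m - along α m) ^ 2 + (across β m - across α m) ^ 2 ≤
      (‖latticePoint m‖ * |β - α|) ^ 2 := by
  obtain ⟨k, rfl⟩ : ∃ k, β = α + k := ⟨β - α, by ring⟩
  rw [add_sub_cancel_left, along_add, across_add, mul_pow, sq_abs, ← along_sq_add_across_sq α]
  have hcos : 2 * (1 - Real.cos k) ≤ k ^ 2 := by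
    linarith [Real.one_sub_sq_div_two_le_cos (x := k)]
  linear_combination (along α m ^ 2 + across α m ^ 2) * hcos +
    (along α m ^ 2 + across α m ^ 2) * Real.sin_sq_add_cos_sq k

lemma abs_along_sub_le (α β : ℝ) (m : ℤ × ℤ) :
    |along β m - along α m| ≤ ‖latticePoint m‖ * |β - α| := by
  apply abs_le_of_sq_le_sq _ (by positivity)
  linarith [along_sub_sq_add_across_sub_sq_le α β m, sq_nonneg (across β m - across α m)]

lemma abs_across_sub_le (α β : ℝ) (m : ℤ × ℤ) :
    |across β m - across α m| ≤ ‖latticePoint m‖ * |β - α| := by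
  apply abs_le_of_sq_le_sq _ (by positivity)
  linarith [along_sub_sq_add_across_sub_sq_le α β m, sq_nonneg (along β m - along α m)]

lemma sub_sq_le_of_abs_offset_le {ε φ α : ℝ} {m : ℤ × ℤ} (hε0 : 0 ≤ ε)
    (hb : |offset ε φ α m| ≤ ε) :
    (‖latticePoint m‖ - ε) ^ 2 ≤ (along α m - ε * Real.cos φ) ^ 2 + ε ^ 2 := by
  have hnorm := along_sq_add_across_sq α m
  have hinner : Real.cos φ * along α m + Real.sin φ * across α m ≤ ‖latticePoint m‖ := by
    apply le_of_abs_le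
    apply abs_le_of_sq_le_sq _ (norm_nonneg _)
    linear_combination sq_nonneg (Real.cos φ * across α m - Real.sin φ * along α m) +
      (along α m ^ 2 + across α m ^ 2) * Real.sin_sq_add_cos_sq φ + hnorm
  have hoffset : offset ε φ α m ^ 2 ≤ ε ^ 2 := sq_le_sq' (neg_le_of_abs_le hb) (le_of_abs_le hb)
  rw [offset] at hoffset
  linear_combination 2 * ε * hinner + hoffset - hnorm - ε ^ 2 * Real.sin_sq_add_cos_sq φ

lemma norm_le_of_abs_offset_le {ε φ α : ℝ} {m : ℤ × ℤ} (hε0 : 0 < ε) (hε : ε < 1 / 2)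
    (hφ : 0 ≤ Real.cos φ) (hb : |offset ε φ α m| ≤ ε) (hpos : 0 < along α m) :
    (1 - 2 * ε) * ‖latticePoint m‖ ≤ along α m - ε * Real.cos φ := by
  have hm : m ≠ 0 := by
    rintro rfl
    exact hpos.ne' (map_zero _)
  have hone := one_le_norm_latticePoint hm
  have hchord : (0 : ℝ) ^ 2 + offset ε φ α m ^ 2 ≤ ε ^ 2 := by
    rw [zero_pow two_ne_zero, zero_add]
    exact sq_le_sq.mpr (hb.trans (le_abs_self ε))
  have hstart := chord_lt_chord hε0 hε (by positivity) le_rfl (chord_zero ε φ α) hchord hm.symm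
    (by rw [map_zero]; exact hpos.le)
  rw [map_zero] at hstart
  refine (abs_le_of_sq_le_sq' ?_ (by linarith)).2
  have hprod : 0 ≤ ε * (‖latticePoint m‖ * (‖latticePoint m‖ - 1)) :=
    mul_nonneg hε0.le (mul_nonneg (norm_nonneg _) (by linarith))
  have hsq : 0 ≤ ε * ((1 - 2 * ε) * ‖latticePoint m‖ ^ 2) :=
    mul_nonneg hε0.le (mul_nonneg (by linarith) (by positivity))
  linarith [sub_sq_le_of_abs_offset_le hε0.le hb]

lemma norm_sub_le_of_abs_offset_le {ε φ α : ℝ} {m m' : ℤ × ℤ} (hε0 : 0 < ε) (hε : ε < 1 / 2)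
    (hb : |offset ε φ α m| ≤ ε) (hb' : |offset ε φ α m'| ≤ ε) (hlt : along α m' < along α m) :
    (1 - 2 * ε) * ‖latticePoint (m - m')‖ ≤ along α (m - m') := by
  have hone : 1 ≤ ‖latticePoint (m - m')‖ ^ 2 :=
    one_le_pow₀ <| one_le_norm_latticePoint <| sub_ne_zero.mpr fun h : m = m' =>
      hlt.ne (congrArg (along α) h.symm)
  have hnorm := along_sq_add_across_sq α (m - m')
  have hacross : |across α (m - m')| ≤ 2 * ε := by
    have : across α (m - m') = offset ε φ α m' - offset ε φ α m := by
      rw [map_sub, offset, offset]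
      ring
    rw [this]
    exact (abs_sub _ _).trans (by linarith)
  have hsq : across α (m - m') ^ 2 ≤ (2 * ε) ^ 2 :=
    sq_le_sq' (neg_le_of_abs_le hacross) (le_of_abs_le hacross)
  refine (abs_le_of_sq_le_sq' ?_ (by rw [map_sub]; linarith)).2
  have hprod : 0 ≤ ε * ((1 - ε) * (‖latticePoint (m - m')‖ ^ 2 - 1)) :=
    mul_nonneg hε0.le (mul_nonneg (by linarith) (by linarith))
  have hprod' : 0 ≤ ε * (1 - 2 * ε) := mul_nonneg hε0.le (by linarith)
  linarith

section Growth

variable {ε φ₁ φ₂ α₁ α₂ : ℝ} {m : ℤ × ℤ}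

lemma abs_offset_sub_sub_le (hε0 : 0 ≤ ε) (hε : ε ≤ ‖latticePoint m‖) (hα : |α₂ - α₁| ≤ 1)
    (hφα : |φ₂ - φ₁| ≤ |α₂ - α₁|) :
    |offset ε φ₂ α₂ m - offset ε φ₁ α₁ m -
        ((α₂ - α₁) * along α₁ m + (φ₂ - φ₁) * (ε * Real.cos φ₁))| ≤
      2 * ‖latticePoint m‖ * (α₂ - α₁) ^ 2 := by
  have hacross := abs_across_sub_sub_le m hα
  have hsin := abs_sin_sub_sub_le (hφα.trans hα)
  calc _ = |ε * (Real.sin φ₂ - Real.sin φ₁ - (φ₂ - φ₁) * Real.cos φ₁) +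
        (across α₁ m - across α₂ m - (α₂ - α₁) * along α₁ m)| := by
        rw [offset, offset]
        ring_nf
    _ ≤ ε * (φ₂ - φ₁) ^ 2 + ‖latticePoint m‖ * (α₂ - α₁) ^ 2 := by
        refine (abs_add_le _ _).trans ?_
        rw [abs_mul, abs_of_nonneg hε0]
        gcongr
    _ ≤ ‖latticePoint m‖ * (α₂ - α₁) ^ 2 + ‖latticePoint m‖ * (α₂ - α₁) ^ 2 := by
        gcongr ?_ + _
        exact mul_le_mul hε (sq_le_sq.mpr hφα) (sq_nonneg _) (norm_nonneg _)
    _ = 2 * ‖latticePoint m‖ * (α₂ - α₁) ^ 2 := by ring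

variable (hε0 : 0 < ε) (hε : ε < 1 / 2) (hφ : φ₂ ≤ φ₁) (hφα : φ₁ - φ₂ ≤ α₂ - α₁)
  (hα : α₂ - α₁ ≤ (1 - 2 * ε) / 4) (hm : m ≠ 0)

include hε0 hε hφ hφα hα hm

lemma offset_growth_left (hcos : 0 ≤ Real.cos φ₁)
    (hd : (1 - 2 * ε) * ‖latticePoint m‖ ≤ along α₁ m - ε * Real.cos φ₁) :
    (1 - 2 * ε) / 2 * ‖latticePoint m‖ * (α₂ - α₁) ≤ offset ε φ₂ α₂ m - offset ε φ₁ α₁ m := by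
  have hh : 0 ≤ α₂ - α₁ := by linarith
  have hexpand := neg_le_of_abs_le <| abs_offset_sub_sub_le
    (φ₁ := φ₁) (φ₂ := φ₂) (α₁ := α₁) (α₂ := α₂) hε0.le
    (by linarith [one_le_norm_latticePoint hm]) (abs_le.mpr ⟨by linarith, by linarith⟩)
    (by rwa [abs_sub_comm, abs_of_nonneg (sub_nonneg.mpr hφ), abs_of_nonneg hh])
  have hangle : (φ₁ - φ₂) * (ε * Real.cos φ₁) ≤ (α₂ - α₁) * (ε * Real.cos φ₁) := by gcongr
  have hmain := mul_le_mul_of_nonneg_left hd hh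
  have herror := mul_le_mul_of_nonneg_left hα (mul_nonneg (norm_nonneg (latticePoint m)) hh)
  linarith

lemma offset_growth_right (hcos : 0 ≤ Real.cos φ₂)
    (hd : (1 - 2 * ε) * ‖latticePoint m‖ ≤ along α₂ m - ε * Real.cos φ₂) :
    (1 - 2 * ε) / 2 * ‖latticePoint m‖ * (α₂ - α₁) ≤ offset ε φ₂ α₂ m - offset ε φ₁ α₁ m := by
  have hh : 0 ≤ α₂ - α₁ := by linarith
  have hexpand := le_of_abs_le <| abs_offset_sub_sub_le
    (φ₁ := φ₂) (φ₂ := φ₁) (α₁ := α₂) (α₂ := α₁) hε0.le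
    (by linarith [one_le_norm_latticePoint hm]) (abs_le.mpr ⟨by linarith, by linarith⟩)
    (by rwa [abs_of_nonneg (sub_nonneg.mpr hφ), abs_sub_comm, abs_of_nonneg hh])
  have hangle : (φ₁ - φ₂) * (ε * Real.cos φ₂) ≤ (α₂ - α₁) * (ε * Real.cos φ₂) := by gcongr
  have hmain := mul_le_mul_of_nonneg_left hd hh
  have herror := mul_le_mul_of_nonneg_left hα (mul_nonneg (norm_nonneg (latticePoint m)) hh)
  linarith

end Growth

lemma Visible.ne_zero {ε φ α : ℝ} {m : ℤ × ℤ} (h : Visible ε φ α m) : m ≠ 0 := by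
  rintro rfl
  exact h.2.1.ne' (map_zero _)

lemma sub_le_along {α β ρ : ℝ} (m : ℤ × ℤ) (h : |β - α| ≤ ρ) :
    along α m - ρ * ‖latticePoint m‖ ≤ along β m := by
  have := neg_le_of_abs_le (abs_along_sub_le α β m)
  linarith [mul_le_mul_of_nonneg_left h (norm_nonneg (latticePoint m))]

lemma across_le_across {α₁ α α₂ γ : ℝ} {n : ℤ × ℤ} (hγ : γ ≤ 1)
    (hn : γ * ‖latticePoint n‖ ≤ along α n) (h₁ : α₁ ≤ α) (h₂ : α ≤ α₂)
    (h : α₂ - α₁ ≤ γ / 2) : across α₂ n ≤ across α₁ n := by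
  have hexpand := neg_le_of_abs_le <| abs_across_sub_sub_le n (α := α₁) (β := α₂)
    (abs_le.mpr ⟨by linarith, by linarith⟩)
  have halong := sub_le_along n (α := α) (β := α₁) (ρ := γ / 2)
    (abs_le.mpr ⟨by linarith, by linarith⟩)
  have herror := mul_le_mul_of_nonneg_left h (norm_nonneg (latticePoint n))
  have hmain := mul_le_mul_of_nonneg_left (show ‖latticePoint n‖ * (α₂ - α₁) ≤ along α₁ n by
    linarith) (show 0 ≤ α₂ - α₁ by linarith)
  linarith

section Between

variable {ε φ₁ φ φ₂ α₁ α α₂ : ℝ} {m m' : ℤ × ℤ} (hε0 : 0 < ε) (hε : ε < 1 / 2)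
  (hφ₁ : φ ≤ φ₁) (hφα₁ : φ₁ - φ ≤ α - α₁) (hφ₂ : φ₂ ≤ φ) (hφα₂ : φ - φ₂ ≤ α₂ - α)
  (hα : α₂ - α₁ ≤ (1 - 2 * ε) / 4)
  (h₁ : Visible ε φ₁ α₁ m) (h₂ : Visible ε φ₂ α₂ m)

include hε0 hε hφ₁ hφα₁ hφ₂ hφα₂ hα h₁ h₂

lemma offset_mem_Icc_of_visible (hcos₁ : 0 ≤ Real.cos φ₁) (hcos₂ : 0 ≤ Real.cos φ₂) :
    offset ε φ α m ∈ Icc (offset ε φ₁ α₁ m) (offset ε φ₂ α₂ m) := by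
  have hrate : 0 ≤ (1 - 2 * ε) / 2 * ‖latticePoint m‖ :=
    mul_nonneg (by linarith) (norm_nonneg _)
  have hleft := offset_growth_left hε0 hε hφ₁ hφα₁ (by linarith) h₁.ne_zero hcos₁
    (norm_le_of_abs_offset_le hε0 hε hcos₁ h₁.1.le h₁.2.1)
  have hright := offset_growth_right hε0 hε hφ₂ hφα₂ (by linarith) h₂.ne_zero hcos₂
    (norm_le_of_abs_offset_le hε0 hε hcos₂ h₂.1.le h₂.2.1)
  constructor
  · linarith [mul_nonneg hrate (show 0 ≤ α - α₁ by linarith)]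
  · linarith [mul_nonneg hrate (show 0 ≤ α₂ - α by linarith)]

/-- If the ray met `m'` before `m`, then the two outer rays would be more than `2 ε` apart at `m'`
and less than `2 ε` apart at `m`, although the front is divergent. -/
lemma lt_abs_offset_of_visible (hcos : 0 ≤ Real.cos φ) (hoff : |offset ε φ α m| ≤ ε)
    (hpos : 0 < along α m') (hlt : along α m' < along α m) : ε < |offset ε φ α m'| := by
  by_contra! hhit
  have hm' : m' ≠ 0 := by
    rintro rfl
    exact hpos.ne' (map_zero _)
  have hγ : 0 < 1 - 2 * ε := by linarith
  have hN' := mul_pos hγ (zero_lt_one.trans_le (one_le_norm_latticePoint hm'))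
  have hNd := mul_pos hγ <| zero_lt_one.trans_le <| one_le_norm_latticePoint <|
    sub_ne_zero.mpr fun h : m = m' => hlt.ne (congrArg (along α) h.symm)
  have hfar := norm_le_of_abs_offset_le hε0 hε hcos hhit hpos
  have hgap := norm_sub_le_of_abs_offset_le hε0 hε hoff hhit hlt
  have hfront : ∀ β, |β - α| ≤ (1 - 2 * ε) / 4 → 0 < along β m' ∧ along β m' < along β m := by
    intro β hβ
    have hd := sub_le_along (m - m') hβ
    rw [map_sub (along β)] at hd
    have := mul_nonneg hε0.le hcos
    constructor <;> linarith [sub_le_along m' hβ]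
  have hβ₁ : |α₁ - α| ≤ (1 - 2 * ε) / 4 := abs_le.mpr ⟨by linarith, by linarith⟩
  have hβ₂ : |α₂ - α| ≤ (1 - 2 * ε) / 4 := abs_le.mpr ⟨by linarith, by linarith⟩
  have hrate : 0 ≤ (1 - 2 * ε) / 2 * ‖latticePoint m'‖ := by linarith
  have hleft : offset ε φ₁ α₁ m' < -ε := by
    have hgrow := offset_growth_right hε0 hε hφ₁ hφα₁ (by linarith) hm' hcos hfar
    have hle : offset ε φ₁ α₁ m' ≤ ε := by
      linarith [mul_nonneg hrate (show 0 ≤ α - α₁ by linarith), le_of_abs_le hhit]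
    by_contra! hge
    exact (h₁.2.2 m' (hfront _ hβ₁).1 (hfront _ hβ₁).2).not_ge (abs_le.mpr ⟨hge, hle⟩)
  have hright : ε < offset ε φ₂ α₂ m' := by
    have hgrow := offset_growth_left hε0 hε hφ₂ hφα₂ (by linarith) hm' hcos hfar
    have hge : -ε ≤ offset ε φ₂ α₂ m' := by
      linarith [mul_nonneg hrate (show 0 ≤ α₂ - α by linarith), neg_le_of_abs_le hhit]
    by_contra! hle
    exact (h₂.2.2 m' (hfront _ hβ₂).1 (hfront _ hβ₂).2).not_ge (abs_le.mpr ⟨hge, hle⟩)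
  have hacross := across_le_across (by linarith) hgap (show α₁ ≤ α by linarith)
    (show α ≤ α₂ by linarith) (by linarith)
  rw [map_sub, map_sub] at hacross
  have hm₁ := neg_lt_of_abs_lt h₁.1
  have hm₂ := lt_of_abs_lt h₂.1
  simp only [offset] at hleft hright hm₁ hm₂
  linarith

/-- Within a short stretch of a divergent front, the part that hits a given scatterer first is
connected. -/
lemma visible_between (hcos₁ : 0 ≤ Real.cos φ₁) (hcos : 0 ≤ Real.cos φ)
    (hcos₂ : 0 ≤ Real.cos φ₂) : Visible ε φ α m := by
  have hmem := offset_mem_Icc_of_visible hε0 hε hφ₁ hφα₁ hφ₂ hφα₂ hα h₁ h₂ hcos₁ hcos₂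
  have hoff : |offset ε φ α m| < ε := abs_lt.mpr
    ⟨(neg_lt_of_abs_lt h₁.1).trans_le hmem.1, hmem.2.trans_lt (lt_of_abs_lt h₂.1)⟩
  have hpos : 0 < along α m := by
    have hγ := mul_pos (show 0 < 1 - 2 * ε by linarith)
      (zero_lt_one.trans_le (one_le_norm_latticePoint h₁.ne_zero))
    have hclose : |α - α₁| ≤ (1 - 2 * ε) / 4 := abs_le.mpr ⟨by linarith, by linarith⟩
    linarith [sub_le_along m hclose, mul_nonneg hε0.le hcos₁,
      norm_le_of_abs_offset_le hε0 hε hcos₁ h₁.1.le h₁.2.1]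
  exact ⟨hoff, hpos, fun m' h0 hlt => lt_abs_offset_of_visible hε0 hε hφ₁ hφα₁ hφ₂ hφα₂ hα h₁ h₂
    hcos hoff.le h0 hlt⟩

end Between

/-! ### Long free paths cross a corridor -/

section Corridor

variable {G : Type*} [AddCommGroup G] {A B : G →+ ℝ} {ε p : ℝ} {e f m : G}

lemma nonneg_of_det_eq_one (hE : 0 < A e) (hB : B e ≤ 0) (hEB : A e * -B e ≤ 1)
    (hdet : A e * B f - A f * B e = 1) (hle : A f ≤ A e) : 0 ≤ B f := by
  refine nonneg_of_mul_nonneg_right (a := A e) ?_ hE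
  linarith [mul_le_mul_of_nonneg_right hle (neg_nonneg.mpr hB)]

lemma exists_reduced_complement (hE : 0 < A e) (hdet : A e * B f - A f * B e = 1)
    (hbasis : ∃ i j : ℤ, m = i • e + j • f) :
    ∃ g, A g ∈ Ioc 0 (A e) ∧ A e * B g - A g * B e = 1 ∧ ∃ i j : ℤ, m = i • e + j • g := by
  obtain ⟨k, ⟨hlt, hle⟩, -⟩ := existsUnique_sub_zsmul_mem_Ioc hE (A f) 0
  obtain ⟨i, j, rfl⟩ := hbasis
  refine ⟨f - k • e, ?_, ?_, i + j * k, j, by module⟩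
  · rw [map_sub, map_zsmul]
    exact ⟨hlt, hle.trans_eq (zero_add _)⟩
  · rw [map_sub, map_sub, map_zsmul, map_zsmul, zsmul_eq_mul, zsmul_eq_mul]
    linear_combination hdet

lemma exists_nat_add_mul_lt_le {a E T : ℝ} (hE : 0 < E) (h : a < T) :
    ∃ n : ℕ, a + n * E < T ∧ T ≤ a + (n + 1) * E := by
  obtain ⟨k, ⟨hlt, hle⟩, -⟩ := existsUnique_sub_zsmul_mem_Ioc hE T a
  rw [zsmul_eq_mul] at hlt hle
  have hk : (0 : ℝ) < k + 1 := pos_of_mul_pos_left (by linarith) hE.le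
  lift k to ℕ using by
    have : 0 < k + 1 := by exact_mod_cast hk
    omega
  rw [Int.cast_natCast] at hlt hle
  exact ⟨k, by linarith, by linarith⟩

/-- The row through `f` in direction `e` descends in steps smaller than the width of the band
`|p - B x| ≤ ε`, so it cannot jump over the band. -/
lemma sub_lt_neg_of_row (hp : p ≤ ε) (hB : -B e ≤ ε) (hε : 0 ≤ ε) (hBf : 0 ≤ B f) (hA : 0 < A f)
    (hE : 0 ≤ A e) (hfree : ∀ x, 0 < A x → A x < A m → ε < |p - B x|) (n : ℕ)
    (h : A f + n * A e < A m) : p - B f - n * B e < -ε := by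
  induction n with
  | zero =>
    have hmiss := hfree f hA (by simpa using h)
    rw [Nat.cast_zero, zero_mul, sub_zero]
    rcases lt_abs.mp hmiss with hlt | hlt <;> linarith
  | succ n ih =>
    rw [Nat.cast_succ] at h ⊢
    have hprev := ih (by linarith)
    have hAn : A (f + (n + 1) • e) = A f + (n + 1) * A e := by
      rw [map_add, map_nsmul, nsmul_eq_mul, Nat.cast_succ]
    have hBn : B (f + (n + 1) • e) = B f + (n + 1) * B e := by
      rw [map_add, map_nsmul, nsmul_eq_mul, Nat.cast_succ]
    have hmiss := hfree (f + (n + 1) • e) (by rw [hAn]; positivity) (by rwa [hAn])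
    rw [hBn] at hmiss
    rcases lt_abs.mp hmiss with hlt | hlt <;> linarith

lemma coefficients_eq_of_exit {i j n : ℤ} (hE : 0 < A e) (hB : B e < 0)
    (hdet : A e * B f - A f * B e = 1) (hm : m = i • e + j • f) (hBf : 0 ≤ B f) (hA : 0 < A f)
    (hAm : A m ≤ A f + (n + 1) * A e) (hdetm : 0 < A e * B m - A m * B e)
    (hBm : B m < B f + n * B e) : i = n + 1 ∧ j = 1 := by
  have hAij : A m = i * A e + j * A f := by
    rw [hm, map_add, map_zsmul, map_zsmul, zsmul_eq_mul, zsmul_eq_mul]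
  have hBij : B m = i * B e + j * B f := by
    rw [hm, map_add, map_zsmul, map_zsmul, zsmul_eq_mul, zsmul_eq_mul]
  have hj : 1 ≤ j := by
    have : A e * B m - A m * B e = j := by
      rw [hBij, hAij]
      linear_combination (j : ℝ) * hdet
    rw [this] at hdetm
    exact_mod_cast hdetm
  have hj' : (1 : ℝ) ≤ j := by exact_mod_cast hj
  have hi : n + 1 ≤ i := by
    have hpos : 0 < (i - n) * -B e := by
      linarith [mul_nonneg (sub_nonneg.mpr hj') hBf]
    have : (0 : ℝ) < i - n := pos_of_mul_pos_left hpos (by linarith)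
    have : (n : ℝ) < i := by linarith
    exact_mod_cast this
  have hi' : (n : ℝ) + 1 ≤ i := by exact_mod_cast hi
  have hie : 0 ≤ (i - (n + 1)) * A e := mul_nonneg (by linarith) hE.le
  have hjf : 0 ≤ (j - 1) * A f := mul_nonneg (by linarith) hA.le
  have hi_le : (i : ℝ) - (n + 1) ≤ 0 := nonpos_of_mul_nonpos_left (by linarith) hE
  have hj_le : (j : ℝ) - 1 ≤ 0 := nonpos_of_mul_nonpos_left (by linarith) hA
  refine ⟨hi.antisymm' ?_, hj.antisymm' ?_⟩
  · have : (i : ℝ) ≤ n + 1 := by linarith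
    exact_mod_cast this
  · have : (j : ℝ) ≤ 1 := by linarith
    exact_mod_cast this

/-- A long free path drifts across the corridor between two neighbouring rows of scatterers, and
ends almost tangentially on the second row. -/
lemma corridor_of_neg (hp : |p| ≤ ε) (hE : 0 < A e) (hB : B e < 0) (hBε : -B e ≤ ε)
    (hEB : A e * -B e ≤ 1) (hdet : A e * B f - A f * B e = 1)
    (hbasis : ∃ i j : ℤ, m = i • e + j • f) (hT : 6 * A e ≤ A m) (hm : |p - B m| < ε)
    (hfree : ∀ x, 0 < A x → A x < A m → ε < |p - B x|) :
    A e * B m - A m * B e = 1 ∧ ε - |p - B m| ≤ -B e ∧ -B e * (A m - 3 * A e) ≤ 1 := by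
  obtain ⟨g, ⟨hg, hgle⟩, hdetg, i, j, hij⟩ := exists_reduced_complement hE hdet hbasis
  have hBg := nonneg_of_det_eq_one hE hB.le hEB hdetg hgle
  obtain ⟨n, hnlt, hnle⟩ := exists_nat_add_mul_lt_le hE (show A g < A m by linarith)
  have hrow := sub_lt_neg_of_row (le_of_abs_le hp) hBε ((abs_nonneg p).trans hp) hBg hg hE.le
    hfree n hnlt
  have hBe : ε < p - B e := by
    have := neg_le_of_abs_le hp
    rcases lt_abs.mp (hfree e hE (by linarith)) with hlt | hlt <;> linarith
  have hBm := abs_lt.mp hm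
  have hcross : 0 < A e * B m - A m * B e := by
    have hlow := mul_le_mul_of_nonneg_left (show B e ≤ B m by linarith) hE.le
    linarith [mul_pos (show 0 < A m - A e by linarith) (neg_pos.mpr hB)]
  obtain ⟨rfl, rfl⟩ := coefficients_eq_of_exit (n := n) hE hB hdetg hij hBg hg
    (by exact_mod_cast hnle) hcross (by push_cast; linarith)
  rw [one_zsmul] at hij
  have hAm : A m = (n + 1) * A e + A g := by
    rw [hij, map_add, map_zsmul, zsmul_eq_mul]
    push_cast
    ring
  have hBm' : B m = (n + 1) * B e + B g := by
    rw [hij, map_add, map_zsmul, zsmul_eq_mul]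
    push_cast
    ring
  refine ⟨?_, ?_, ?_⟩
  · rw [hAm, hBm']
    linear_combination hdetg
  · linarith [neg_le_abs (p - B m)]
  · have hup := mul_le_mul_of_nonneg_left (show A m - 3 * A e ≤ (n - 1) * A e by linarith)
      (neg_nonneg.mpr hB.le)
    have hrun := mul_le_mul_of_nonneg_left (show (n - 1) * -B e ≤ B g by
      linarith [neg_le_of_abs_le hp]) hE.le
    linarith [mul_pos hg (neg_pos.mpr hB)]

lemma corridor (hp : |p| ≤ ε) (hE : 0 < A e) (hB : B e ≠ 0) (hBε : |B e| ≤ ε)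
    (hEB : A e * |B e| ≤ 1) (hdet : |A e * B f - A f * B e| = 1)
    (hbasis : ∃ i j : ℤ, m = i • e + j • f) (hT : 6 * A e ≤ A m) (hm : |p - B m| < ε)
    (hfree : ∀ x, 0 < A x → A x < A m → ε < |p - B x|) :
    |A e * B m - A m * B e| = 1 ∧ ε - |p - B m| ≤ |B e| ∧ |B e| * (A m - 3 * A e) ≤ 1 := by
  wlog hneg : B e < 0 generalizing B p
  · have hreflect : ∀ x, |-p - (-B) x| = |p - B x| := fun x => by
      rw [AddMonoidHom.neg_apply, ← neg_sub', abs_neg]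
    have hdetneg : ∀ x, |A e * (-B) x - A x * (-B) e| = |A e * B x - A x * B e| := fun x => by
      rw [AddMonoidHom.neg_apply, AddMonoidHom.neg_apply, mul_neg, mul_neg, ← neg_sub', abs_neg]
    have := this (B := -B) (p := -p) (by rwa [abs_neg]) (neg_ne_zero.mpr hB)
      (by rwa [AddMonoidHom.neg_apply, abs_neg]) (by rwa [AddMonoidHom.neg_apply, abs_neg])
      (by rwa [hdetneg]) (by rwa [hreflect]) (fun x => by rw [hreflect]; exact hfree x)
      (neg_lt_zero.mpr (lt_of_le_of_ne (not_lt.mp hneg) hB.symm))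
    rwa [hreflect, hdetneg, AddMonoidHom.neg_apply, abs_neg] at this
  wlog hpos : A e * B f - A f * B e = 1 generalizing f
  · refine this (f := -f) ?_ ?_ ?_
    · obtain ⟨i, j, rfl⟩ := hbasis
      exact ⟨i, -j, by module⟩
    · simpa only [map_neg, mul_neg, neg_mul, ← neg_sub', abs_neg] using hdet
    · have := (eq_or_eq_neg_of_abs_eq hdet).resolve_left hpos
      rw [map_neg, map_neg]
      linarith
  rw [abs_of_neg hneg] at *
  obtain ⟨hdetm, hgraze, hlong⟩ := corridor_of_neg hp hE hneg hBε hEB hpos hbasis hT hm hfree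
  exact ⟨by rw [hdetm, abs_one], hgraze, hlong⟩

end Corridor

lemma along_mul_across_sub (α : ℝ) (e f : ℤ × ℤ) :
    along α e * across α f - along α f * across α e = ((e.2 * f.1 - e.1 * f.2 : ℤ) : ℝ) := by
  simp only [along_apply, across_apply]
  push_cast
  linear_combination (e.2 * f.1 - e.1 * f.2 : ℝ) * Real.sin_sq_add_cos_sq α

lemma exists_basis_of_isCoprime {e : ℤ × ℤ} (h : IsCoprime e.1 e.2) :
    ∃ f : ℤ × ℤ, e.2 * f.1 - e.1 * f.2 = 1 ∧ ∀ m, ∃ i j : ℤ, m = i • e + j • f := by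
  obtain ⟨u, v, huv⟩ := h
  refine ⟨(v, -u), by linear_combination huv, fun m =>
    ⟨u * m.1 + v * m.2, e.2 * m.1 - e.1 * m.2, Prod.ext ?_ ?_⟩⟩
  · simp only [Prod.fst_add, Prod.smul_fst, smul_eq_mul]
    linear_combination -m.1 * huv
  · simp only [Prod.snd_add, Prod.smul_snd, smul_eq_mul]
    linear_combination -m.2 * huv

lemma exists_corridor_direction {ε : ℝ} (hε0 : 0 < ε) (hε : ε < 1 / 2) (α : ℝ) :
    ∃ e : ℤ × ℤ, IsCoprime e.1 e.2 ∧ 0 < along α e ∧ |across α e| ≤ ε ∧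
      along α e * |across α e| ≤ 1 ∧ along α e ≤ 3 / ε ∧ ‖latticePoint e‖ ≤ 4 / ε := by
  have hinv : 2 < 1 / ε := by
    rw [lt_div_iff₀ hε0]
    linarith
  have hlt := Nat.lt_floor_add_one (1 / ε)
  have hle := Nat.floor_le (a := 1 / ε) (by positivity)
  obtain ⟨e, hcop, hE, hB, hEB, hle'⟩ :=
    exists_coprime_along_pos α (Nat.floor_pos.mpr (one_le_two.trans hinv.le))
  have hE3 : along α e ≤ 3 / ε := by
    have : 3 / ε = 3 * (1 / ε) := by ring
    linarith
  have hBε : |across α e| ≤ ε := by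
    refine hB.trans ?_
    rw [div_le_iff₀ (by positivity)]
    rw [div_lt_iff₀ hε0] at hlt
    linarith
  have hnorm : ‖latticePoint e‖ ≤ along α e + |across α e| := by
    apply le_of_abs_le
    apply abs_le_of_sq_le_sq _ (by positivity)
    rw [← along_sq_add_across_sq α, ← sq_abs (across α e)]
    linarith [mul_nonneg hE.le (abs_nonneg (across α e))]
  have : 4 / ε = 3 / ε + 1 / ε := by ring
  exact ⟨e, hcop, hE, hBε, hEB, hE3, by linarith⟩

lemma Visible.abs_across_le_one {ε φ α : ℝ} {m : ℤ × ℤ} (h : Visible ε φ α m) (hε0 : 0 ≤ ε)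
    (hε : ε ≤ 1 / 2) : |across α m| ≤ 1 := by
  have hsin : |ε * Real.sin φ| ≤ ε := by
    rw [abs_mul, abs_of_nonneg hε0]
    exact mul_le_of_le_one_right hε0 (Real.abs_sin_le_one φ)
  calc |across α m| = |ε * Real.sin φ - offset ε φ α m| := by rw [offset, sub_sub_cancel]
    _ ≤ |ε * Real.sin φ| + |offset ε φ α m| := abs_sub _ _
    _ ≤ 1 := by linarith [h.1]

lemma half_norm_le_along {α : ℝ} {m : ℤ × ℤ} (hm : 2 ≤ ‖latticePoint m‖) (hpos : 0 ≤ along α m)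
    (h : |across α m| ≤ 1) : ‖latticePoint m‖ / 2 ≤ along α m := by
  refine (abs_le_of_sq_le_sq' ?_ hpos).2
  have hacross : across α m ^ 2 ≤ 1 := (sq_le_one_iff_abs_le_one _).mpr h
  have hnorm : 2 ^ 2 ≤ ‖latticePoint m‖ ^ 2 := by gcongr
  linarith [along_sq_add_across_sq α m]

lemma sq_sub_sq_le_of_mul_le {ε b h N : ℝ} (hb : |b| ≤ ε) (hN : 0 < N)
    (hbh : ε - |b| ≤ h) (hhN : h * N ≤ 4) : ε ^ 2 - b ^ 2 ≤ 8 * ε / N := by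
  have hε : 0 ≤ ε := (abs_nonneg b).trans hb
  rw [le_div_iff₀ hN, ← sq_abs b]
  calc (ε ^ 2 - |b| ^ 2) * N = (ε - |b|) * (ε + |b|) * N := by ring
    _ ≤ h * (2 * ε) * N := by gcongr <;> linarith
    _ = h * N * (2 * ε) := by ring
    _ ≤ 4 * (2 * ε) := by gcongr
    _ = 8 * ε := by ring

lemma Visible.far {ε φ α : ℝ} {m : ℤ × ℤ} (hε0 : 0 < ε) (hε : ε < 1 / 2)
    (h : Visible ε φ α m) (hfar : 36 / ε ≤ ‖latticePoint m‖) :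
    (∃ e : ℤ × ℤ, |e.2 * m.1 - e.1 * m.2| = 1 ∧ ‖latticePoint e‖ ≤ 4 / ε ∧ |across α e| ≤ 1) ∧
      ε ^ 2 - offset ε φ α m ^ 2 ≤ 8 * ε / ‖latticePoint m‖ := by
  have hinv : 2 < 1 / ε := by
    rw [lt_div_iff₀ hε0]
    linarith
  have h36 : 36 / ε = 36 * (1 / ε) := by ring
  have h3 : 3 / ε = 3 * (1 / ε) := by ring
  have hhalf := half_norm_le_along (by linarith) h.2.1.le (h.abs_across_le_one hε0.le hε.le)
  obtain ⟨e, hcop, hE, hBε, hEB, hE3, hnorm⟩ := exists_corridor_direction hε0 hε α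
  obtain ⟨f, hdet, hbasis⟩ := exists_basis_of_isCoprime hcop
  have hp : |ε * Real.sin φ| ≤ ε := by
    rw [abs_mul, abs_of_pos hε0]
    exact mul_le_of_le_one_right hε0.le (Real.abs_sin_le_one φ)
  have hne : across α e ≠ 0 := by
    intro h0
    have := h.2.2 e hE (by linarith)
    rw [offset, h0, sub_zero] at this
    linarith
  obtain ⟨hdetm, hgraze, hlong⟩ := corridor hp hE hne hBε hEB
    (by rw [along_mul_across_sub, hdet, Int.cast_one, abs_one]) (hbasis m) (by linarith) h.1 h.2.2
  rw [along_mul_across_sub] at hdetm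
  refine ⟨⟨e, by exact_mod_cast hdetm, hnorm, by linarith⟩,
    sq_sub_sq_le_of_mul_le h.1.le (by linarith) hgraze ?_⟩
  linarith [mul_le_mul_of_nonneg_left (show ‖latticePoint m‖ / 4 ≤ along α m - 3 * along α e by
    linarith) (abs_nonneg (across α e))]

/-! ### Sums over lattice points -/

lemma card_Icc_ceil_floor_le {x y : ℝ} (h : x ≤ y) :
    ((Finset.Icc ⌈x⌉ ⌊y⌋).card : ℝ) ≤ y - x + 1 := by
  have hcast : ((⌊y⌋ + 1 - ⌈x⌉).toNat : ℝ) = max ((⌊y⌋ + 1 - ⌈x⌉ : ℤ) : ℝ) 0 := by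
    exact_mod_cast Int.toNat_eq_max (⌊y⌋ + 1 - ⌈x⌉)
  rw [Int.card_Icc, hcast]
  push_cast
  exact max_le (by linarith [Int.floor_le y, Int.le_ceil x]) (by linarith)

lemma card_Icc_neg_abs (i : ℤ) : ((Finset.Icc (-|i|) |i|).card : ℝ) = 2 * |(i : ℝ)| + 1 := by
  have hcard : (((Finset.Icc (-|i|) |i|).card : ℤ)) = 2 * |i| + 1 := by
    rw [Int.card_Icc, Int.toNat_of_nonneg (by linarith [abs_nonneg i])]
    ring
  exact_mod_cast hcard

/-- The vertical coordinates of the lattice points of a strip of half-width `D` with horizontal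
coordinate `i`, as long as they do not exceed it in size. -/
def stripColumn (α D : ℝ) (i : ℤ) : Finset ℤ :=
  (Finset.Icc (-|i|) |i|).filter fun j => |across α (i, j)| ≤ D

lemma mem_stripColumn {α D : ℝ} {i j : ℤ} :
    j ∈ stripColumn α D i ↔ |j| ≤ |i| ∧ |across α (i, j)| ≤ D := by
  rw [stripColumn, Finset.mem_filter, Finset.mem_Icc, ← abs_le]

lemma card_stripColumn_le_of_half_le {α D : ℝ} (hD : 1 ≤ D) (i : ℤ)
    (hα : 1 / 2 ≤ |Real.sin α|) : ((stripColumn α D i).card : ℝ) ≤ 10 * D := by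
  have hsin : Real.sin α ≠ 0 := fun h => by norm_num [h] at hα
  set x := i * Real.cos α / Real.sin α
  have hsub : stripColumn α D i ⊆ Finset.Icc ⌈x - 2 * D⌉ ⌊x + 2 * D⌋ := by
    intro j hj
    have hj := (mem_stripColumn.mp hj).2
    have hacross : across α (i, j) = (x - j) * Real.sin α := by
      rw [across_apply, sub_mul, div_mul_cancel₀ _ hsin]
    rw [hacross, abs_mul] at hj
    have hxj : |x - j| ≤ 2 * D := by
      linarith [mul_le_mul_of_nonneg_left hα (abs_nonneg (x - j))]
    rw [Finset.mem_Icc, Int.ceil_le, Int.le_floor]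
    constructor <;> linarith [abs_le.mp hxj]
  calc ((stripColumn α D i).card : ℝ)
      ≤ (Finset.Icc ⌈x - 2 * D⌉ ⌊x + 2 * D⌋).card := by exact_mod_cast Finset.card_le_card hsub
    _ ≤ x + 2 * D - (x - 2 * D) + 1 := card_Icc_ceil_floor_le (by linarith)
    _ ≤ 10 * D := by linarith

lemma card_stripColumn_le_of_lt_half {α D : ℝ} (hD : 1 ≤ D) (i : ℤ)
    (hα : |Real.sin α| < 1 / 2) : ((stripColumn α D i).card : ℝ) ≤ 10 * D := by
  rcases (stripColumn α D i).eq_empty_or_nonempty with hempty | ⟨j, hj⟩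
  · rw [hempty, Finset.card_empty, Nat.cast_zero]
    linarith
  obtain ⟨hji, hacross⟩ := mem_stripColumn.mp hj
  have hji' : |(j : ℝ)| ≤ |(i : ℝ)| := by exact_mod_cast hji
  have hcos : 4 / 5 ≤ |Real.cos α| := by
    by_contra! hcos
    nlinarith [abs_nonneg (Real.sin α), abs_nonneg (Real.cos α), sq_abs (Real.sin α),
      sq_abs (Real.cos α), Real.sin_sq_add_cos_sq α]
  have hi : |(i : ℝ)| * |Real.cos α| ≤ D + |(j : ℝ)| * |Real.sin α| := by
    rw [← abs_mul, ← abs_mul]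
    calc |i * Real.cos α| = |across α (i, j) + j * Real.sin α| := by
          rw [across_apply, sub_add_cancel]
      _ ≤ |across α (i, j)| + |j * Real.sin α| := abs_add_le _ _
      _ ≤ D + |j * Real.sin α| := by gcongr
  have hiD : |(i : ℝ)| * (3 / 10) ≤ D := by
    nlinarith [abs_nonneg (i : ℝ), abs_nonneg (j : ℝ)]
  calc ((stripColumn α D i).card : ℝ) ≤ (Finset.Icc (-|i|) |i|).card := by
        exact_mod_cast Finset.card_filter_le _ _
    _ = 2 * |(i : ℝ)| + 1 := card_Icc_neg_abs i
    _ ≤ 10 * D := by linarith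

lemma card_stripColumn_le {D : ℝ} (hD : 1 ≤ D) (α : ℝ) (i : ℤ) :
    ((stripColumn α D i).card : ℝ) ≤ 10 * D :=
  (le_or_gt (1 / 2) |Real.sin α|).elim (card_stripColumn_le_of_half_le hD i)
    (card_stripColumn_le_of_lt_half hD i)

lemma tsum_int_natAbs_le (h : ℕ → ℝ≥0∞) : ∑' i : ℤ, h i.natAbs ≤ 2 * ∑' n, h n := by
  have hnat : HasSum (fun n : ℕ => h ((n : ℤ).natAbs)) (∑' n, h n) := ENNReal.summable.hasSum
  have hneg : HasSum (fun n : ℕ => h ((-((n : ℤ) + 1)).natAbs)) (∑' n, h (n + 1)) := by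
    have hnatAbs (n : ℕ) : (-((n : ℤ) + 1)).natAbs = n + 1 := by omega
    simp only [hnatAbs]
    exact ENNReal.summable.hasSum
  rw [(HasSum.of_nat_of_neg_add_one (f := fun i : ℤ => h i.natAbs) hnat hneg).tsum_eq, two_mul]
  refine add_le_add_right ?_ _
  exact ENNReal.tsum_comp_le_tsum_of_injective (add_left_injective 1) h

/-- The sup norm of a lattice vector. -/
def coordMax (m : ℤ × ℤ) : ℕ := max m.1.natAbs m.2.natAbs

lemma norm_latticePoint_swap (m : ℤ × ℤ) : ‖latticePoint m.swap‖ = ‖latticePoint m‖ := by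
  rw [← sq_eq_sq₀ (norm_nonneg _) (norm_nonneg _), norm_latticePoint_sq, norm_latticePoint_sq,
    add_comm, Prod.fst_swap, Prod.snd_swap]

lemma coordMax_swap (m : ℤ × ℤ) : coordMax m.swap = coordMax m := max_comm _ _

lemma coordMax_eq_natAbs_fst {m : ℤ × ℤ} (h : |m.2| ≤ |m.1|) : coordMax m = m.1.natAbs :=
  max_eq_left (by zify; exact h)

lemma coordMax_pos {m : ℤ × ℤ} (hm : m ≠ 0) : 0 < coordMax m := by
  by_contra! hmax
  obtain ⟨h1, h2⟩ := max_le_iff.mp hmax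
  exact hm (Prod.ext (by simpa using h1) (by simpa using h2))

lemma norm_latticePoint_le_two_mul_coordMax (m : ℤ × ℤ) :
    ‖latticePoint m‖ ≤ 2 * coordMax m := by
  have hnorm := Complex.norm_le_abs_re_add_abs_im (latticePoint m)
  simp only [latticePoint, ← Int.cast_abs, ← Nat.cast_natAbs] at hnorm ⊢
  have h1 : (m.1.natAbs : ℝ) ≤ coordMax m := by exact_mod_cast le_max_left _ _
  have h2 : (m.2.natAbs : ℝ) ≤ coordMax m := by exact_mod_cast le_max_right _ _
  linarith

lemma coordMax_le_norm_latticePoint (m : ℤ × ℤ) : (coordMax m : ℝ) ≤ ‖latticePoint m‖ := by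
  have h1 := Complex.abs_re_le_norm (latticePoint m)
  have h2 := Complex.abs_im_le_norm (latticePoint m)
  simp only [latticePoint] at h1 h2
  rw [coordMax, Nat.cast_max, Nat.cast_natAbs, Nat.cast_natAbs, Int.cast_abs, Int.cast_abs]
  exact max_le h1 h2

lemma tsum_le_of_abs_snd_le {α Δ : ℝ} (hΔ : 0 ≤ Δ) {F : ℤ × ℤ → ℝ≥0∞} {g : ℕ → ℝ≥0∞}
    (hsupp : ∀ m, F m ≠ 0 → |m.2| ≤ |m.1| ∧ |across α m| ≤ 1 + Δ * ‖latticePoint m‖)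
    (hFg : ∀ m, F m ≤ g (coordMax m)) :
    ∑' m, F m ≤ 2 * ∑' n : ℕ, ENNReal.ofReal (10 * (1 + 2 * Δ * n)) * g n := by
  rw [ENNReal.tsum_prod']
  refine (ENNReal.tsum_le_tsum fun i => ?_).trans
    (tsum_int_natAbs_le fun n => ENNReal.ofReal (10 * (1 + 2 * Δ * n)) * g n)
  set D := 1 + 2 * Δ * (i.natAbs : ℝ)
  have hD : 1 ≤ D := le_add_of_nonneg_right (by positivity)
  have hcolumn (j : ℤ) (hj : F (i, j) ≠ 0) : j ∈ stripColumn α D i := by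
    obtain ⟨hji, hacross⟩ := hsupp _ hj
    refine mem_stripColumn.mpr ⟨hji, hacross.trans ?_⟩
    have hnorm := norm_latticePoint_le_two_mul_coordMax (i, j)
    rw [coordMax_eq_natAbs_fst hji] at hnorm
    linarith [mul_le_mul_of_nonneg_left hnorm hΔ]
  have hterm (j : ℤ) (hj : j ∈ stripColumn α D i) : F (i, j) ≤ g i.natAbs := by
    simpa only [coordMax_eq_natAbs_fst (m := (i, j)) (mem_stripColumn.mp hj).1] using hFg (i, j)
  calc ∑' j, F (i, j) = ∑ j ∈ stripColumn α D i, F (i, j) :=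
        tsum_eq_sum fun j hj => not_imp_comm.mp (hcolumn j) hj
    _ ≤ (stripColumn α D i).card • g i.natAbs := Finset.sum_le_card_nsmul _ _ _ hterm
    _ ≤ ENNReal.ofReal (10 * D) * g i.natAbs := by
      rw [nsmul_eq_mul, ← ENNReal.ofReal_natCast]
      gcongr
      exact card_stripColumn_le hD α i

lemma tsum_le_tsum_coordMax {α Δ : ℝ} (hΔ : 0 ≤ Δ) {F : ℤ × ℤ → ℝ≥0∞} {g : ℕ → ℝ≥0∞}
    (hsupp : ∀ m, F m ≠ 0 → |across α m| ≤ 1 + Δ * ‖latticePoint m‖)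
    (hFg : ∀ m, F m ≤ g (coordMax m)) :
    ∑' m, F m ≤ 4 * ∑' n : ℕ, ENNReal.ofReal (10 * (1 + 2 * Δ * n)) * g n := by
  set S : Set (ℤ × ℤ) := {m | |m.2| ≤ |m.1|}
  set S' : Set (ℤ × ℤ) := {m | |m.1| ≤ |m.2|}
  have hle {T : Set (ℤ × ℤ)} (m : ℤ × ℤ) : T.indicator F m ≤ g (coordMax m) :=
    (indicator_le_self _ _ m).trans (hFg m)
  have hne {T : Set (ℤ × ℤ)} {m : ℤ × ℤ} (hm : T.indicator F m ≠ 0) : m ∈ T ∧ F m ≠ 0 :=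
    indicator_apply_ne_zero.mp hm
  have hfst := tsum_le_of_abs_snd_le (F := S.indicator F) hΔ
    (fun m hm => ⟨(hne hm).1, hsupp m (hne hm).2⟩) hle
  have hsnd := tsum_le_of_abs_snd_le (α := π / 2 - α) (F := fun m => S'.indicator F m.swap) hΔ
    (fun m hm => ⟨(hne hm).1, by
      have hm' := hsupp _ (hne hm).2
      rwa [← abs_neg, ← across_swap, m.swap_swap, norm_latticePoint_swap] at hm'⟩)
    (fun m => coordMax_swap m ▸ hle m.swap)
  rw [← (Equiv.prodComm ℤ ℤ).tsum_eq] at hsnd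
  simp only [Equiv.prodComm_apply, Prod.swap_swap] at hsnd
  calc ∑' m, F m ≤ ∑' m, (S.indicator F m + S'.indicator F m) := by
        refine ENNReal.tsum_le_tsum fun m => ?_
        rcases le_total |m.2| |m.1| with h | h
        · exact (indicator_of_mem (s := S) h F).ge.trans le_self_add
        · exact (indicator_of_mem (s := S') h F).ge.trans le_add_self
    _ = ∑' m, S.indicator F m + ∑' m, S'.indicator F m := ENNReal.tsum_add
    _ ≤ _ := add_le_add hfst hsnd
    _ = _ := by rw [← add_mul]; norm_num

lemma sum_rpow_neg_half_le (N : ℕ) :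
    ∑ n ∈ Finset.Icc 1 N, (n : ℝ) ^ (-(1 / 2 : ℝ)) ≤ 2 * √N := by
  induction N with
  | zero => simp
  | succ N ih =>
    have hpow : ((N + 1 : ℕ) : ℝ) ^ (-(1 / 2 : ℝ)) = 1 / √((N : ℝ) + 1) := by
      rw [Real.rpow_neg (by positivity), ← Real.sqrt_eq_rpow, Nat.cast_succ, one_div]
    have hterm : 1 / √((N : ℝ) + 1) ≤ 2 * √((N : ℝ) + 1) - 2 * √N := by
      rw [div_le_iff₀ (by positivity)]
      nlinarith [sq_nonneg (√((N : ℝ) + 1) - √N), Real.sq_sqrt (N.cast_add_one_pos (α := ℝ)).le,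
        Real.sq_sqrt (N.cast_nonneg (α := ℝ))]
    rw [Finset.sum_Icc_succ_top (by omega), hpow, Nat.cast_succ]
    linarith

lemma sum_rpow_neg_le {σ : ℝ} (hσ : σ ≤ 1 / 2) (N : ℕ) :
    ∑ n ∈ Finset.Icc 1 N, (n : ℝ) ^ (-σ) ≤ 2 * (N : ℝ) ^ (1 - σ) := by
  rcases Nat.eq_zero_or_pos N with rfl | hN
  · simpa using by positivity
  have hN' : (0 : ℝ) < N := by exact_mod_cast hN
  calc ∑ n ∈ Finset.Icc 1 N, (n : ℝ) ^ (-σ)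
      ≤ ∑ n ∈ Finset.Icc 1 N, (N : ℝ) ^ (1 / 2 - σ) * (n : ℝ) ^ (-(1 / 2 : ℝ)) := by
        refine Finset.sum_le_sum fun n hn => ?_
        obtain ⟨hn1, hnN⟩ := Finset.mem_Icc.mp hn
        have hsplit : (n : ℝ) ^ (-σ) = (n : ℝ) ^ (1 / 2 - σ) * (n : ℝ) ^ (-(1 / 2 : ℝ)) := by
          rw [← Real.rpow_add (by exact_mod_cast hn1)]
          ring_nf
        rw [hsplit]
        gcongr
    _ = (N : ℝ) ^ (1 / 2 - σ) * ∑ n ∈ Finset.Icc 1 N, (n : ℝ) ^ (-(1 / 2 : ℝ)) := by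
        rw [Finset.mul_sum]
    _ ≤ (N : ℝ) ^ (1 / 2 - σ) * (2 * √N) := by
        gcongr
        exact sum_rpow_neg_half_le N
    _ = 2 * (N : ℝ) ^ (1 - σ) := by
        rw [Real.sqrt_eq_rpow, show 1 - σ = (1 / 2 - σ) + 1 / 2 by ring, Real.rpow_add hN']
        ring

lemma sum_rpow_le {ν : ℝ} (hν : 0 ≤ ν) (N : ℕ) :
    ∑ n ∈ Finset.Icc 1 N, (n : ℝ) ^ ν ≤ (N : ℝ) ^ (1 + ν) := by
  rcases Nat.eq_zero_or_pos N with rfl | hN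
  · simpa using by positivity
  calc ∑ n ∈ Finset.Icc 1 N, (n : ℝ) ^ ν ≤ ∑ _n ∈ Finset.Icc 1 N, (N : ℝ) ^ ν :=
        Finset.sum_le_sum fun _ hn => by gcongr; exact (Finset.mem_Icc.mp hn).2
    _ = (N : ℝ) ^ (1 + ν) := by
        rw [Finset.sum_const, Nat.card_Icc, nsmul_eq_mul, Real.rpow_one_add' (by positivity)
          (by positivity), Nat.add_sub_cancel]

/-- The value `∑ n ^ (-(1 + σ))` of the zeta function. -/
def zetaSum (σ : ℝ) : ℝ≥0∞ := ∑' n : ℕ, ENNReal.ofReal ((n : ℝ) ^ (-(1 + σ)))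

lemma zetaSum_ne_top {σ : ℝ} (hσ : 0 < σ) : zetaSum σ ≠ ∞ :=
  (Real.summable_nat_rpow.mpr (by linarith)).tsum_ofReal_ne_top

lemma zetaSum_anti {η σ : ℝ} (hη : 0 < η) (h : η ≤ σ) : zetaSum σ ≤ zetaSum η := by
  refine ENNReal.tsum_le_tsum fun n => ENNReal.ofReal_le_ofReal ?_
  rcases n.eq_zero_or_pos with rfl | hn
  · rw [Nat.cast_zero, Real.zero_rpow (by linarith), Real.zero_rpow (by linarith)]
  · exact Real.rpow_le_rpow_of_exponent_le (by exact_mod_cast hn) (by linarith)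

/-- The position of a lattice vector in the direction of `e`, in units of `e`. -/
def rowCoordinate (e m : ℤ × ℤ) : ℝ := (e.1 * m.1 + e.2 * m.2) / ‖latticePoint e‖ ^ 2

lemma rowCoordinate_add_zsmul {e : ℤ × ℤ} (he : e ≠ 0) (m : ℤ × ℤ) (d : ℤ) :
    rowCoordinate e (m + d • e) = rowCoordinate e m + d := by
  have hnorm : ‖latticePoint e‖ ^ 2 ≠ 0 := by
    have := one_le_norm_latticePoint he
    positivity
  rw [rowCoordinate, rowCoordinate, div_add' _ _ _ hnorm, norm_latticePoint_sq]
  simp only [Prod.fst_add, Prod.snd_add, Prod.smul_fst, Prod.smul_snd, smul_eq_mul]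
  push_cast
  ring

/-- The two rows of lattice points next to the line spanned by `e`, far away from `e`. -/
def adjacentRows (e : ℤ × ℤ) : Set (ℤ × ℤ) :=
  {m | |e.2 * m.1 - e.1 * m.2| = 1 ∧ 3 * ‖latticePoint e‖ ≤ ‖latticePoint m‖}

/-- The row of a point of `adjacentRows e` and the integer part of its position in this row. -/
def rowIndex (e m : ℤ × ℤ) : Bool × ℤ :=
  (decide (e.2 * m.1 - e.1 * m.2 = 1), ⌊rowCoordinate e m⌋)

lemma exists_eq_add_zsmul_of_det_eq {e m m' : ℤ × ℤ} (hm : |e.2 * m.1 - e.1 * m.2| = 1)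
    (h : e.2 * m.1 - e.1 * m.2 = e.2 * m'.1 - e.1 * m'.2) : ∃ d : ℤ, m' = m + d • e := by
  obtain ⟨s, hs⟩ : ∃ s, s = e.2 * m.1 - e.1 * m.2 := ⟨_, rfl⟩
  have hs1 : s * s = 1 := by rw [hs, ← abs_mul_abs_self, hm, one_mul]
  refine ⟨-((m.2 * m'.1 - m.1 * m'.2) * s), Prod.ext ?_ ?_⟩
  · simp only [Prod.fst_add, Prod.smul_fst, smul_eq_mul]
    linear_combination (-(m'.1 - m.1)) * hs1 + s * (m'.1 - m.1) * hs - s * m.1 * h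
  · simp only [Prod.snd_add, Prod.smul_snd, smul_eq_mul]
    linear_combination (-(m'.2 - m.2)) * hs1 + s * (m'.2 - m.2) * hs - s * m.2 * h

lemma injOn_rowIndex {e : ℤ × ℤ} (he : e ≠ 0) : InjOn (rowIndex e) (adjacentRows e) := by
  rintro m ⟨hm, -⟩ m' ⟨hm', -⟩ h
  obtain ⟨hrow, hfloor⟩ := Prod.mk.inj h
  rw [decide_eq_decide] at hrow
  have hdet : e.2 * m.1 - e.1 * m.2 = e.2 * m'.1 - e.1 * m'.2 := by
    rcases (abs_eq zero_le_one).mp hm with h1 | h1 <;>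
      rcases (abs_eq zero_le_one).mp hm' with h2 | h2 <;> omega
  obtain ⟨d, rfl⟩ := exists_eq_add_zsmul_of_det_eq hm hdet
  rw [rowCoordinate_add_zsmul he, Int.floor_add_intCast, left_eq_add] at hfloor
  rw [hfloor, zero_smul, add_zero]

lemma rowCoordinate_mul_norm_sq {e m : ℤ × ℤ} (hm : m ∈ adjacentRows e) (he : e ≠ 0) :
    (rowCoordinate e m * ‖latticePoint e‖) ^ 2 * ‖latticePoint e‖ ^ 2 =
      ‖latticePoint m‖ ^ 2 * ‖latticePoint e‖ ^ 2 - 1 := by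
  have hnorm : ‖latticePoint e‖ ^ 2 ≠ 0 := by
    have := one_le_norm_latticePoint he
    positivity
  have hdet : ((e.2 : ℝ) * m.1 - e.1 * m.2) ^ 2 = 1 := by
    have hsq : (e.2 * m.1 - e.1 * m.2) ^ 2 = 1 := by rw [← sq_abs, hm.1, one_pow]
    exact_mod_cast hsq
  have hcoord : rowCoordinate e m * ‖latticePoint e‖ ^ 2 = e.1 * m.1 + e.2 * m.2 :=
    div_mul_cancel₀ _ hnorm
  calc (rowCoordinate e m * ‖latticePoint e‖) ^ 2 * ‖latticePoint e‖ ^ 2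
      = (rowCoordinate e m * ‖latticePoint e‖ ^ 2) ^ 2 := by ring
    _ = ‖latticePoint m‖ ^ 2 * ‖latticePoint e‖ ^ 2 - 1 := by
      rw [hcoord, norm_latticePoint_sq, norm_latticePoint_sq]
      linear_combination -hdet

lemma abs_rowCoordinate_mul_norm_le {e m : ℤ × ℤ} (hm : m ∈ adjacentRows e) (he : e ≠ 0) :
    |rowCoordinate e m| * ‖latticePoint e‖ ≤ ‖latticePoint m‖ := by
  have he1 := one_le_norm_latticePoint he
  rw [← abs_of_nonneg (norm_nonneg (latticePoint e)), ← abs_mul]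
  refine abs_le_of_sq_le_sq (le_of_mul_le_mul_right ?_ (by positivity : 0 < ‖latticePoint e‖ ^ 2))
    (norm_nonneg _)
  linarith [rowCoordinate_mul_norm_sq hm he]

lemma two_le_abs_rowCoordinate {e m : ℤ × ℤ} (hm : m ∈ adjacentRows e) (he : e ≠ 0) :
    2 ≤ |rowCoordinate e m| := by
  have he1 := one_le_norm_latticePoint he
  have hz := rowCoordinate_mul_norm_sq hm he
  by_contra! hlt
  have hz4 : rowCoordinate e m ^ 2 ≤ 4 := by
    rw [← sq_abs]
    nlinarith [abs_nonneg (rowCoordinate e m)]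
  have hm9 : (3 * ‖latticePoint e‖) ^ 2 ≤ ‖latticePoint m‖ ^ 2 := by
    gcongr
    exact hm.2
  nlinarith [one_le_pow₀ he1 (n := 4), pow_pos (zero_lt_one.trans_le he1) 4,
    mul_le_mul_of_nonneg_right hm9 (sq_nonneg ‖latticePoint e‖),
    mul_le_mul_of_nonneg_right hz4 (pow_nonneg (norm_nonneg (latticePoint e)) 4)]

lemma one_le_natAbs_floor_and_le {z : ℝ} (hz : 2 ≤ |z|) :
    1 ≤ ⌊z⌋.natAbs ∧ (⌊z⌋.natAbs : ℝ) ≤ 2 * |z| := by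
  have hdist : |⌊z⌋ - z| ≤ 1 := by
    rw [abs_le]
    constructor <;> linarith [Int.floor_le z, Int.lt_floor_add_one z]
  have hcast : (⌊z⌋.natAbs : ℝ) = |(⌊z⌋ : ℝ)| := by rw [Nat.cast_natAbs, Int.cast_abs]
  rw [← Nat.one_le_cast (α := ℝ), hcast]
  constructor
  · linarith [abs_sub_abs_le_abs_sub z ⌊z⌋, abs_sub_comm z ⌊z⌋]
  · linarith [abs_sub_abs_le_abs_sub (⌊z⌋ : ℝ) z]

lemma norm_rpow_le_of_mem_adjacentRows {σ : ℝ} (hσ0 : 0 ≤ σ) (hσ : σ ≤ 1) {e m : ℤ × ℤ}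
    (he : e ≠ 0) (hm : m ∈ adjacentRows e) :
    ‖latticePoint m‖ ^ (-(1 + σ)) ≤
      4 * ‖latticePoint e‖ ^ (-(1 + σ)) * ((rowIndex e m).2.natAbs : ℝ) ^ (-(1 + σ)) := by
  have he1 := one_le_norm_latticePoint he
  obtain ⟨hone, hle⟩ := one_le_natAbs_floor_and_le (two_le_abs_rowCoordinate hm he)
  have hn0 : (0 : ℝ) < ⌊rowCoordinate e m⌋.natAbs := by exact_mod_cast hone
  change _ ≤ _ * (⌊rowCoordinate e m⌋.natAbs : ℝ) ^ (-(1 + σ))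
  set n : ℝ := (⌊rowCoordinate e m⌋.natAbs : ℝ)
  set L := ‖latticePoint e‖
  have hbase : n * L / 2 ≤ ‖latticePoint m‖ := by
    nlinarith [abs_rowCoordinate_mul_norm_le hm he]
  calc ‖latticePoint m‖ ^ (-(1 + σ)) ≤ (n * L / 2) ^ (-(1 + σ)) :=
        Real.rpow_le_rpow_of_nonpos (by positivity) hbase (by linarith)
    _ = 2 ^ (1 + σ) * L ^ (-(1 + σ)) * n ^ (-(1 + σ)) := by
        rw [Real.div_rpow (by positivity) (by norm_num), Real.mul_rpow hn0.le (by positivity),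
          Real.rpow_neg zero_le_two, div_inv_eq_mul]
        ring
    _ ≤ 2 ^ (2 : ℝ) * L ^ (-(1 + σ)) * n ^ (-(1 + σ)) := by
        gcongr
        · exact one_le_two
        · linarith
    _ = 4 * L ^ (-(1 + σ)) * n ^ (-(1 + σ)) := by norm_num

lemma tsum_adjacentRows_le {σ : ℝ} (hσ0 : 0 ≤ σ) (hσ : σ ≤ 1) {e : ℤ × ℤ} (he : e ≠ 0) :
    ∑' m : adjacentRows e, ENNReal.ofReal (‖latticePoint m‖ ^ (-(1 + σ))) ≤
      16 * ENNReal.ofReal (‖latticePoint e‖ ^ (-(1 + σ))) * zetaSum σ := by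
  set c := 4 * ENNReal.ofReal (‖latticePoint e‖ ^ (-(1 + σ)))
  set g : ℕ → ℝ≥0∞ := fun n => ENNReal.ofReal ((n : ℝ) ^ (-(1 + σ)))
  have hterm (m : adjacentRows e) :
      ENNReal.ofReal (‖latticePoint m‖ ^ (-(1 + σ))) ≤ c * g (rowIndex e m).2.natAbs := by
    simp only [c, g]
    rw [← ENNReal.ofReal_ofNat 4, ← ENNReal.ofReal_mul (by norm_num),
      ← ENNReal.ofReal_mul (by positivity)]
    exact ENNReal.ofReal_le_ofReal (norm_rpow_le_of_mem_adjacentRows hσ0 hσ he m.2)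
  calc ∑' m : adjacentRows e, ENNReal.ofReal (‖latticePoint m‖ ^ (-(1 + σ)))
      ≤ ∑' m : adjacentRows e, c * g (rowIndex e m).2.natAbs := ENNReal.tsum_le_tsum hterm
    _ ≤ ∑' y : Bool × ℤ, c * g y.2.natAbs :=
        ENNReal.tsum_comp_le_tsum_of_injective (injOn_rowIndex he).injective
          fun y : Bool × ℤ => c * g y.2.natAbs
    _ = 2 * (c * ∑' n : ℤ, g n.natAbs) := by
        rw [ENNReal.tsum_prod', tsum_fintype, Fintype.sum_bool, ← two_mul, ENNReal.tsum_mul_left]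
    _ ≤ 2 * (c * (2 * zetaSum σ)) := by
        gcongr
        exact tsum_int_natAbs_le g
    _ = _ := by ring

/-! ### Counting visible scatterers -/

/-- The nonzero lattice points of norm at most `R` around the line of direction `(sin α, cos α)`,
within the distance that grows at rate `Δ` along the line. -/
def sector (α Δ R : ℝ) : Set (ℤ × ℤ) :=
  {m | m ≠ 0 ∧ ‖latticePoint m‖ ≤ R ∧ |across α m| ≤ 1 + Δ * ‖latticePoint m‖}

lemma tsum_sector_le_sum {α Δ R P β : ℝ} (hΔ : 0 ≤ Δ) (hP : 0 ≤ P) (hβ : 0 ≤ β) :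
    ∑' m : sector α Δ R, ENNReal.ofReal (P * ‖latticePoint m‖ ^ (-β)) ≤
      ENNReal.ofReal (4 * ∑ n ∈ Finset.Icc 1 ⌊R⌋₊,
        10 * (1 + 2 * Δ * n) * (P * (n : ℝ) ^ (-β))) := by
  set N := ⌊R⌋₊
  set g : ℕ → ℝ≥0∞ :=
    (Finset.Icc 1 N : Set ℕ).indicator fun n => ENNReal.ofReal (P * (n : ℝ) ^ (-β))
  have hg {n : ℕ} (hn : n ∈ Finset.Icc 1 N) : g n = ENNReal.ofReal (P * (n : ℝ) ^ (-β)) :=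
    indicator_of_mem (Finset.mem_coe.mpr hn) _
  have hg0 {n : ℕ} (hn : n ∉ Finset.Icc 1 N) : g n = 0 :=
    indicator_of_notMem (Finset.mem_coe.not.mpr hn) _
  rw [tsum_subtype (sector α Δ R) fun m => ENNReal.ofReal (P * ‖latticePoint m‖ ^ (-β))]
  refine (tsum_le_tsum_coordMax (α := α) (F := (sector α Δ R).indicator fun m =>
    ENNReal.ofReal (P * ‖latticePoint m‖ ^ (-β))) (g := g) hΔ
    (fun m hm => (mem_of_indicator_ne_zero hm : m ∈ sector α Δ R).2.2)
    fun m => indicator_apply_le' (fun ⟨hm0, hmR, _⟩ => ?_) fun _ => zero_le).trans_eq ?_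
  · have hpos := coordMax_pos hm0
    have hle := coordMax_le_norm_latticePoint m
    rw [hg (Finset.mem_Icc.mpr ⟨hpos, Nat.le_floor (hle.trans hmR)⟩)]
    exact ENNReal.ofReal_le_ofReal (mul_le_mul_of_nonneg_left
      (Real.rpow_le_rpow_of_nonpos (by exact_mod_cast hpos) hle (by linarith)) hP)
  · rw [tsum_eq_sum (s := Finset.Icc 1 N) fun n hn => by
        rw [hg0 hn, mul_zero],
      ENNReal.ofReal_mul (by norm_num), ENNReal.ofReal_ofNat,
      ENNReal.ofReal_sum_of_nonneg fun n _ => by positivity]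
    congr 1
    refine Finset.sum_congr rfl fun n hn => ?_
    rw [hg hn, ← ENNReal.ofReal_mul (by positivity)]

lemma tsum_sector_le {α Δ R P β A : ℝ} (hΔ : 0 ≤ Δ) (hR : 0 ≤ R) (hP : 0 ≤ P) (hβ : 1 / 2 ≤ β)
    (hA : ∑ n ∈ Finset.Icc 1 ⌊R⌋₊, (n : ℝ) ^ (1 - β) ≤ A) :
    ∑' m : sector α Δ R, ENNReal.ofReal (P * ‖latticePoint m‖ ^ (-β)) ≤
      ENNReal.ofReal (40 * P * (2 * √R + 2 * Δ * A)) := by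
  refine (tsum_sector_le_sum hΔ hP (by linarith)).trans (ENNReal.ofReal_le_ofReal ?_)
  have hterm (n : ℕ) (hn : n ∈ Finset.Icc 1 ⌊R⌋₊) :
      10 * (1 + 2 * Δ * n) * (P * (n : ℝ) ^ (-β)) ≤
        10 * P * (n : ℝ) ^ (-(1 / 2 : ℝ)) + 20 * P * Δ * (n : ℝ) ^ (1 - β) := by
    have hn1 : (1 : ℝ) ≤ n := by exact_mod_cast (Finset.mem_Icc.mp hn).1
    have hsplit : (n : ℝ) ^ (1 - β) = n * (n : ℝ) ^ (-β) := by
      rw [sub_eq_neg_add, Real.rpow_add_one (by positivity), mul_comm]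
    have hmono : P * (n : ℝ) ^ (-β) ≤ P * (n : ℝ) ^ (-(1 / 2 : ℝ)) := by gcongr
    rw [hsplit]
    linarith
  have hsqrt : ∑ n ∈ Finset.Icc 1 ⌊R⌋₊, (n : ℝ) ^ (-(1 / 2 : ℝ)) ≤ 2 * √R := by
    refine (sum_rpow_neg_half_le _).trans ?_
    gcongr
    exact Nat.floor_le hR
  calc 4 * ∑ n ∈ Finset.Icc 1 ⌊R⌋₊, 10 * (1 + 2 * Δ * n) * (P * (n : ℝ) ^ (-β))
      ≤ 4 * (10 * P * ∑ n ∈ Finset.Icc 1 ⌊R⌋₊, (n : ℝ) ^ (-(1 / 2 : ℝ)) +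
          20 * P * Δ * ∑ n ∈ Finset.Icc 1 ⌊R⌋₊, (n : ℝ) ^ (1 - β)) := by
        rw [Finset.mul_sum _ _ (10 * P), Finset.mul_sum _ _ (20 * P * Δ),
          ← Finset.sum_add_distrib]
        gcongr with n hn
        exact hterm n hn
    _ ≤ 4 * (10 * P * (2 * √R) + 20 * P * Δ * A) := by gcongr
    _ = 40 * P * (2 * √R + 2 * Δ * A) := by ring

lemma tsum_near_sector_le {ε ν c α : ℝ} (hε : 0 < ε) (hν0 : 0 ≤ ν) (hν : ν ≤ 1 / 2)
    (hc : 0 ≤ c) :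
    ∑' m : sector α (2 * c * ε ^ ν) (36 / ε), ENNReal.ofReal (ε * ‖latticePoint m‖ ^ (ν - 1)) ≤
      ENNReal.ofReal (34560 * (c + √ε)) := by
  have hsum : ∑ n ∈ Finset.Icc 1 ⌊36 / ε⌋₊, (n : ℝ) ^ (1 - (1 - ν)) ≤ (36 / ε) ^ (1 + ν) := by
    rw [sub_sub_cancel]
    refine (sum_rpow_le hν0 _).trans ?_
    gcongr
    exact Nat.floor_le (by positivity)
  have hsector := tsum_sector_le (α := α) (β := 1 - ν) (Δ := 2 * c * ε ^ ν) (by positivity)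
    (by positivity) hε.le (by linarith) hsum
  rw [neg_sub] at hsector
  refine hsector.trans (ENNReal.ofReal_le_ofReal ?_)
  have hsqrt : ε * √(36 / ε) = 6 * √ε := by
    rw [Real.sqrt_div (by norm_num), show (36 : ℝ) = 6 ^ 2 by norm_num,
      Real.sqrt_sq (by norm_num), mul_div_left_comm, Real.div_sqrt]
  have hpow : ε * (ε ^ ν * (36 / ε) ^ (1 + ν)) = 36 ^ (1 + ν) := by
    rw [← mul_assoc, mul_comm ε, ← Real.rpow_add_one hε.ne', add_comm ν,
      ← Real.mul_rpow hε.le (by positivity), mul_div_cancel₀ _ hε.ne']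
  have h216 : (36 : ℝ) ^ (1 + ν) ≤ 216 := by
    calc (36 : ℝ) ^ (1 + ν) ≤ 36 ^ (1 + 1 / 2 : ℝ) := by
          gcongr
          norm_num
      _ = 216 := by
          rw [Real.rpow_add (by norm_num), ← Real.sqrt_eq_rpow, Real.rpow_one,
            show (36 : ℝ) = 6 ^ 2 by norm_num, Real.sqrt_sq (by norm_num)]
          norm_num
  calc 40 * ε * (2 * √(36 / ε) + 2 * (2 * c * ε ^ ν) * (36 / ε) ^ (1 + ν))
      = 80 * (ε * √(36 / ε)) + 160 * c * (ε * (ε ^ ν * (36 / ε) ^ (1 + ν))) := by ring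
    _ ≤ 80 * (6 * √ε) + 160 * c * 216 := by
        rw [hsqrt, hpow]
        gcongr
    _ ≤ 34560 * (c + √ε) := by linarith [Real.sqrt_nonneg ε]

lemma tsum_far_sector_le {ε ν a η c α : ℝ} (hε0 : 0 < ε) (hε : ε ≤ 1) (hνa : 2 * ν ≤ a)
    (haν : a / 2 - ν ≤ 1 / 2) (ha : a ≤ 1 - η) (hc : 0 ≤ c) :
    ∑' e : sector α (2 * c * ε ^ ν) (4 / ε),
        ENNReal.ofReal (ε ^ (1 - a / 2) * ‖latticePoint e‖ ^ (-(1 + (a / 2 - ν)))) ≤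
      ENNReal.ofReal (1280 * (c + ε ^ (η / 2))) := by
  set σ := a / 2 - ν with hσ
  have hsum : ∑ n ∈ Finset.Icc 1 ⌊4 / ε⌋₊, (n : ℝ) ^ (1 - (1 + σ)) ≤ 2 * (4 / ε) ^ (1 - σ) := by
    rw [sub_add_cancel_left]
    refine (sum_rpow_neg_le haν _).trans ?_
    gcongr
    · linarith
    · exact Nat.floor_le (by positivity)
  refine (tsum_sector_le (by positivity) (by positivity) (by positivity) (by linarith)
    hsum).trans (ENNReal.ofReal_le_ofReal ?_)
  have hsqrt : ε ^ (1 - a / 2) * √(4 / ε) ≤ 2 * ε ^ (η / 2) := by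
    rw [Real.sqrt_div (by norm_num), show (4 : ℝ) = 2 ^ 2 by norm_num,
      Real.sqrt_sq (by norm_num), Real.sqrt_eq_rpow, mul_div_left_comm, ← Real.rpow_sub hε0]
    exact mul_le_mul_of_nonneg_left
      (Real.rpow_le_rpow_of_exponent_ge hε0 hε (by linarith)) zero_le_two
  have hpow : ε ^ (1 - a / 2) * (ε ^ ν * (4 / ε) ^ (1 - σ)) = 4 ^ (1 - σ) := by
    rw [← mul_assoc, ← Real.rpow_add hε0, show 1 - a / 2 + ν = 1 - σ by rw [hσ]; ring,
      ← Real.mul_rpow hε0.le (by positivity), mul_div_cancel₀ _ hε0.ne']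
  have hfour : (4 : ℝ) ^ (1 - σ) ≤ 4 :=
    Real.rpow_le_self_of_one_le (by norm_num) (by linarith)
  calc 40 * ε ^ (1 - a / 2) *
        (2 * √(4 / ε) + 2 * (2 * c * ε ^ ν) * (2 * (4 / ε) ^ (1 - σ)))
      = 80 * (ε ^ (1 - a / 2) * √(4 / ε)) +
          320 * c * (ε ^ (1 - a / 2) * (ε ^ ν * (4 / ε) ^ (1 - σ))) := by ring
    _ ≤ 80 * (2 * ε ^ (η / 2)) + 320 * c * 4 := by
        rw [hpow]
        gcongr
    _ ≤ 1280 * (c + ε ^ (η / 2)) := by linarith [Real.rpow_nonneg hε0.le (η / 2)]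

/-- The bound for the cosine of the outgoing angle at a visible scatterer at distance `L`: far
scatterers can only be hit through a corridor, almost tangentially. -/
def grazing (ε L : ℝ) : ℝ := if L < 36 / ε then 1 else √(8 / (ε * L))

lemma grazing_nonneg (ε L : ℝ) : 0 ≤ grazing ε L := by
  unfold grazing
  split_ifs <;> positivity

lemma mul_grazing_rpow_le {ε ν a L : ℝ} (hε : 0 < ε) (ha : a ≤ 1) (hL : 36 / ε ≤ L) :
    ε * L ^ (ν - 1) * grazing ε L ^ a ≤ 3 * ε ^ (1 - a / 2) * L ^ (-(1 + (a / 2 - ν))) := by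
  have hL0 : 0 < L := (by positivity : 0 < 36 / ε).trans_le hL
  have height : (8 : ℝ) ^ (a / 2) ≤ 3 := by
    calc (8 : ℝ) ^ (a / 2) ≤ 8 ^ (1 / 2 : ℝ) := by
          gcongr
          norm_num
      _ ≤ 3 := by
          rw [← Real.sqrt_eq_rpow]
          exact Real.sqrt_le_iff.mpr ⟨by norm_num, by norm_num⟩
  have hgrazing : grazing ε L ^ a = 8 ^ (a / 2) * (ε ^ (-(a / 2)) * L ^ (-(a / 2))) := by
    rw [grazing, if_neg hL.not_gt, Real.sqrt_eq_rpow, ← Real.rpow_mul (by positivity),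
      one_div_mul_eq_div, Real.div_rpow (by norm_num) (by positivity),
      Real.mul_rpow hε.le hL0.le, Real.rpow_neg hε.le, Real.rpow_neg hL0.le, ← mul_inv,
      div_eq_mul_inv]
  calc ε * L ^ (ν - 1) * grazing ε L ^ a
      = 8 ^ (a / 2) * (ε ^ (1 : ℝ) * ε ^ (-(a / 2))) * (L ^ (ν - 1) * L ^ (-(a / 2))) := by
        rw [hgrazing, Real.rpow_one]
        ring
    _ = 8 ^ (a / 2) * ε ^ (1 - a / 2) * L ^ (-(1 + (a / 2 - ν))) := by
        rw [← Real.rpow_add hε, ← Real.rpow_add hL0]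
        ring_nf
    _ ≤ 3 * ε ^ (1 - a / 2) * L ^ (-(1 + (a / 2 - ν))) := by gcongr

/-- The contribution of the scatterer `m` to the growth sum: the contraction of the billiard map on
the pieces near `m` is at most `ε * cos φ / ‖m‖`, and `cos φ` is interpolated between `grazing` and
the width of the homogeneity strip, with exponents `a` and `1 - a`. -/
def scattererWeight (ε ν a : ℝ) (m : ℤ × ℤ) : ℝ≥0∞ :=
  ENNReal.ofReal (ε * ‖latticePoint m‖ ^ (ν - 1) * grazing ε ‖latticePoint m‖ ^ a)

lemma tsum_scattererWeight_le_of_far {ε ν a η c α : ℝ} (hε0 : 0 < ε) (hε : ε ≤ 1) (hν : 0 ≤ ν)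
    (hη : 0 < η) (ha : a ≤ 1 - η) (hνa : 2 * ν ≤ a - η) (hc : 0 ≤ c) {P : Set (ℤ × ℤ)}
    (hfar : ∀ m ∈ P, 36 / ε ≤ ‖latticePoint m‖)
    (hP : P ⊆ ⋃ e : sector α (2 * c * ε ^ ν) (4 / ε), adjacentRows e) :
    ∑' m : P, scattererWeight ε ν a m ≤
      ENNReal.ofReal (61440 * (c + ε ^ (η / 2))) * zetaSum (η / 2) := by
  set σ := a / 2 - ν with hσ
  set Q := sector α (2 * c * ε ^ ν) (4 / ε)
  set K := 3 * ENNReal.ofReal (ε ^ (1 - a / 2))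
  set F : ℤ × ℤ → ℝ≥0∞ := fun m => ENNReal.ofReal (‖latticePoint m‖ ^ (-(1 + σ)))
  have hweight (m : P) : scattererWeight ε ν a m ≤ K * F m := by
    simp only [K, F]
    rw [← ENNReal.ofReal_ofNat 3, ← ENNReal.ofReal_mul (by norm_num),
      ← ENNReal.ofReal_mul (by positivity)]
    exact ENNReal.ofReal_le_ofReal (mul_grazing_rpow_le hε0 (by linarith) (hfar m m.2))
  have hQ : ∑' e : Q, ENNReal.ofReal (ε ^ (1 - a / 2)) * F e ≤
      ENNReal.ofReal (1280 * (c + ε ^ (η / 2))) := by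
    simp only [F, ← ENNReal.ofReal_mul (Real.rpow_nonneg hε0.le _)]
    exact tsum_far_sector_le hε0 hε (by linarith) (by linarith) ha hc
  calc ∑' m : P, scattererWeight ε ν a m ≤ ∑' m : P, K * F m := ENNReal.tsum_le_tsum hweight
    _ ≤ K * ∑' e : Q, ∑' m : adjacentRows e, F m := by
        rw [ENNReal.tsum_mul_left]
        gcongr
        exact (ENNReal.tsum_mono_subtype F hP).trans (ENNReal.tsum_iUnion_le_tsum F _)
    _ ≤ K * ∑' e : Q, 16 * F e * zetaSum (η / 2) := by
        gcongr with e
        refine (tsum_adjacentRows_le (by linarith) (by linarith) e.2.1).trans ?_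
        gcongr
        exact zetaSum_anti (half_pos hη) (by linarith)
    _ = 48 * (∑' e : Q, ENNReal.ofReal (ε ^ (1 - a / 2)) * F e) * zetaSum (η / 2) := by
        rw [ENNReal.tsum_mul_right, ENNReal.tsum_mul_left, ENNReal.tsum_mul_left]
        ring
    _ ≤ 48 * ENNReal.ofReal (1280 * (c + ε ^ (η / 2))) * zetaSum (η / 2) := by gcongr
    _ = ENNReal.ofReal (61440 * (c + ε ^ (η / 2))) * zetaSum (η / 2) := by
        rw [← ENNReal.ofReal_ofNat 48, ← ENNReal.ofReal_mul (by norm_num), ← mul_assoc]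
        norm_num

lemma tsum_scattererWeight_le_of_near {ε ν a η c α : ℝ} (hε0 : 0 < ε) (hε : ε ≤ 1)
    (hν0 : 0 ≤ ν) (hν : ν ≤ 1 / 2) (hη : η ≤ 1) (hc : 0 ≤ c) {P : Set (ℤ × ℤ)}
    (hnear : ∀ m ∈ P, ‖latticePoint m‖ < 36 / ε)
    (hP : P ⊆ sector α (2 * c * ε ^ ν) (36 / ε)) :
    ∑' m : P, scattererWeight ε ν a m ≤ ENNReal.ofReal (61440 * (c + ε ^ (η / 2))) := by
  set F : ℤ × ℤ → ℝ≥0∞ := fun m => ENNReal.ofReal (ε * ‖latticePoint m‖ ^ (ν - 1))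
  have hweight (m : P) : scattererWeight ε ν a m = F m := by
    rw [scattererWeight, grazing, if_pos (hnear m m.2), Real.one_rpow, mul_one]
  have hsqrt : √ε ≤ ε ^ (η / 2) := by
    rw [Real.sqrt_eq_rpow]
    exact Real.rpow_le_rpow_of_exponent_ge hε0 hε (by linarith)
  calc ∑' m : P, scattererWeight ε ν a m = ∑' m : P, F m := tsum_congr hweight
    _ ≤ ∑' m : sector α (2 * c * ε ^ ν) (36 / ε), F m := ENNReal.tsum_mono_subtype F hP
    _ ≤ ENNReal.ofReal (34560 * (c + √ε)) := tsum_near_sector_le hε0 hν0 hν hc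
    _ ≤ ENNReal.ofReal (61440 * (c + ε ^ (η / 2))) := by
        refine ENNReal.ofReal_le_ofReal ?_
        linarith [Real.sqrt_nonneg ε]

lemma tsum_scattererWeight_le {ε ν a η c α : ℝ} (hε0 : 0 < ε) (hε : ε ≤ 1) (hν : 0 ≤ ν)
    (hη : 0 < η) (ha : a ≤ 1 - η) (hνa : 2 * ν ≤ a - η) (hc : 0 ≤ c) {P : Set (ℤ × ℤ)}
    (hP : ∀ m ∈ P, m ≠ 0 ∧ |across α m| ≤ 1 + 2 * c * ε ^ ν * ‖latticePoint m‖)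
    (hfar : ∀ m ∈ P, 36 / ε ≤ ‖latticePoint m‖ →
      ∃ e ∈ sector α (2 * c * ε ^ ν) (4 / ε), m ∈ adjacentRows e) :
    ∑' m : P, scattererWeight ε ν a m ≤
      ENNReal.ofReal (61440 * (c + ε ^ (η / 2))) * (1 + zetaSum (η / 2)) := by
  set R : Set (ℤ × ℤ) := {m | ‖latticePoint m‖ < 36 / ε}
  have hsplit : P = P ∩ R ∪ P \ R := (inter_union_sdiff P R).symm
  rw [hsplit, mul_add, mul_one]
  refine (ENNReal.tsum_union_le (scattererWeight ε ν a) _ _).trans (add_le_add ?_ ?_)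
  · exact tsum_scattererWeight_le_of_near (α := α) hε0 hε hν (by linarith) (by linarith) hc
      (fun m hm => hm.2) fun m hm => ⟨(hP m hm.1).1, hm.2.le, (hP m hm.1).2⟩
  · refine tsum_scattererWeight_le_of_far (α := α) hε0 hε hν hη ha hνa hc
      (fun m hm => not_lt.mp hm.2) fun m hm => ?_
    obtain ⟨e, he, hme⟩ := hfar m hm.1 (not_lt.mp hm.2)
    exact mem_iUnion.mpr ⟨⟨e, he⟩, hme⟩

/-! ### Stable graphs and homogeneity strips -/

lemma dist_point_le (θ φ θ' φ' : ℝ) :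
    dist (point θ φ) (point θ' φ') ≤ |θ - θ'| + |φ - φ'| := by
  have hfst : dist (point θ φ).fst (point θ' φ').fst ≤ |θ - θ'| := by
    change dist (θ : Real.Angle) (θ' : Real.Angle) ≤ _
    rw [dist_eq_norm, ← Real.Angle.coe_sub, ← Real.norm_eq_abs]
    exact QuotientAddGroup.norm_mk_le_norm
  have hsnd : dist (point θ φ).snd (point θ' φ').snd = |φ - φ'| := rfl
  rw [WithLp.prod_dist_eq_of_L2, hsnd]
  calc √(dist (point θ φ).fst (point θ' φ').fst ^ 2 + |φ - φ'| ^ 2)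
      ≤ √((|θ - θ'| + |φ - φ'|) ^ 2) := by
        refine Real.sqrt_le_sqrt ?_
        have := pow_le_pow_left₀ dist_nonneg hfst 2
        nlinarith [mul_nonneg (abs_nonneg (θ - θ')) (abs_nonneg (φ - φ'))]
    _ = |θ - θ'| + |φ - φ'| := Real.sqrt_sq (by positivity)

lemma continuous_point : Continuous fun z : ℝ × ℝ => point z.1 z.2 :=
  (WithLp.prod_continuous_toLp 2 _ _).comp
    ((Real.Angle.continuous_coe.comp continuous_fst).prodMk continuous_snd)

lemma ofReal_abs_snd_sub_le_length {V : Set Cylinder} (hV : IsPreconnected V) {x y : Cylinder}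
    (hx : x ∈ V) (hy : y ∈ V) : ENNReal.ofReal |y.snd - x.snd| ≤ length V := by
  have hlip : LipschitzWith 1 fun z : Cylinder => z.snd :=
    LipschitzWith.mk_one WithLp.dist_snd_le
  have hsub : uIcc x.snd y.snd ⊆ (fun z : Cylinder => z.snd) '' V :=
    (hV.image _ hlip.continuous.continuousOn).ordConnected.uIcc_subset
      (mem_image_of_mem _ hx) (mem_image_of_mem _ hy)
  calc ENNReal.ofReal |y.snd - x.snd| = volume (uIcc x.snd y.snd) := Real.volume_interval.symm
    _ ≤ volume ((fun z : Cylinder => z.snd) '' V) := measure_mono hsub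
    _ = μH[1] ((fun z : Cylinder => z.snd) '' V) := by rw [hausdorffMeasure_real]
    _ ≤ ((1 : NNReal) : ℝ≥0∞) ^ (1 : ℝ) * μH[1] V := hlip.hausdorffMeasure_image_le zero_le_one V
    _ = length V := by rw [ENNReal.coe_one, ENNReal.one_rpow, one_mul, length]

/-- The set `W` is the graph, over the interval `I`, of a continuous function `w` with all slopes at
most `-1`. This is what the growth estimate needs to know about a stable leaf. -/
structure IsStableGraph (I : Set ℝ) (w : ℝ → ℝ) (W : Set Cylinder) : Prop where
  nonempty : I.Nonempty
  ordConnected : I.OrdConnected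
  image_eq : W = (fun θ => point θ (w θ)) '' I
  continuousOn : ContinuousOn w I
  mem_Icc : ∀ θ ∈ I, w θ ∈ Icc (-(π / 2)) (π / 2)
  sub_le : ∀ θ₁ ∈ I, ∀ θ₂ ∈ I, θ₁ ≤ θ₂ → θ₂ - θ₁ ≤ w θ₁ - w θ₂

lemma IsHomogeneous.subset_phaseSpace {r₀ : ℝ} {k₀ : ℕ} {W : Set Cylinder}
    (hW : IsHomogeneous r₀ k₀ W) : W ⊆ phaseSpace := by
  rcases hW with h | ⟨k, -, h | h⟩ <;> exact h.trans inter_subset_right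

lemma IsAdmissibleStableLeaf.exists_isStableGraph {ε r₀ B δ₀ : ℝ} {k₀ : ℕ} {W : Set Cylinder}
    (hW : IsAdmissibleStableLeaf ε r₀ k₀ B δ₀ W) : ∃ I w, IsStableGraph I w W := by
  obtain ⟨⟨I, w, hI, hIne, rfl, hw, hslope, -⟩, hhom, -, -⟩ := hW
  refine ⟨I, w, hIne.nonempty, hI, rfl, hw.continuousOn,
    fun θ hθ => hhom.subset_phaseSpace (mem_image_of_mem _ hθ), fun θ₁ h₁ θ₂ h₂ h => ?_⟩
  have hderiv (θ : ℝ) (hθ : θ ∈ interior I) : deriv w θ ≤ -1 := by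
    rw [← derivWithin_of_mem_nhds (mem_interior_iff_mem_nhds.mp hθ)]
    exact (hslope θ (interior_subset hθ)).2
  have hdiff : DifferentiableOn ℝ w (interior I) :=
    (hw.differentiableOn two_ne_zero).mono interior_subset
  linarith [hI.convex.image_sub_le_mul_sub_of_deriv_le hw.continuousOn hdiff hderiv θ₁ h₁ θ₂ h₂ h]

namespace IsStableGraph

variable {I : Set ℝ} {w : ℝ → ℝ} {W : Set Cylinder}

lemma isPreconnected (hW : IsStableGraph I w W) : IsPreconnected W := by
  rw [hW.image_eq]
  exact hW.ordConnected.isPreconnected.image _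
    (continuous_point.comp_continuousOn (continuousOn_id.prodMk hW.continuousOn))

lemma cos_nonneg (hW : IsStableGraph I w W) {θ : ℝ} (hθ : θ ∈ I) : 0 ≤ Real.cos (w θ) :=
  Real.cos_nonneg_of_mem_Icc (hW.mem_Icc θ hθ)

lemma abs_sub_le (hW : IsStableGraph I w W) {δ : ℝ} (hδ : 0 ≤ δ)
    (hlen : length W ≤ ENNReal.ofReal δ) {θ θ' : ℝ} (hθ : θ ∈ I) (hθ' : θ' ∈ I) :
    |w θ - w θ'| ≤ δ := by
  have hmem {t : ℝ} (ht : t ∈ I) : point t (w t) ∈ W := hW.image_eq ▸ mem_image_of_mem _ ht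
  rw [← ENNReal.ofReal_le_ofReal_iff hδ]
  exact (ofReal_abs_snd_sub_le_length hW.isPreconnected (hmem hθ') (hmem hθ)).trans hlen

lemma abs_direction_sub_le (hW : IsStableGraph I w W) {θ θ' : ℝ} (hθ : θ ∈ I) (hθ' : θ' ∈ I) :
    |θ - w θ - (θ' - w θ')| ≤ 2 * |w θ - w θ'| := by
  rcases le_total θ θ' with h | h
  · have := hW.sub_le θ hθ θ' hθ' h
    rw [abs_of_nonneg (by linarith : 0 ≤ w θ - w θ'), abs_of_nonpos (by linarith)]
    linarith
  · have := hW.sub_le θ' hθ' θ hθ h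
    rw [abs_of_nonpos (by linarith : w θ - w θ' ≤ 0), abs_of_nonneg (by linarith)]
    linarith

end IsStableGraph

/-- The distance of an outgoing angle to the end `π / 2` (for `true`) or `-(π / 2)` (for `false`)
of the interval of outgoing angles. -/
def edgeDist : Bool → ℝ → ℝ
  | true, φ => π / 2 - φ
  | false, φ => π / 2 + φ

lemma continuous_edgeDist (b : Bool) : Continuous (edgeDist b) := by
  cases b <;> unfold edgeDist <;> fun_prop

lemma edgeDist_add_edgeDist_of_ne {b b' : Bool} (h : b ≠ b') (φ : ℝ) :
    edgeDist b φ + edgeDist b' φ = π := by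
  cases b <;> cases b' <;> simp only [edgeDist, ne_eq, not_true_eq_false] at h ⊢ <;> ring

lemma cos_le_edgeDist {φ : ℝ} (hφ : φ ∈ Icc (-(π / 2)) (π / 2)) (b : Bool) :
    Real.cos φ ≤ edgeDist b φ := by
  cases b
  · rw [← Real.cos_neg, ← Real.sin_pi_div_two_sub, sub_neg_eq_add]
    exact Real.sin_le (by linarith [hφ.1])
  · rw [← Real.sin_pi_div_two_sub]
    exact Real.sin_le (by linarith [hφ.2])

lemma edgeDist_pos {x : Cylinder} (hx : x ∈ phaseSpace) (hx0 : x ∉ singularSetZero) (b : Bool) :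
    0 < edgeDist b x.snd :=
  (cos_pos_of_notMem_singularSetZero hx hx0).trans_le (cos_le_edgeDist hx b)

lemma mem_stripBoundaries_iff {r₀ : ℝ} {k₀ : ℕ} {x : Cylinder} (hx : x ∈ phaseSpace) :
    x ∈ stripBoundaries r₀ k₀ ↔ ∃ k : ℕ, k₀ ≤ k ∧ ∃ b, edgeDist b x.snd = (k : ℝ) ^ (-r₀) := by
  have hupper : |π / 2 - x.snd| = edgeDist true x.snd := abs_of_nonneg (by linarith [hx.2])
  have hlower : |-(π / 2) - x.snd| = edgeDist false x.snd := by
    rw [abs_of_nonpos (by linarith [hx.1]), neg_sub', neg_neg, sub_neg_eq_add, edgeDist]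
  simp only [stripBoundaries, mem_ofPred_eq, hupper, hlower, Bool.exists_bool, or_comm]

/-- The outgoing angles in the interior of a homogeneity strip: the central one for `none`, and the
`k`-th one at the end `b` of the interval of outgoing angles for `some (b, k)`. -/
def openStrip (r₀ : ℝ) (k₀ : ℕ) : Option (Bool × ℕ) → Set ℝ
  | none => {φ | ∀ b, (k₀ : ℝ) ^ (-r₀) < edgeDist b φ}
  | some (b, k) => {φ | k₀ ≤ k ∧ edgeDist b φ ∈ Ioo (((k : ℝ) + 1) ^ (-r₀)) ((k : ℝ) ^ (-r₀))}

lemma ordConnected_openStrip (r₀ : ℝ) (k₀ : ℕ) (s : Option (Bool × ℕ)) :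
    (openStrip r₀ k₀ s).OrdConnected := by
  refine ⟨fun φ₁ h₁ φ₂ h₂ φ hφ => ?_⟩
  rcases s with _ | ⟨b, k⟩
  · rintro (_ | _)
    · have := h₁ false
      simp only [edgeDist] at this ⊢
      linarith [hφ.1]
    · have := h₂ true
      simp only [edgeDist] at this ⊢
      linarith [hφ.2]
  · obtain ⟨hk, hlow₁, hupp₁⟩ := h₁
    obtain ⟨-, hlow₂, hupp₂⟩ := h₂
    refine ⟨hk, ?_⟩
    cases b <;> simp only [edgeDist] at * <;> constructor <;> linarith [hφ.1, hφ.2]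

lemma natCast_rpow_neg_anti {r : ℝ} (hr : 0 ≤ r) {j k : ℕ} (hj : 1 ≤ j) (hjk : j ≤ k) :
    (k : ℝ) ^ (-r) ≤ (j : ℝ) ^ (-r) :=
  Real.rpow_le_rpow_of_nonpos (by exact_mod_cast hj) (by exact_mod_cast hjk) (neg_nonpos.mpr hr)

lemma natCast_rpow_neg_le_one {r : ℝ} (hr : 0 ≤ r) {k : ℕ} (hk : 1 ≤ k) : (k : ℝ) ^ (-r) ≤ 1 :=
  (natCast_rpow_neg_anti hr le_rfl hk).trans_eq (by rw [Nat.cast_one, Real.one_rpow])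

lemma edgeDist_ne_of_mem_openStrip {r₀ φ : ℝ} {k₀ k : ℕ} {s : Option (Bool × ℕ)} (hr : 0 ≤ r₀)
    (hk₀ : 1 ≤ k₀) (hk : k₀ ≤ k) (hφ : φ ∈ openStrip r₀ k₀ s) (b : Bool) :
    edgeDist b φ ≠ (k : ℝ) ^ (-r₀) := by
  intro hb
  rcases s with _ | ⟨b', j⟩
  · exact ((hφ b).trans_eq hb).not_ge (natCast_rpow_neg_anti hr hk₀ hk)
  obtain ⟨hj, hlow, hupp⟩ := hφ
  rcases eq_or_ne b b' with rfl | hne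
  · rw [hb] at hlow hupp
    rcases le_or_gt k j with hle | hgt
    · exact hupp.not_ge (natCast_rpow_neg_anti hr (hk₀.trans hk) hle)
    · have := natCast_rpow_neg_anti hr j.succ_pos hgt
      rw [Nat.cast_succ] at this
      exact hlow.not_ge this
  · linarith [edgeDist_add_edgeDist_of_ne hne φ, Real.pi_gt_three,
      natCast_rpow_neg_le_one hr (hk₀.trans hk), natCast_rpow_neg_le_one hr (hk₀.trans hj)]

lemma exists_strip_index {r₀ d : ℝ} {k₀ : ℕ} (hr : 0 < r₀) (hd : 0 < d)
    (hd₀ : d < (k₀ : ℝ) ^ (-r₀)) (hne : ∀ k : ℕ, k₀ ≤ k → d ≠ (k : ℝ) ^ (-r₀)) :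
    ∃ k : ℕ, k₀ ≤ k ∧ d ∈ Ioo (((k : ℝ) + 1) ^ (-r₀)) ((k : ℝ) ^ (-r₀)) := by
  have hlim : Filter.Tendsto (fun k : ℕ => (k : ℝ) ^ (-r₀)) Filter.atTop (nhds 0) :=
    (tendsto_rpow_neg_atTop hr).comp tendsto_natCast_atTop_atTop
  have hsmall : ∃ n : ℕ, ((k₀ + n : ℕ) : ℝ) ^ (-r₀) < d :=
    ((Filter.tendsto_atTop_mono (fun n => n.le_add_left k₀) Filter.tendsto_id).eventually
      (hlim.eventually_lt_const hd)).exists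
  classical
  obtain ⟨n, hn⟩ : ∃ n, Nat.find hsmall = n + 1 := Nat.exists_eq_add_one_of_ne_zero fun h =>
    hd₀.not_gt (by simpa only [h, add_zero] using Nat.find_spec hsmall)
  have hlow := Nat.find_spec hsmall
  have hupp := Nat.find_min hsmall (m := n) (by omega)
  rw [hn, ← add_assoc, Nat.cast_succ] at hlow
  have hle : k₀ ≤ k₀ + n := Nat.le_add_right _ _
  exact ⟨k₀ + n, hle, hlow, lt_of_le_of_ne (not_lt.mp hupp) (hne _ hle)⟩

lemma exists_mem_openStrip {r₀ : ℝ} {k₀ : ℕ} {x : Cylinder} (hr : 0 < r₀)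
    (hx : x ∈ phaseSpace) (hx0 : x ∉ singularSetZero) (hxb : x ∉ stripBoundaries r₀ k₀) :
    ∃ s, x.snd ∈ openStrip r₀ k₀ s := by
  rw [mem_stripBoundaries_iff hx] at hxb
  push Not at hxb
  by_cases hcentral : ∀ b, (k₀ : ℝ) ^ (-r₀) < edgeDist b x.snd
  · exact ⟨none, hcentral⟩
  · push Not at hcentral
    obtain ⟨b, hb⟩ := hcentral
    obtain ⟨k, hk⟩ := exists_strip_index hr (edgeDist_pos hx hx0 b)
      (lt_of_le_of_ne hb (hxb k₀ le_rfl b)) fun k hk => hxb k hk b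
    exact ⟨some (b, k), hk⟩

/-- A bound for `cos φ` on a homogeneity strip. -/
def stripWidth (r₀ : ℝ) : Option (Bool × ℕ) → ℝ
  | none => 1
  | some (_, k) => (k : ℝ) ^ (-r₀)

lemma stripWidth_nonneg (r₀ : ℝ) (s : Option (Bool × ℕ)) : 0 ≤ stripWidth r₀ s := by
  rcases s with _ | ⟨_, k⟩ <;> unfold stripWidth <;> positivity

lemma cos_le_stripWidth {r₀ : ℝ} {k₀ : ℕ} {s : Option (Bool × ℕ)} {V : Set Cylinder}
    {x y : Cylinder} (hV : IsPreconnected V) (hVp : V ⊆ phaseSpace)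
    (hVb : Disjoint V (stripBoundaries r₀ k₀)) (hx : x ∈ V) (hy : y ∈ V)
    (hs : x.snd ∈ openStrip r₀ k₀ s) : Real.cos y.snd ≤ stripWidth r₀ s := by
  rcases s with _ | ⟨b, k⟩
  · exact Real.cos_le_one _
  refine (cos_le_edgeDist (hVp hy) b).trans ?_
  by_contra! hlt
  have hcont : Continuous fun z : Cylinder => edgeDist b z.snd :=
    (continuous_edgeDist b).comp (by fun_prop)
  obtain ⟨z, hz, hzk⟩ :=
    hV.intermediate_value hx hy hcont.continuousOn ⟨hs.2.2.le, hlt.le⟩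
  exact disjoint_left.mp hVb hz ((mem_stripBoundaries_iff (hVp hz)).mpr ⟨k, hs.1, b, hzk⟩)

lemma min_le_rpow_mul_rpow {p q a : ℝ} (hp : 0 ≤ p) (hq : 0 ≤ q) (ha0 : 0 ≤ a) (ha1 : a ≤ 1) :
    min p q ≤ p ^ a * q ^ (1 - a) := by
  have hmin := le_min hp hq
  calc min p q = min p q ^ a * min p q ^ (1 - a) := by
        rw [← Real.rpow_add_of_nonneg hmin ha0 (by linarith), add_sub_cancel, Real.rpow_one]
    _ ≤ p ^ a * q ^ (1 - a) := by
        gcongr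
        · exact min_le_left _ _
        · exact min_le_right _ _

/-- The weight of a homogeneity strip in the growth sum: the summable part of its width. -/
def stripWeight (η : ℝ) : Option (Bool × ℕ) → ℝ
  | none => 1
  | some (_, k) => (k : ℝ) ^ (-(1 + η))

lemma stripWidth_rpow_le {r₀ η : ℝ} (hr : 1 ≤ r₀) (hη : 0 < η) (s : Option (Bool × ℕ)) :
    stripWidth r₀ s ^ (1 / r₀ + η) ≤ stripWeight η s := by
  rcases s with _ | ⟨_, k⟩
  · exact (Real.one_rpow _).le
  have hexp : -r₀ * (1 / r₀ + η) = -(1 + r₀ * η) := by field_simp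
  simp only [stripWidth, stripWeight]
  rw [← Real.rpow_mul k.cast_nonneg, hexp]
  rcases k.eq_zero_or_pos with rfl | hk
  · rw [Nat.cast_zero, Real.zero_rpow (by nlinarith), Real.zero_rpow (by linarith)]
  · exact Real.rpow_le_rpow_of_exponent_le (by exact_mod_cast hk) (by nlinarith)

lemma tsum_stripWeight (η : ℝ) :
    ∑' s, ENNReal.ofReal (stripWeight η s) = 1 + 2 * zetaSum η := by
  rw [← (Equiv.optionEquivSumPUnit.{0} (Bool × ℕ)).symm.tsum_eq,
    ENNReal.summable.tsum_sum ENNReal.summable, add_comm]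
  congr 1
  · simp [stripWeight]
  · calc ∑' p : Bool × ℕ, ENNReal.ofReal (stripWeight η (some p))
        = ∑' (_ : Bool) (k : ℕ), ENNReal.ofReal ((k : ℝ) ^ (-(1 + η))) :=
          ENNReal.tsum_prod (f := fun b k => ENNReal.ofReal (stripWeight η (some (b, k))))
      _ = 2 * zetaSum η := by rw [tsum_fintype, Fintype.sum_bool, ← two_mul, zetaSum]

/-! ### The pieces of the preimage -/

namespace IsStableGraph

variable {ε r₀ : ℝ} {k₀ : ℕ} {I : Set ℝ} {w : ℝ → ℝ} {W : Set Cylinder}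

lemma exists_eq_backPoint (hW : IsStableGraph I w W) (hε0 : 0 < ε) (hε : ε < 1 / 2)
    {x : Cylinder} (hx : x ∈ cutPreimage ε r₀ k₀ W) :
    ∃ θ ∈ I, w θ ∈ Ioo (-(π / 2)) (π / 2) ∧ Visible ε (w θ) (θ - w θ) (-displacement ε x) ∧
      x = backPoint ε θ (w θ) (-displacement ε x) := by
  obtain ⟨⟨hxp, hxW⟩, hcut⟩ := hx
  simp only [mem_union, not_or, singularSetOne] at hcut
  obtain ⟨⟨hx0, hTx⟩, -⟩ := hcut
  rw [hW.image_eq] at hxW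
  obtain ⟨θ, hθ, hT⟩ := hxW
  obtain ⟨hvis, hback⟩ := visible_and_eq_backPoint hε0 hε hxp hx0 hT.symm
  have hgraze : ¬(w θ = π / 2 ∨ w θ = -(π / 2)) := fun h => hTx ⟨hxp, hT ▸ h⟩
  rw [not_or] at hgraze
  have hw := hW.mem_Icc θ hθ
  exact ⟨θ, hθ, ⟨lt_of_le_of_ne hw.1 (Ne.symm hgraze.2), lt_of_le_of_ne hw.2 hgraze.1⟩, hvis, hback⟩

lemma continuousOn_backPoint (hW : IsStableGraph I w W) (m : ℤ × ℤ) :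
    ContinuousOn (fun θ => backPoint ε θ (w θ) m) I := by
  have hw := hW.continuousOn
  have hangle : ContinuousOn (fun θ => backAngle ε (w θ) (θ - w θ) m) I := by
    simp only [backAngle, offset, across_apply]
    exact Real.continuous_arcsin.comp_continuousOn (by fun_prop)
  exact continuous_point.comp_continuousOn (f := fun θ =>
    (θ - w θ + π - backAngle ε (w θ) (θ - w θ) m, backAngle ε (w θ) (θ - w θ) m)) (by fun_prop)

lemma backPoint_mem_cutPreimage (hW : IsStableGraph I w W) (hε0 : 0 < ε) (hε : ε < 1 / 2)
    (hr : 0 ≤ r₀) (hk₀ : 1 ≤ k₀) {θ : ℝ} (hθ : θ ∈ I) (hwθ : w θ ∈ Ioo (-(π / 2)) (π / 2))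
    {m : ℤ × ℤ} (hvis : Visible ε (w θ) (θ - w θ) m) {s : Option (Bool × ℕ)}
    (hs : (backPoint ε θ (w θ) m).snd ∈ openStrip r₀ k₀ s) :
    backPoint ε θ (w θ) m ∈ cutPreimage ε r₀ k₀ W := by
  have hT := billiardMap_backPoint hε0 hε (hW.mem_Icc θ hθ) hvis
  have hangle : (backPoint ε θ (w θ) m).snd ∈ Ioo (-(π / 2)) (π / 2) :=
    backAngle_mem_Ioo hε0 hvis.1
  have hphase : backPoint ε θ (w θ) m ∈ phaseSpace := Ioo_subset_Icc_self hangle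
  refine ⟨⟨hphase, hT ▸ hW.image_eq ▸ mem_image_of_mem _ hθ⟩, ?_⟩
  rintro (((h | h) | ⟨-, h⟩) | h)
  · exact hangle.2.ne h
  · exact hangle.1.ne' h
  · rw [hT] at h
    exact h.elim hwθ.2.ne hwθ.1.ne'
  · obtain ⟨k, hk, b, hb⟩ := (mem_stripBoundaries_iff hphase).mp h
    exact edgeDist_ne_of_mem_openStrip hr hk₀ hk hs b hb

lemma connectedComponentIn_backPoint_eq (hW : IsStableGraph I w W) (hε0 : 0 < ε)
    (hε : ε < 1 / 2) (hr : 0 ≤ r₀) (hk₀ : 1 ≤ k₀) {θ₁ θ₂ : ℝ} {m : ℤ × ℤ}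
    {s : Option (Bool × ℕ)} (hθ₁ : θ₁ ∈ I) (hθ₂ : θ₂ ∈ I)
    (hα : |θ₁ - w θ₁ - (θ₂ - w θ₂)| ≤ (1 - 2 * ε) / 4)
    (hw₁ : w θ₁ ∈ Ioo (-(π / 2)) (π / 2)) (hw₂ : w θ₂ ∈ Ioo (-(π / 2)) (π / 2))
    (hvis₁ : Visible ε (w θ₁) (θ₁ - w θ₁) m) (hvis₂ : Visible ε (w θ₂) (θ₂ - w θ₂) m)
    (hs₁ : (backPoint ε θ₁ (w θ₁) m).snd ∈ openStrip r₀ k₀ s)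
    (hs₂ : (backPoint ε θ₂ (w θ₂) m).snd ∈ openStrip r₀ k₀ s) :
    connectedComponentIn (cutPreimage ε r₀ k₀ W) (backPoint ε θ₁ (w θ₁) m) =
      connectedComponentIn (cutPreimage ε r₀ k₀ W) (backPoint ε θ₂ (w θ₂) m) := by
  wlog hle : θ₁ ≤ θ₂ generalizing θ₁ θ₂
  · exact (this hθ₂ hθ₁ (by rwa [abs_sub_comm]) hw₂ hw₁ hvis₂ hvis₁ hs₂ hs₁
      (le_of_not_ge hle)).symm
  have hI : Icc θ₁ θ₂ ⊆ I := hW.ordConnected.out hθ₁ hθ₂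
  have harc : (fun θ => backPoint ε θ (w θ) m) '' Icc θ₁ θ₂ ⊆ cutPreimage ε r₀ k₀ W := by
    rintro _ ⟨θ, hθ, rfl⟩
    have hslope₁ := hW.sub_le θ₁ hθ₁ θ (hI hθ) hθ.1
    have hslope₂ := hW.sub_le θ (hI hθ) θ₂ hθ₂ hθ.2
    have hθ₁θ := hθ.1
    have hθθ₂ := hθ.2
    have hα' := neg_le_of_abs_le hα
    have hvis := visible_between (φ₁ := w θ₁) (φ := w θ) (φ₂ := w θ₂)
      (α₁ := θ₁ - w θ₁) (α := θ - w θ) (α₂ := θ₂ - w θ₂) hε0 hε (by linarith) (by linarith)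
      (by linarith) (by linarith) (by linarith) hvis₁ hvis₂ (hW.cos_nonneg hθ₁)
      (hW.cos_nonneg (hI hθ)) (hW.cos_nonneg hθ₂)
    obtain ⟨hlow, hupp⟩ := offset_mem_Icc_of_visible (φ₁ := w θ₁) (φ := w θ) (φ₂ := w θ₂)
      (α₁ := θ₁ - w θ₁) (α := θ - w θ) (α₂ := θ₂ - w θ₂) hε0 hε (by linarith) (by linarith)
      (by linarith) (by linarith) (by linarith) hvis₁ hvis₂ (hW.cos_nonneg hθ₁)
      (hW.cos_nonneg hθ₂)
    refine hW.backPoint_mem_cutPreimage hε0 hε hr hk₀ (hI hθ)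
      ⟨by linarith [hw₂.1], by linarith [hw₁.2]⟩ hvis
      ((ordConnected_openStrip r₀ k₀ s).out hs₁ hs₂ ⟨?_, ?_⟩)
    · exact Real.monotone_arcsin (by gcongr)
    · exact Real.monotone_arcsin (by gcongr)
  have hconn := isPreconnected_Icc.image _ ((hW.continuousOn_backPoint (ε := ε) m).mono hI)
  exact connectedComponentIn_eq (hconn.subset_connectedComponentIn
    (mem_image_of_mem _ (left_mem_Icc.mpr hle)) harc (mem_image_of_mem _ (right_mem_Icc.mpr hle)))

end IsStableGraph

lemma displacement_eq_of_isPreconnected {ε r₀ : ℝ} {k₀ : ℕ} {V W : Set Cylinder} (hε0 : 0 < ε)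
    (hε : ε < 1 / 2) (hV : IsPreconnected V) (hVW : V ⊆ cutPreimage ε r₀ k₀ W) {x y : Cylinder}
    (hx : x ∈ V) (hy : y ∈ V) : displacement ε x = displacement ε y := by
  refine hV.constant (fun z hz => tendsto_nhds_of_eventually_eq ?_) hx hy
  have hsub : V ⊆ phaseSpace := fun z hz => (hVW hz).1.1
  exact nhdsWithin_mono z hsub
    (eventually_displacement_eq hε0 hε (hsub hz) fun h => (hVW hz).2 (Or.inl h))

lemma pieceDisplacement_eq {ε : ℝ} {V : Set Cylinder} {x : Cylinder} (hx : x ∈ V)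
    (hV : ∀ y ∈ V, displacement ε y = displacement ε x) :
    pieceDisplacement ε V = displacement ε x :=
  (Classical.epsilon_spec (p := fun ℓ => ∀ y ∈ V, displacement ε y = ℓ) ⟨_, hV⟩ x hx).symm

lemma abs_sin_sub_le_of_cos_le {f g q : ℝ} (hf : f ∈ Icc (-(π / 2)) (π / 2))
    (hg : g ∈ Icc (-(π / 2)) (π / 2)) (h : ∀ t ∈ uIcc f g, Real.cos t ≤ q) :
    |Real.sin g - Real.sin f| ≤ q * |g - f| := by
  refine (convex_uIcc f g).norm_image_sub_le_of_norm_deriv_le (f := Real.sin)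
    (fun t _ => Real.differentiableAt_sin) (fun t ht => ?_) left_mem_uIcc right_mem_uIcc
  rw [Real.deriv_sin, Real.norm_eq_abs, abs_of_nonneg]
  · exact h t ht
  · exact Real.cos_nonneg_of_mem_Icc (uIcc_subset_Icc hf hg ht)

lemma dist_point_le_mul_dist_backPoint {ε θ₁ θ₂ φ₁ φ₂ q : ℝ} {m : ℤ × ℤ} (hε0 : 0 < ε)
    (hε : ε < 1 / 2) (hθ : θ₁ ≤ θ₂) (hφ : θ₂ - θ₁ ≤ φ₁ - φ₂)
    (hα : θ₂ - φ₂ - (θ₁ - φ₁) ≤ (1 - 2 * ε) / 4) (hcos : 0 ≤ Real.cos φ₁)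
    (h₁ : Visible ε φ₁ (θ₁ - φ₁) m) (h₂ : Visible ε φ₂ (θ₂ - φ₂) m)
    (hq : ∀ f ∈ uIcc (backAngle ε φ₁ (θ₁ - φ₁) m) (backAngle ε φ₂ (θ₂ - φ₂) m),
      Real.cos f ≤ q) :
    dist (point θ₁ φ₁) (point θ₂ φ₂) ≤ 2 * ε * q / ((1 - 2 * ε) * ‖latticePoint m‖) *
      dist (backPoint ε θ₁ φ₁ m) (backPoint ε θ₂ φ₂ m) := by
  set f₁ := backAngle ε φ₁ (θ₁ - φ₁) m
  set f₂ := backAngle ε φ₂ (θ₂ - φ₂) m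
  have hf₁I : f₁ ∈ Icc (-(π / 2)) (π / 2) := Ioo_subset_Icc_self (backAngle_mem_Ioo hε0 h₁.1)
  have hf₂I : f₂ ∈ Icc (-(π / 2)) (π / 2) := Ioo_subset_Icc_self (backAngle_mem_Ioo hε0 h₂.1)
  have hq0 : 0 ≤ q := (Real.cos_nonneg_of_mem_Icc hf₁I).trans (hq f₁ left_mem_uIcc)
  have hgrowth : (1 - 2 * ε) / 2 * ‖latticePoint m‖ * (θ₂ - φ₂ - (θ₁ - φ₁)) ≤
      ε * (Real.sin f₂ - Real.sin f₁) := by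
    rw [mul_sub ε, sin_backAngle hε0 h₁.1.le, sin_backAngle hε0 h₂.1.le]
    exact offset_growth_left hε0 hε (by linarith) (by linarith) hα h₁.ne_zero hcos
      (norm_le_of_abs_offset_le hε0 hε hcos h₁.1.le h₁.2.1)
  have hsin : Real.sin f₂ - Real.sin f₁ ≤ q * dist (backPoint ε θ₁ φ₁ m) (backPoint ε θ₂ φ₂ m) :=
    calc Real.sin f₂ - Real.sin f₁ ≤ |Real.sin f₂ - Real.sin f₁| := le_abs_self _
      _ ≤ q * |f₂ - f₁| := abs_sin_sub_le_of_cos_le hf₁I hf₂I hq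
      _ ≤ q * dist (backPoint ε θ₁ φ₁ m) (backPoint ε θ₂ φ₂ m) := by
        rw [abs_sub_comm]
        gcongr
        exact WithLp.dist_snd_le (x := backPoint ε θ₁ φ₁ m) (y := backPoint ε θ₂ φ₂ m)
  have hnorm : 0 < (1 - 2 * ε) * ‖latticePoint m‖ :=
    mul_pos (by linarith) (zero_lt_one.trans_le (one_le_norm_latticePoint h₁.ne_zero))
  calc dist (point θ₁ φ₁) (point θ₂ φ₂) ≤ |θ₁ - θ₂| + |φ₁ - φ₂| := dist_point_le _ _ _ _
    _ = θ₂ - φ₂ - (θ₁ - φ₁) := by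
      rw [abs_of_nonpos (by linarith), abs_of_nonneg (by linarith)]
      ring
    _ ≤ 2 * ε * q / ((1 - 2 * ε) * ‖latticePoint m‖) *
        dist (backPoint ε θ₁ φ₁ m) (backPoint ε θ₂ φ₂ m) := by
      rw [div_mul_eq_mul_div, le_div_iff₀ hnorm]
      linarith [mul_le_mul_of_nonneg_left hsin hε0.le]

lemma floor_div_mem_Icc {x ρ : ℝ} {N : ℕ} (hρ : 0 < ρ) (hx : |x| ≤ N * ρ) :
    ⌊x / ρ⌋ ∈ Finset.Icc (-(N : ℤ)) N := by
  obtain ⟨hlow, hupp⟩ := abs_le.mp hx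
  rw [Finset.mem_Icc]
  refine ⟨Int.le_floor.mpr ?_, Int.cast_le.mp ((Int.floor_le _).trans ?_)⟩
  · rw [le_div_iff₀ hρ, Int.cast_neg, Int.cast_natCast]
    linarith
  · rwa [div_le_iff₀ hρ, Int.cast_natCast]

lemma abs_sub_le_of_floor_div_eq {x y ρ : ℝ} (hρ : 0 < ρ) (h : ⌊x / ρ⌋ = ⌊y / ρ⌋) :
    |x - y| ≤ ρ := by
  have := Int.abs_sub_lt_one_of_floor_eq_floor h
  rw [← sub_div, abs_div, abs_of_pos hρ, div_lt_one hρ] at this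
  exact this.le

lemma card_Icc_neg (N : ℕ) : (Finset.Icc (-(N : ℤ)) N).card = 2 * N + 1 := by
  rw [Int.card_Icc]
  omega

lemma length_image_le_card_mul {ι : Type*} {f : Cylinder → Cylinder} {K : NNReal} {J : Finset ι}
    {V : Set Cylinder} {U : ι → Set Cylinder} (hVU : V ⊆ ⋃ j ∈ J, U j)
    (hf : ∀ j ∈ J, LipschitzOnWith K f (V ∩ U j)) : length (f '' V) ≤ J.card * (K * length V) := by
  have hcover : f '' V ⊆ ⋃ j ∈ J, f '' (V ∩ U j) := by
    rintro _ ⟨x, hx, rfl⟩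
    obtain ⟨j, hj, hxj⟩ := mem_iUnion₂.mp (hVU hx)
    exact mem_biUnion hj (mem_image_of_mem f ⟨hx, hxj⟩)
  calc length (f '' V) ≤ length (⋃ j ∈ J, f '' (V ∩ U j)) := measure_mono hcover
    _ ≤ ∑ j ∈ J, length (f '' (V ∩ U j)) := measure_biUnion_finset_le _ _
    _ ≤ ∑ _j ∈ J, K * length V := by
      refine Finset.sum_le_sum fun j hj => ?_
      have hlip := (hf j hj).hausdorffMeasure_image_le (d := 1) zero_le_one
      rw [ENNReal.rpow_one] at hlip
      exact hlip.trans (by gcongr; exact measure_mono inter_subset_left)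
    _ = J.card * (K * length V) := by rw [Finset.sum_const, nsmul_eq_mul]

/-! ### Expansion on a piece -/

lemma cos_backAngle_le_grazing {ε φ α : ℝ} {m : ℤ × ℤ} (hε0 : 0 < ε) (hε : ε < 1 / 2)
    (h : Visible ε φ α m) : Real.cos (backAngle ε φ α m) ≤ grazing ε ‖latticePoint m‖ := by
  unfold grazing
  split_ifs with hnear
  · exact Real.cos_le_one _
  push Not at hnear
  have hL : 0 < ‖latticePoint m‖ := lt_of_lt_of_le (by positivity) hnear
  have hoff := (h.far hε0 hε hnear).2
  rw [← sin_backAngle hε0 h.1.le, le_div_iff₀ hL] at hoff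
  refine Real.le_sqrt_of_sq_le ((le_div_iff₀ (by positivity)).mpr ?_)
  refine le_of_mul_le_mul_left ?_ hε0
  rw [Real.cos_sq']
  linarith

lemma abs_across_le_add {α β d : ℝ} {m : ℤ × ℤ} (h : |across α m| ≤ 1) (hd : |β - α| ≤ d) :
    |across β m| ≤ 1 + d * ‖latticePoint m‖ := by
  have hdiff := (abs_across_sub_le α β m).trans
    (mul_le_mul_of_nonneg_left hd (norm_nonneg (latticePoint m)))
  linarith [abs_sub_abs_le_abs_sub (across β m) (across α m)]

namespace IsStableGraph

variable {ε r₀ ρ α₀ η : ℝ} {k₀ N : ℕ} {I : Set ℝ} {w : ℝ → ℝ} {V W : Set Cylinder}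

lemma lipschitzOnWith_billiardMap (hW : IsStableGraph I w W) (hε0 : 0 < ε) (hε : ε < 1 / 2)
    (hV : IsPreconnected V) {q : ℝ} (hq : ∀ x ∈ V, Real.cos x.snd ≤ q) {U : Set Cylinder}
    (hUV : U ⊆ V) {m : ℤ × ℤ} {A : Set ℝ}
    (hA : ∀ θ ∈ A, ∀ θ' ∈ A, |θ - w θ - (θ' - w θ')| ≤ (1 - 2 * ε) / 4)
    (hU : ∀ x ∈ U, ∃ θ ∈ I ∩ A, Visible ε (w θ) (θ - w θ) m ∧ x = backPoint ε θ (w θ) m) :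
    LipschitzOnWith (2 * ε * q / ((1 - 2 * ε) * ‖latticePoint m‖)).toNNReal
      (billiardMap ε) U := by
  refine LipschitzOnWith.of_dist_le_mul fun x₁ hx₁ x₂ hx₂ => ?_
  refine le_trans ?_ (mul_le_mul_of_nonneg_right (Real.le_coe_toNNReal _) dist_nonneg)
  obtain ⟨θ₁, ⟨hθ₁, hA₁⟩, hvis₁, rfl⟩ := hU x₁ hx₁
  obtain ⟨θ₂, ⟨hθ₂, hA₂⟩, hvis₂, rfl⟩ := hU x₂ hx₂
  wlog hle : θ₁ ≤ θ₂ generalizing θ₁ θ₂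
  · rw [dist_comm, dist_comm (backPoint ε θ₁ _ _)]
    exact this θ₂ hθ₂ hA₂ hvis₂ hx₂ θ₁ hθ₁ hA₁ hvis₁ hx₁ (le_of_not_ge hle)
  have hslope := hW.sub_le θ₁ hθ₁ θ₂ hθ₂ hle
  rw [billiardMap_backPoint hε0 hε (hW.mem_Icc θ₁ hθ₁) hvis₁,
    billiardMap_backPoint hε0 hε (hW.mem_Icc θ₂ hθ₂) hvis₂]
  refine dist_point_le_mul_dist_backPoint hε0 hε hle hslope
    (le_of_abs_le (hA θ₂ hA₂ θ₁ hA₁)) (hW.cos_nonneg hθ₁) hvis₁ hvis₂ fun f hf => ?_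
  have hsnd : Continuous fun z : Cylinder => z.snd := by fun_prop
  obtain ⟨z, hz, rfl⟩ := (hV.image _ hsnd.continuousOn).ordConnected.uIcc_subset
    (mem_image_of_mem _ (hUV hx₁)) (mem_image_of_mem _ (hUV hx₂)) hf
  exact hq z hz

lemma length_image_le (hW : IsStableGraph I w W) (hε0 : 0 < ε) (hε : ε < 1 / 2) (hρ0 : 0 < ρ)
    (hρ : ρ ≤ (1 - 2 * ε) / 4) (hN : ∀ θ ∈ I, |θ - w θ - α₀| ≤ N * ρ) (hV : IsPreconnected V)
    (hVW : V ⊆ cutPreimage ε r₀ k₀ W) {m : ℤ × ℤ} (hm : ∀ x ∈ V, -displacement ε x = m)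
    {q : ℝ} (hq : ∀ x ∈ V, Real.cos x.snd ≤ q) :
    length (billiardMap ε '' V) ≤ (2 * N + 1 : ℕ) *
      (ENNReal.ofReal (2 * ε * q / ((1 - 2 * ε) * ‖latticePoint m‖)) * length V) := by
  set cell : ℝ → ℤ := fun θ => ⌊(θ - w θ - α₀) / ρ⌋
  set U : ℤ → Set Cylinder := fun j => {x | ∃ θ ∈ I ∩ {θ | cell θ = j},
    Visible ε (w θ) (θ - w θ) m ∧ x = backPoint ε θ (w θ) m}
  have hcover : V ⊆ ⋃ j ∈ Finset.Icc (-(N : ℤ)) N, U j := fun x hx => by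
    obtain ⟨θ, hθ, -, hvis, hback⟩ := hW.exists_eq_backPoint hε0 hε (hVW hx)
    rw [hm x hx] at hvis hback
    exact mem_biUnion (floor_div_mem_Icc hρ0 (hN θ hθ)) ⟨θ, ⟨hθ, rfl⟩, hvis, hback⟩
  rw [← card_Icc_neg]
  refine length_image_le_card_mul hcover fun j _ => hW.lipschitzOnWith_billiardMap hε0 hε hV hq
    inter_subset_left (A := {θ | cell θ = j}) (fun θ hθ θ' hθ' => ?_) fun x hx => hx.2
  have hshort := abs_sub_le_of_floor_div_eq hρ0 (hθ.trans hθ'.symm)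
  rw [sub_sub_sub_cancel_right] at hshort
  exact hshort.trans hρ

lemma cos_snd_le (hW : IsStableGraph I w W) (hε0 : 0 < ε) (hε : ε < 1 / 2) (hr : 1 ≤ r₀)
    (hη : 0 < η) (hηr : 1 / r₀ + η ≤ 1) (hV : IsPreconnected V)
    (hVW : V ⊆ cutPreimage ε r₀ k₀ W) {x y : Cylinder} (hx : x ∈ V) (hy : y ∈ V)
    {s : Option (Bool × ℕ)} (hs : x.snd ∈ openStrip r₀ k₀ s) :
    Real.cos y.snd ≤ grazing ε ‖latticePoint (-displacement ε y)‖ ^ (1 - (1 / r₀ + η)) *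
      stripWeight η s := by
  obtain ⟨θ, -, -, hvis, hback⟩ := hW.exists_eq_backPoint hε0 hε (hVW hy)
  have hgrazing : Real.cos y.snd ≤ grazing ε ‖latticePoint (-displacement ε y)‖ :=
    (congrArg (fun z : Cylinder => Real.cos z.snd) hback).trans_le
      (cos_backAngle_le_grazing hε0 hε hvis)
  have hstrip : Real.cos y.snd ≤ stripWidth r₀ s :=
    cos_le_stripWidth hV (fun z hz => (hVW hz).1.1)
      (disjoint_left.mpr fun z hz hb => (hVW hz).2 (Or.inr hb)) hx hy hs
  have hr0 : 0 < 1 / r₀ := by positivity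
  refine (le_min hgrazing hstrip).trans <| (min_le_rpow_mul_rpow (grazing_nonneg _ _)
    (stripWidth_nonneg _ _) (a := 1 - (1 / r₀ + η)) (by linarith) (by linarith)).trans ?_
  rw [sub_sub_cancel]
  exact mul_le_mul_of_nonneg_left (stripWidth_rpow_le hr hη s)
    (Real.rpow_nonneg (grazing_nonneg _ _) _)

lemma piece_growth_le (hW : IsStableGraph I w W) (hε0 : 0 < ε) (hε : ε < 1 / 2) (hρ0 : 0 < ρ)
    (hρ : ρ ≤ (1 - 2 * ε) / 4) (hN : ∀ θ ∈ I, |θ - w θ - α₀| ≤ N * ρ) (hr : 1 ≤ r₀)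
    (hη : 0 < η) (hηr : 1 / r₀ + η ≤ 1) (hV : IsPreconnected V)
    (hVW : V ⊆ cutPreimage ε r₀ k₀ W) {x : Cylinder} (hx : x ∈ V) {s : Option (Bool × ℕ)}
    (hs : x.snd ∈ openStrip r₀ k₀ s) (ν : ℝ) :
    ENNReal.ofReal (‖latticePoint (pieceDisplacement ε V)‖ ^ ν) *
      (length (billiardMap ε '' V) / length V) ≤
    (2 * N + 1 : ℕ) * (ENNReal.ofReal (2 / (1 - 2 * ε)) *
      (scattererWeight ε ν (1 - (1 / r₀ + η)) (-displacement ε x) *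
        ENNReal.ofReal (stripWeight η s))) := by
  have hdisp (y : Cylinder) (hy : y ∈ V) : displacement ε y = displacement ε x :=
    displacement_eq_of_isPreconnected hε0 hε hV hVW hy hx
  rw [pieceDisplacement_eq hx hdisp, ← norm_latticePoint_neg]
  obtain ⟨θ, -, -, hvis, -⟩ := hW.exists_eq_backPoint hε0 hε (hVW hx)
  set m := -displacement ε x
  set g := grazing ε ‖latticePoint m‖ ^ (1 - (1 / r₀ + η))
  have hL : 0 < ‖latticePoint m‖ :=
    zero_lt_one.trans_le (one_le_norm_latticePoint hvis.ne_zero)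
  have hlen := hW.length_image_le hε0 hε hρ0 hρ hN hV hVW
    (fun y hy => by rw [hdisp y hy]) (m := m) (q := g * stripWeight η s) fun y hy => by
      have := hW.cos_snd_le hε0 hε hr hη hηr hV hVW hx hy hs
      rwa [hdisp y hy] at this
  rw [← mul_assoc] at hlen
  refine (mul_le_mul_right (ENNReal.div_le_of_le_mul hlen) _).trans_eq ?_
  have hγ : 0 < 1 - 2 * ε := by linarith
  have hg : 0 ≤ g := Real.rpow_nonneg (grazing_nonneg _ _) _
  have hweight : scattererWeight ε ν (1 - (1 / r₀ + η)) m =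
      ENNReal.ofReal (ε * (‖latticePoint m‖ ^ ν / ‖latticePoint m‖) * g) := by
    rw [scattererWeight, Real.rpow_sub_one hL.ne']
  rw [mul_left_comm, hweight, ← ENNReal.ofReal_mul (by positivity),
    ← ENNReal.ofReal_mul (by positivity), ← ENNReal.ofReal_mul (by positivity)]
  congr 2
  field_simp

end IsStableGraph

/-! ### The growth sum -/

/-- The lattice points that are visible, looking back in time, from the points of the graph of `w`
over `I`: the possible values of `-κ` on the preimage of the graph. -/
def visibleScatterers (ε : ℝ) (I : Set ℝ) (w : ℝ → ℝ) : Set (ℤ × ℤ) :=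
  {m | ∃ θ ∈ I, Visible ε (w θ) (θ - w θ) m}

lemma rpow_neg_mul_leafSize {c ε ν : ℝ} (hε : 0 < ε) : ε ^ (-ν) * leafSize c ε ν = c := by
  rw [leafSize, mul_left_comm, ← Real.rpow_add hε, neg_add_cancel, Real.rpow_zero, mul_one]

namespace IsStableGraph

variable {ε r₀ ρ α₀ η ν c : ℝ} {k₀ N : ℕ} {I : Set ℝ} {w : ℝ → ℝ} {V W : Set Cylinder}

lemma exists_piece_label (hW : IsStableGraph I w W) (hε0 : 0 < ε) (hε : ε < 1 / 2)
    (hρ0 : 0 < ρ) (hN : ∀ θ ∈ I, |θ - w θ - α₀| ≤ N * ρ) (hr : 0 < r₀)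
    (hV : V ∈ preimagePieces ε r₀ k₀ W) :
    ∃ θ ∈ I, ∃ (j : Finset.Icc (-(N : ℤ)) N) (m : visibleScatterers ε I w)
      (s : Option (Bool × ℕ)),
      V = connectedComponentIn (cutPreimage ε r₀ k₀ W) (backPoint ε θ (w θ) m) ∧
      backPoint ε θ (w θ) m ∈ V ∧ displacement ε (backPoint ε θ (w θ) m) = -m ∧
      w θ ∈ Ioo (-(π / 2)) (π / 2) ∧ Visible ε (w θ) (θ - w θ) m ∧
      (backPoint ε θ (w θ) m).snd ∈ openStrip r₀ k₀ s ∧ ⌊(θ - w θ - α₀) / ρ⌋ = j := by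
  obtain ⟨x, hx, rfl⟩ := hV
  obtain ⟨θ, hθ, hwθ, hvis, hback⟩ := hW.exists_eq_backPoint hε0 hε hx
  obtain ⟨s, hs⟩ := exists_mem_openStrip hr hx.1.1 (fun h => hx.2 (Or.inl (Or.inl h)))
    fun h => hx.2 (Or.inr h)
  refine ⟨θ, hθ, ⟨_, floor_div_mem_Icc hρ0 (hN θ hθ)⟩, ⟨-displacement ε x, θ, hθ, hvis⟩, s, ?_⟩
  rw [← hback, neg_neg]
  exact ⟨rfl, mem_connectedComponentIn hx, rfl, hwθ, hvis, hs, rfl⟩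

/-- By the connectedness of the preimages over a short part of the leaf, a piece is determined by
its scatterer, its strip and the cell of directions that it maps to. -/
lemma growthSum_le_tsum_mul_tsum (hW : IsStableGraph I w W) (hε0 : 0 < ε) (hε : ε < 1 / 2)
    (hk₀ : 1 ≤ k₀) (hρ0 : 0 < ρ) (hρ : ρ ≤ (1 - 2 * ε) / 4)
    (hN : ∀ θ ∈ I, |θ - w θ - α₀| ≤ N * ρ) (hr : 1 ≤ r₀) (hη : 0 < η)
    (hηr : 1 / r₀ + η ≤ 1) :
    growthSum ε r₀ ν k₀ W ≤ (2 * N + 1 : ℕ) * ((2 * N + 1 : ℕ) *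
      (ENNReal.ofReal (2 / (1 - 2 * ε)) *
        ((∑' m : visibleScatterers ε I w, scattererWeight ε ν (1 - (1 / r₀ + η)) m) *
          ∑' s, ENNReal.ofReal (stripWeight η s)))) := by
  have hr0 : 0 < r₀ := zero_lt_one.trans_le hr
  choose Θ hΘ J M S hV hmem hdisp hwΘ hvis hS hJ using fun V : preimagePieces ε r₀ k₀ W =>
    hW.exists_piece_label hε0 hε hρ0 hN hr0 V.2
  have hinj : Function.Injective fun V => (J V, M V, S V) := fun V₁ V₂ h => by
    simp only [Prod.mk.injEq] at h
    obtain ⟨hj, hm, hs⟩ := h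
    have hshort := abs_sub_le_of_floor_div_eq hρ0 ((hJ V₁).trans (hj ▸ (hJ V₂).symm))
    rw [sub_sub_sub_cancel_right] at hshort
    refine Subtype.ext ((hV V₁).trans (Eq.trans ?_ (hV V₂).symm))
    rw [hm]
    exact hW.connectedComponentIn_backPoint_eq hε0 hε hr0.le hk₀ (hΘ V₁) (hΘ V₂)
      (hshort.trans hρ) (hwΘ V₁) (hwΘ V₂) (hm ▸ hvis V₁) (hvis V₂) (hm ▸ hS V₁) (hs ▸ hS V₂)
  set term : Finset.Icc (-(N : ℤ)) N × visibleScatterers ε I w × Option (Bool × ℕ) → ℝ≥0∞ :=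
    fun p => (2 * N + 1 : ℕ) * (ENNReal.ofReal (2 / (1 - 2 * ε)) *
      (scattererWeight ε ν (1 - (1 / r₀ + η)) p.2.1 * ENNReal.ofReal (stripWeight η p.2.2)))
  calc growthSum ε r₀ ν k₀ W ≤ ∑' V, term (J V, M V, S V) := by
        refine ENNReal.tsum_le_tsum fun V => ?_
        have hVW := (hV V).trans_subset (connectedComponentIn_subset _ _)
        have hpiece := hW.piece_growth_le hε0 hε hρ0 hρ hN hr hη hηr
          (hV V ▸ isPreconnected_connectedComponentIn) hVW (hmem V) (hS V) ν
        rwa [hdisp V, neg_neg] at hpiece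
    _ ≤ ∑' p, term p := ENNReal.tsum_comp_le_tsum_of_injective hinj term
    _ = _ := by
        rw [ENNReal.tsum_prod', tsum_fintype]
        simp only [term, ENNReal.tsum_prod', ENNReal.tsum_mul_left, ENNReal.tsum_mul_right,
          Finset.sum_const, nsmul_eq_mul, Finset.card_univ, Fintype.card_coe, card_Icc_neg]

lemma tsum_visibleScatterers_le {a θ₀ : ℝ} (hW : IsStableGraph I w W) (hε0 : 0 < ε)
    (hε : ε < 1 / 2) (hν : 0 ≤ ν) (hη : 0 < η) (ha : a ≤ 1 - η) (hνa : 2 * ν ≤ a - η)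
    (hc : 0 ≤ c) (hlen : length W ≤ ENNReal.ofReal (leafSize c ε ν)) (hθ₀ : θ₀ ∈ I) :
    ∑' m : visibleScatterers ε I w, scattererWeight ε ν a m ≤
      ENNReal.ofReal (61440 * (c + ε ^ (η / 2))) * (1 + zetaSum (η / 2)) := by
  have hdir (θ : ℝ) (hθ : θ ∈ I) : |θ₀ - w θ₀ - (θ - w θ)| ≤ 2 * c * ε ^ ν := by
    have hle := hW.abs_sub_le (by unfold leafSize; positivity) hlen hθ₀ hθ
    unfold leafSize at hle
    linarith [hW.abs_direction_sub_le hθ₀ hθ]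
  refine tsum_scattererWeight_le (α := θ₀ - w θ₀) hε0 (by linarith) hν hη ha hνa hc ?_ ?_
  · rintro m ⟨θ, hθ, hvis⟩
    exact ⟨hvis.ne_zero, abs_across_le_add (hvis.abs_across_le_one hε0.le hε.le) (hdir θ hθ)⟩
  · rintro m ⟨θ, hθ, hvis⟩ hfar
    obtain ⟨⟨e, hdet, hnorm, hacross⟩, -⟩ := hvis.far hε0 hε hfar
    have he : e ≠ 0 := by
      rintro rfl
      simp at hdet
    refine ⟨e, ⟨he, hnorm, abs_across_le_add hacross (hdir θ hθ)⟩, hdet, ?_⟩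
    calc 3 * ‖latticePoint e‖ ≤ 3 * (4 / ε) := by gcongr
      _ ≤ 36 / ε := by rw [← mul_div_assoc]; gcongr; norm_num
      _ ≤ ‖latticePoint m‖ := hfar

lemma abs_direction_sub_le_seven (hW : IsStableGraph I w W) {θ θ' : ℝ} (hθ : θ ∈ I)
    (hθ' : θ' ∈ I) : |θ - w θ - (θ' - w θ')| ≤ 7 := by
  have hw := hW.mem_Icc θ hθ
  have hw' := hW.mem_Icc θ' hθ'
  have hπ : |w θ - w θ'| ≤ π := abs_le.mpr ⟨by linarith [hw.1, hw'.2], by linarith [hw.2, hw'.1]⟩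
  linarith [hW.abs_direction_sub_le hθ hθ', Real.pi_lt_d2]

end IsStableGraph

/-- The one-step growth sum is at most `K` for every stable graph of length at most `c ε ^ ν`,
whatever the strips and the exponents `r₀`, `ν` that leave the room `η`. As `ε ^ (-ν) δ₀ = c` when
`δ₀ = c ε ^ ν`, the estimate `(*)` is the case `K = C (ε + c)`. -/
def GrowthSumLE (η c ε K : ℝ) : Prop :=
  ∀ (k₀ : ℕ) (r₀ ν : ℝ), 1 ≤ k₀ → 1 < r₀ → 0 ≤ ν → ν ≤ 1 / 2 - 1 / (2 * r₀) - η →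
    ∀ (I : Set ℝ) (w : ℝ → ℝ) (W : Set Cylinder), IsStableGraph I w W →
      length W ≤ ENNReal.ofReal (leafSize c ε ν) → growthSum ε r₀ ν k₀ W ≤ ENNReal.ofReal K

lemma GrowthSumLE.mono {η c ε K K' : ℝ} (h : GrowthSumLE η c ε K) (hK : K ≤ K') :
    GrowthSumLE η c ε K' :=
  fun k₀ r₀ ν hk₀ hr hν0 hν I w W hW hlen =>
    (h k₀ r₀ ν hk₀ hr hν0 hν I w W hW hlen).trans (ENNReal.ofReal_le_ofReal hK)

lemma exists_growthSumLE {η κ : ℝ} (hη : 0 < η) (hκ : κ < 1 / 2) :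
    ∃ C : ℝ, 0 < C ∧ ∀ c ε : ℝ, 0 < c → 0 < ε → ε ≤ κ →
      GrowthSumLE η c ε (C * (c + ε ^ (η / 2))) := by
  have hρ0 : 0 < (1 - 2 * κ) / 4 := by linarith
  set N := ⌈7 / ((1 - 2 * κ) / 4)⌉₊
  have hN : 7 ≤ N * ((1 - 2 * κ) / 4) := (div_le_iff₀ hρ0).mp (Nat.le_ceil _)
  set M : ℝ≥0∞ := (2 * N + 1 : ℕ) * ((2 * N + 1 : ℕ) * (ENNReal.ofReal (2 / (1 - 2 * κ)) *
    (ENNReal.ofReal 61440 * (1 + zetaSum (η / 2)) * (1 + 2 * zetaSum η)))) with hM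
  have hMtop : M ≠ ∞ := by
    have := zetaSum_ne_top hη
    have := zetaSum_ne_top (half_pos hη)
    finiteness
  refine ⟨M.toReal + 1, by positivity, ?_⟩
  intro c ε hc hε0 hε k₀ r₀ ν hk₀ hr hν0 hν I w W hW hlen
  obtain ⟨θ₀, hθ₀⟩ := hW.nonempty
  have hr' : 1 / (2 * r₀) = 1 / r₀ / 2 := by rw [div_div, mul_comm]
  have hr0 : 0 < 1 / r₀ := by positivity
  have hpieces := hW.growthSum_le_tsum_mul_tsum (ν := ν) (η := η) hε0 (by linarith) hk₀ hρ0
    (by linarith) (fun θ hθ => (hW.abs_direction_sub_le_seven hθ hθ₀).trans hN) hr.le hη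
    (by linarith)
  have hscatterers := hW.tsum_visibleScatterers_le (a := 1 - (1 / r₀ + η)) hε0 (by linarith) hν0
    hη (by linarith) (by linarith) hc.le hlen hθ₀
  calc growthSum ε r₀ ν k₀ W
      ≤ (2 * N + 1 : ℕ) * ((2 * N + 1 : ℕ) * (ENNReal.ofReal (2 / (1 - 2 * κ)) *
          (ENNReal.ofReal (61440 * (c + ε ^ (η / 2))) * (1 + zetaSum (η / 2)) *
            (1 + 2 * zetaSum η)))) := by
        rw [← tsum_stripWeight]
        refine hpieces.trans ?_
        gcongr
        linarith
    _ = M * ENNReal.ofReal (c + ε ^ (η / 2)) := by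
        rw [hM, ENNReal.ofReal_mul (p := 61440) (by norm_num)]
        ring
    _ = ENNReal.ofReal (M.toReal * (c + ε ^ (η / 2))) := by
        rw [ENNReal.ofReal_mul ENNReal.toReal_nonneg, ENNReal.ofReal_toReal hMtop]
    _ ≤ ENNReal.ofReal ((M.toReal + 1) * (c + ε ^ (η / 2))) := by
        gcongr
        linarith

lemma exists_growthSumLE_of_le_lt_half {η c εmax : ℝ} (hη : 0 < η) (hc : 0 < c)
    (hεmax : εmax < 1 / 2) :
    ∃ C : ℝ, 0 < C ∧ ∀ ε : ℝ, 0 < ε → ε ≤ εmax → GrowthSumLE η c ε (C * (ε + c)) := by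
  obtain ⟨C, hC, hsum⟩ := exists_growthSumLE hη hεmax
  refine ⟨C * ((c + 1) / c), by positivity, fun ε hε0 hε => (hsum c ε hc hε0 hε).mono ?_⟩
  have hpow : ε ^ (η / 2) ≤ 1 := Real.rpow_le_one hε0.le (by linarith) (by positivity)
  rw [mul_assoc]
  gcongr
  calc c + ε ^ (η / 2) ≤ c + 1 := by gcongr
    _ = (c + 1) / c * c := by field_simp
    _ ≤ (c + 1) / c * (ε + c) := by gcongr; linarith

lemma exists_uniform_growthSumLE_of_small {η : ℝ} (hη : 0 < η) :
    ∃ C : ℝ, 0 < C ∧ ∀ c : ℝ, 0 < c → ∃ ε₀ : ℝ, 0 < ε₀ ∧ ε₀ < 1 / 2 ∧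
      ∀ ε : ℝ, 0 < ε → ε ≤ ε₀ → GrowthSumLE η c ε (C * (ε + c)) := by
  obtain ⟨C, hC, hsum⟩ := exists_growthSumLE hη (κ := 1 / 4) (by norm_num)
  refine ⟨C * 2, by positivity, fun c hc => ⟨min (1 / 4) (c ^ (2 / η)), by positivity,
    (min_le_left _ _).trans_lt (by norm_num), fun ε hε0 hε =>
      (hsum c ε hc hε0 (hε.trans (min_le_left _ _))).mono ?_⟩⟩
  have hpow : ε ^ (η / 2) ≤ c := calc
    ε ^ (η / 2) ≤ (c ^ (2 / η)) ^ (η / 2) := by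
      gcongr
      exact hε.trans (min_le_right _ _)
    _ = c := by rw [← Real.rpow_mul hc.le, div_mul_div_cancel₀ hη.ne', div_self two_ne_zero,
      Real.rpow_one]
  rw [mul_assoc]
  gcongr
  linarith

lemma GrowthSumLE.growthSum_le {η c ε C r₀ ν B : ℝ} {k₀ : ℕ} {W : Set Cylinder}
    (h : GrowthSumLE η c ε (C * (ε + c))) (hk₀ : 1 ≤ k₀) (hr : 1 < r₀) (hν0 : 0 ≤ ν)
    (hν : ν ≤ 1 / 2 - 1 / (2 * r₀) - η) (hε : 0 < ε)
    (hW : IsAdmissibleStableLeaf ε r₀ k₀ B (leafSize c ε ν) W) :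
    growthSum ε r₀ ν k₀ W ≤ ENNReal.ofReal (C * (ε + ε ^ (-ν) * leafSize c ε ν)) := by
  obtain ⟨I, w, hgraph⟩ := hW.exists_isStableGraph
  rw [rpow_neg_mul_leafSize hε]
  exact h k₀ r₀ ν hk₀ hr hν0 hν I w W hgraph hW.2.2.2

end LorentzGas

end

theorem mainTheorem6_general (η : ℝ) (hη : 0 < η) :
    (∀ c : ℝ, 0 < c → ∀ εmax : ℝ, εmax < 1 / 2 → ∃ C : ℝ, 0 < C ∧
      ∀ ε : ℝ, 0 < ε → ε ≤ εmax → LorentzGas.GrowthSumLE η c ε (C * (ε + c))) ∧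
    (∃ C : ℝ, 0 < C ∧ ∀ c : ℝ, 0 < c → ∃ ε₀ : ℝ, 0 < ε₀ ∧ ε₀ < 1 / 2 ∧
      ∀ ε : ℝ, 0 < ε → ε ≤ ε₀ → LorentzGas.GrowthSumLE η c ε (C * (ε + c))) :=
  ⟨fun _ hc _ hεmax => LorentzGas.exists_growthSumLE_of_le_lt_half hη hc hεmax,
    LorentzGas.exists_uniform_growthSumLE_of_small hη⟩

theorem mainTheorem6 (k₀ : ℕ) (hk₀ : 1 ≤ k₀) (B : ℝ) (η : ℝ) (hη : 0 < η) :
    (∀ (c : ℝ), 0 < c → ∀ (εmax : ℝ), εmax < 1 / 2 → ∃ C : ℝ, 0 < C ∧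
      ∀ (r₀ ν ε : ℝ), 1 < r₀ → 0 ≤ ν → ν ≤ 1 / 2 - 1 / (2 * r₀) - η → 0 < ε → ε ≤ εmax →
        ∀ W : Set LorentzGas.Cylinder,
          LorentzGas.IsAdmissibleStableLeaf ε r₀ k₀ B (LorentzGas.leafSize c ε ν) W →
          LorentzGas.growthSum ε r₀ ν k₀ W ≤
            ENNReal.ofReal (C * (ε + ε ^ (-ν) * LorentzGas.leafSize c ε ν))) ∧
    (∃ C : ℝ, 0 < C ∧ ∀ (c : ℝ), 0 < c → ∃ ε₀ : ℝ, 0 < ε₀ ∧ ε₀ < 1 / 2 ∧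
      ∀ (r₀ ν ε : ℝ), 1 < r₀ → 0 ≤ ν → ν ≤ 1 / 2 - 1 / (2 * r₀) - η → 0 < ε → ε ≤ ε₀ →
        ∀ W : Set LorentzGas.Cylinder,
          LorentzGas.IsAdmissibleStableLeaf ε r₀ k₀ B (LorentzGas.leafSize c ε ν) W →
          LorentzGas.growthSum ε r₀ ν k₀ W ≤
            ENNReal.ofReal (C * (ε + ε ^ (-ν) * LorentzGas.leafSize c ε ν))) := by
  obtain ⟨hfixed, C₀, hC₀, huniform⟩ := mainTheorem6_general η hη
  refine ⟨fun c hc εmax hεmax => ?_, C₀, hC₀, fun c hc => ?_⟩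
  · obtain ⟨C, hC, h⟩ := hfixed c hc εmax hεmax
    exact ⟨C, hC, fun r₀ ν ε hr hν0 hν hε0 hε W hW =>
      (h ε hε0 hε).growthSum_le hk₀ hr hν0 hν hε0 hW⟩
  · obtain ⟨ε₀, hε₀, hε₀', h⟩ := huniform c hc
    exact ⟨ε₀, hε₀, hε₀', fun r₀ ν ε hr hν0 hν hε0 hε W hW =>
      (h ε hε0 hε).growthSum_le hk₀ hr hν0 hν hε0 hW⟩
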